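/- **Setting.** Let $G$ be a directed hypergraph on $V=[N]$ with hyperedges $r\in[R]$, $R\ge 1$. Hyperedge $r$ has a weight $w_r>0$, an incidence set $S_r\subseteq[N]$ with $|S_r|\ge 2$, and nonempty head and tail sets $H_r,T_r\subseteq S_r$ (undirected hypergraphs: $H_r=T_r=S_r$); every vertex lies in some $S_r$. Let $D=\mathrm{diag}(d_i)$ with $d_i=\sum_{r:i\in S_r}w_r$, and let $\Psi=\mathrm{diag}(\Psi_{ii})$ with $\Psi_{ii}=|\{r: i\in S_r\}|$. Let $\alpha\in(0,1)$, $p_0\in\mathbb R^N$, $x_0=D^{-1}p_0$ and $W=\frac{\alpha}{1-\alpha}D$. Let $F'_r(A)=\sqrt{w_r}$ if $A\cap H_r\ne\emptyset$ and $A^c\cap T_r\neq\emptyset$, and $F'_r(A)=0$ otherwise; this is a normalized nonnegative submodular function. Denote its Lovász extension by $f'_r$, its base polytope by $B_r$, and put $C_r=\{(y,\varphi):\varphi\ge 0,\ y\in\varphi B_r\}$. Write $\|x\|_W^2=\sum_i W_{ii}x_i^2$. A vector $p$ is a *PageRank vector* if $\alpha(p_0-p)+(1-\alpha)(AD^{-1}p-p)=0$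 for a symmetric matrix $A$ obtained at $x=D^{-1}p$ as follows. Each active hyperedge, i.e. one with $\max_{H_r}x>\min_{T_r}x$, distributes its weight $w_r$ as nonnegative weights over the pairs in $\arg\max_{H_r}x\times\arg\min_{T_r}x$. For $i\ne j$, $A_{ij}$ is the total weight on the unordered pair $\{i,j\}$, and $A_{ii}=d_i-\sum_{j\neq i}A_{ij}$. Let $\Xi$ be the set of minimizers, over all $(y,\varphi)$ with $(y_r,\varphi_r)\in C_r$ for every $r$, of $g(y,\varphi)=\|\sum_r y_r-2Wx_0\|_{W^{-1}}^2+\sum_r\varphi_r^2$, and let $g^*$ be the minimum. Let $d$ and $d_{\Psi W^{-1}}$ be the distances to $\Xi$ in the norms $\big(\sum_r\|y_r\|_{W^{-1}}^2+\|\varphi\|^2\big)^{1/2}$ and $\big(\sum_r\|y_r\|_{\Psi W^{-1}}^2+\|\varphi\|^2\big)^{1/2}$. *Algorithms.* Both start from $(y,\varphi)=0$, and both return $(y,\varphi)$ together with $x=x_0-\frac12W^{-1}\sum_r y_r$. Write $\Pi_{C}(b;W')=\arg\min_{(y,\varphi)\in C}\|y-b\|_{W'}^2+\varphi^2$. Random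 coordinate descent (RCD) draws in each iteration $r\in[R]$ uniformly and independently and sets $(y_r,\varphi_r)\leftarrow\Pi_{C_r}(2Wx_0-\sum_{r'\ne r}y_{r'};W^{-1})$. Alternating projection (AP) sets in each iteration, for all $r$ simultaneously, $\lambda_{r,i}=y_{r,i}-\Psi_{ii}^{-1}\big(\sum_{r'}y_{r',i}-2W_{ii}(x_0)_i\big)$ for $i\in S_r$, then $(y_r,\varphi_r)\leftarrow\Pi_{C_r}(\lambda_r;\Psi W^{-1})$. The projections are computed on the coordinates in $S_r$ by an explicit routine: with $V=W'^{-1}$ and $b'=\frac12V^{-1}b$, sort $\{b'_i\}_{i\in H_r}$ and $\{b'_j\}_{j\in T_r}$, then perform a line search over the breakpoints for $\gamma=\max_{H_r}z$ and $\delta=\min_{T_r}z$ of the minimizer $z$ of $\|z-b'\|_V^2+f'_r(z)^2$; finally $y=b-2Vz$ and $\varphi=2f'_r(z)$. Time is the number of elementary steps on a real RAM: real $+,-,\times,/,\sqrt{\ }$, comparisons, memory accesses, random draws and control steps, including initialization and output. **Statement.** There is a universal constant $C>0$ such that for all such $G,\alpha,p_0$: 1. The QDSFM problem $\min_x\|x-x_0\|_W^2+\sum_r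 f'_r(x)^2$ has exactly one solution, and $p$ is a PageRank vector if and only if $D^{-1}p$ is this solution. Also $\Xi\ne\emptyset$. 2. For every $r$, every positive diagonal $V$ and every $b\in\mathbb R^N$, the projection routine returns exactly $\Pi_{C_r}(b;V^{-1})$, in at most $C\,|S_r|\log|S_r|$ steps. 3. (RCD) All iterates are feasible. For $0<\epsilon\le\frac12$ put $$\mathcal B_\epsilon=C\,N^2\max\Big\{1,9\tfrac{1-\alpha}{\alpha}\Big\}\max_{i,j}\frac{D_{ii}}{D_{jj}}\ \sum_{r}|S_r|\log|S_r|\ \log\frac{\max\{1,\Delta_0\}}{\epsilon},\qquad \Delta_0=g(0)-g^*+d(0,\Xi)^2 .$$ (a) There is a number $K$ of iterations such that running RCD for $K$ iterations takes expected time at most $\mathcal B_\epsilon$, and after any $k\ge K$ iterations $\mathbb E[g-g^*+d^2]\le\epsilon$, $\mathbb E[d]\le\epsilon$, and $\mathbb E\|x-D^{-1}p\|_W^2\le\epsilon$ for the PageRank vector $p$. (b) The expected time until $d((y,\varphi),\Xi)\le\epsilon$ for the first time is at most $\mathcal B_\epsilon$. 4. (AP) All iterates are feasible. For $0<\epsilon\le\frac12$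 there is a number $K$ of iterations such that running AP for $K$ iterations takes time at most $$C\,N^2\max\Big\{1,9\tfrac{1-\alpha}{\alpha}\Big\}\max_{i,j}\frac{\Psi_{jj}D_{ii}}{D_{jj}}\ \sum_{r}|S_r|\log|S_r|\ \log\frac{\max\{1,d_{\Psi W^{-1}}(0,\Xi)\}}{\epsilon},$$ and after any $k\ge K$ iterations $d_{\Psi W^{-1}}((y,\varphi),\Xi)\le\epsilon$ and $\|x-D^{-1}p\|_W\le\epsilon$ for the PageRank vector $p$. In particular, for fixed data and $\epsilon\to0$ the times are $O(\,\cdot\,\log\frac1\epsilon)$ with a universal constant in the $O$: the logarithms are at most $2\log\frac1\epsilon$ as soon as $\epsilon\le1/\max\{1,\Delta_0\}$, respectively $\epsilon\le 1/\max\{1,d_{\Psi W^{-1}}(0,\Xi)\}$. -/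

import Mathlib

open MeasureTheory
open scoped ENNReal Pointwise

noncomputable section

/-! ### Submodular functions, Lovász extension, base polytope -/

/-- A normalized, nonnegative submodular set function on the ground set `[N]`. -/
def IsNormalizedSubmodular {N : ℕ} (F : Finset (Fin N) → ℝ) : Prop :=
  F ∅ = 0 ∧ (∀ A, 0 ≤ F A) ∧ ∀ A B, F (A ∪ B) + F (A ∩ B) ≤ F A + F B

/-- A permutation `i₁, …, i_N` of the coordinates with `x i₁ ≥ x i₂ ≥ ⋯ ≥ x i_N`. -/
def descOrder {N : ℕ} (x : Fin N → ℝ) : Equiv.Perm (Fin N) :=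
  Tuple.sort (fun i => -x i)

/-- The Lovász extension
`f(x) = ∑_{k<N} F({i₁,…,i_k}) (x_{i_k} - x_{i_{k+1}}) + F([N]) x_{i_N}`. -/
def lovasz {N : ℕ} (F : Finset (Fin N) → ℝ) (x : Fin N → ℝ) : ℝ :=
  ∑ k : Fin N, F ((Finset.Iic k).image (descOrder x)) *
    (x (descOrder x k) - if h : k.val + 1 < N then x (descOrder x ⟨k.val + 1, h⟩) else 0)

/-- The base polytope `{y | y(S) ≤ F(S) for all S, y([N]) = F([N])}`. -/
def basePolytope {N : ℕ} (F : Finset (Fin N) → ℝ) : Set (Fin N → ℝ) :=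
  {y | (∀ A : Finset (Fin N), ∑ i ∈ A, y i ≤ F A) ∧ ∑ i, y i = F Finset.univ}

/-- The squared norm `‖x‖_W² = ∑ W_ii x_i²` of a diagonal matrix `W`. -/
def wNormSq {N : ℕ} (W x : Fin N → ℝ) : ℝ := ∑ i, W i * x i ^ 2

/-- The cone `C = {(y, φ) | φ ≥ 0, y ∈ φ B}`. -/
def polyCone {N : ℕ} (F : Finset (Fin N) → ℝ) : Set ((Fin N → ℝ) × ℝ) :=
  {z | 0 ≤ z.2 ∧ z.1 ∈ z.2 • basePolytope F}

/-- `z = Π_C(b; W')`: `z ∈ C` minimizes `‖y - b‖_{W'}² + φ²` over `(y, φ) ∈ C`. -/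
def IsConeProj {N : ℕ} (F : Finset (Fin N) → ℝ) (b W' : Fin N → ℝ)
    (z : (Fin N → ℝ) × ℝ) : Prop :=
  z ∈ polyCone F ∧
    ∀ z' ∈ polyCone F, wNormSq W' (z.1 - b) + z.2 ^ 2 ≤ wNormSq W' (z'.1 - b) + z'.2 ^ 2

/-! ### The QDSFM problem and its dual -/

/-- The QDSFM objective `‖x - a‖_W² + ∑_r f_r(x)²`. -/
def qdsfm {N R : ℕ} (F : Fin R → Finset (Fin N) → ℝ) (W a x : Fin N → ℝ) : ℝ :=
  wNormSq W (x - a) + ∑ r, lovasz (F r) x ^ 2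

/-- Pairs `(y, φ)` with `y = (y_1, …, y_R)`, `y_r ∈ ℝ^N`, and `φ ∈ ℝ^R`. -/
abbrev DualVar (N R : ℕ) : Type := (Fin R → Fin N → ℝ) × (Fin R → ℝ)

/-- The product of the cones. -/
def prodCone {N R : ℕ} (F : Fin R → Finset (Fin N) → ℝ) : Set (DualVar N R) :=
  {z | ∀ r, (z.1 r, z.2 r) ∈ polyCone (F r)}

/-- The dual objective `g(y, φ) = ‖∑_r y_r - 2Wa‖_{W⁻¹}² + ∑_r φ_r²`. -/
def dualObj {N R : ℕ} (W a : Fin N → ℝ) (z : DualVar N R) : ℝ :=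
  wNormSq W⁻¹ (∑ r, z.1 r - 2 • (W * a)) + ∑ r, z.2 r ^ 2

/-- The set `Ξ` of solutions of the dual problem. -/
def dualSol {N R : ℕ} (F : Fin R → Finset (Fin N) → ℝ) (W a : Fin N → ℝ) :
    Set (DualVar N R) :=
  {z | z ∈ prodCone F ∧ IsMinOn (dualObj W a) (prodCone F) z}

/-- The optimal value `g*` of the dual problem. -/
def dualOpt {N R : ℕ} (F : Fin R → Finset (Fin N) → ℝ) (W a : Fin N → ℝ) : ℝ :=
  sInf (dualObj W a '' prodCone F)

/-- The distance `min_{z' ∈ X} √(‖y - y'‖_{I(W')}² + ‖φ - φ'‖²)`. -/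
def dualDist {N R : ℕ} (W' : Fin N → ℝ) (z : DualVar N R) (X : Set (DualVar N R)) : ℝ :=
  sInf ((fun z' : DualVar N R =>
    √(∑ r, wNormSq W' (z.1 r - z'.1 r) + ∑ r, (z.2 r - z'.2 r) ^ 2)) '' X)

/-! ### Directed hypergraphs -/

/-- A directed hypergraph on `[N]` with `R` hyperedges; the hyperedge `r` has incidence set `S r`,
weight `w r`, head set `H r` and tail set `T r`. An undirected hypergraph is the case
`H r = T r = S r`. -/
structure DirHypergraph (N R : ℕ) where
  w : Fin R → ℝ
  S : Fin R → Finset (Fin N)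
  H : Fin R → Finset (Fin N)
  T : Fin R → Finset (Fin N)
  w_pos : ∀ r, 0 < w r
  two_le_card : ∀ r, 2 ≤ (S r).card
  H_sub : ∀ r, H r ⊆ S r
  T_sub : ∀ r, T r ⊆ S r
  H_nonempty : ∀ r, (H r).Nonempty
  T_nonempty : ∀ r, (T r).Nonempty
  covered : ∀ i, ∃ r, i ∈ S r

namespace DirHypergraph

variable {N R : ℕ} (G : DirHypergraph N R)

/-- The degree `d_i = ∑_{r : i ∈ S_r} w_r`; this is also the diagonal entry `D_ii`. -/
def deg (i : Fin N) : ℝ := ∑ r, if i ∈ G.S r then G.w r else 0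

/-- `Ψ_ii`, the number of hyperedges that contain `i`. -/
def psi (i : Fin N) : ℝ := ((Finset.univ.filter fun r => i ∈ G.S r).card : ℝ)

/-- `F_r(A) = 1` if `A ∩ H_r ≠ ∅` and `Aᶜ ∩ T_r ≠ ∅`, and `0` otherwise. -/
def cut (r : Fin R) (A : Finset (Fin N)) : ℝ :=
  open Classical in if (A ∩ G.H r).Nonempty ∧ (Aᶜ ∩ G.T r).Nonempty then 1 else 0

/-- `F'_r = √w_r F_r`, the function whose Lovász extension is `f'_r = √w_r f_r`. -/
def wcut (r : Fin R) (A : Finset (Fin N)) : ℝ := √(G.w r) * G.cut r A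

/-- `W = (α / (1 - α)) D`. -/
def W (α : ℝ) (i : Fin N) : ℝ := α / (1 - α) * G.deg i

/-- `x₀ = D⁻¹ p₀`. -/
def x0 (p₀ : Fin N → ℝ) (i : Fin N) : ℝ := p₀ i / G.deg i

/-! PageRank -/

/-- The hyperedge `r` is active at `x`: `max_{H_r} x > min_{T_r} x`. -/
def Active (x : Fin N → ℝ) (r : Fin R) : Prop := ∃ i ∈ G.H r, ∃ j ∈ G.T r, x j < x i

/-- `argmax_{i ∈ H_r} x_i`. -/
def upSet (x : Fin N → ℝ) (r : Fin R) : Set (Fin N) := {i | i ∈ G.H r ∧ ∀ j ∈ G.H r, x j ≤ x i}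

/-- `argmin_{i ∈ T_r} x_i`. -/
def downSet (x : Fin N → ℝ) (r : Fin R) : Set (Fin N) := {i | i ∈ G.T r ∧ ∀ j ∈ G.T r, x i ≤ x j}

/-- Admissible pairwise weights at `x`: nonnegative, of total `w_r` for an active hyperedge `r`,
and supported on the pairs of `upSet × downSet` of active hyperedges. -/
def Admissible (x : Fin N → ℝ) (c : Fin R → Fin N → Fin N → ℝ) : Prop :=
  (∀ r i j, 0 ≤ c r i j) ∧
  (∀ r, G.Active x r → ∑ i, ∑ j, c r i j = G.w r) ∧
  (∀ r i j, ¬ (G.Active x r ∧ i ∈ G.upSet x r ∧ j ∈ G.downSet x r) → c r i j = 0)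

/-- The off-diagonal entries of the symmetric matrix `A` obtained from pairwise weights; the weight
of `(i, j) ∈ upSet × downSet` is attached to the unordered pair `{i, j}`. -/
def offDiag (c : Fin R → Fin N → Fin N → ℝ) (i j : Fin N) : ℝ := ∑ r, (c r i j + c r j i)

/-- The matrix `A`, with `A_ii = d_i - ∑_{j ≠ i} A_ij`. -/
def diffMatrix (c : Fin R → Fin N → Fin N → ℝ) : Matrix (Fin N) (Fin N) ℝ := fun i j =>
  if i = j then G.deg i - ∑ k ∈ Finset.univ.erase i, offDiag c i k else offDiag c i j

/-- `p` is a PageRank vector `pr(α, p₀)`: a stationary point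
`α (p₀ - p) + (1 - α) (M(p) - p) = 0`, where `M(p) = A D⁻¹ p` for admissible pairwise weights. -/
def IsPageRank (α : ℝ) (p₀ p : Fin N → ℝ) : Prop :=
  ∃ c, G.Admissible (G.x0 p) c ∧
    α • (p₀ - p) + (1 - α) • ((G.diffMatrix c).mulVec (G.x0 p) - p) = 0

end DirHypergraph

/-! ### Step counting on a real RAM -/

/-- A value together with the number of elementary steps spent on computing it. -/
structure Timed (α : Type) where
  val : α
  time : ℕ

instance : Monad Timed where
  pure x := ⟨x, 0⟩
  bind m f := ⟨(f m.val).val, m.time + (f m.val).time⟩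

namespace RAM

/-- One step of control flow (a loop round, a test on a stored flag, a list operation). -/
def tick : Timed Unit := ⟨(), 1⟩

/-- The real operations and the comparison of reals, one step each. -/
def add (x y : ℝ) : Timed ℝ := ⟨x + y, 1⟩
def sub (x y : ℝ) : Timed ℝ := ⟨x - y, 1⟩
def mul (x y : ℝ) : Timed ℝ := ⟨x * y, 1⟩
def div (x y : ℝ) : Timed ℝ := ⟨x / y, 1⟩
def sqrt (x : ℝ) : Timed ℝ := ⟨√x, 1⟩
def le (x y : ℝ) : Timed Bool := ⟨decide (x ≤ y), 1⟩

/-- Reading and writing one memory cell of an array, one step each. -/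
def read {ι : Type} (t : ι → ℝ) (i : ι) : Timed ℝ := ⟨t i, 1⟩
def write {ι : Type} [DecidableEq ι] (t : ι → ℝ) (i : ι) (v : ℝ) : Timed (ι → ℝ) :=
  ⟨Function.update t i v, 1⟩

/-- A fresh array of zeros; one step per cell. -/
def alloc (n : ℕ) : Timed (Fin n → ℝ) := ⟨fun _ => 0, n⟩

/-- `for a in l do s ← f s a`. -/
def forEach {α σ : Type} (f : σ → α → Timed σ) : List α → σ → Timed σ
  | [], s => do tick; pure s
  | a :: l, s => do
    tick
    let s' ← f s a
    forEach f l s'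

/-- Apply a routine to all entries of a list. -/
def mapL {α β : Type} (f : α → Timed β) : List α → Timed (List β)
  | [] => do tick; pure []
  | a :: l => do
    tick
    let b ← f a
    let bs ← mapL f l
    pure (b :: bs)

/-- Split a list into two halves. -/
def split {α : Type} : List α → Timed (List α × List α)
  | [] => do tick; pure ([], [])
  | a :: l => do
    tick
    let p ← split l
    pure (a :: p.2, p.1)

/-- Merge two lists of pairs (key, weight), sorted by key: in ascending order of the keys if
`asc = true`, in descending order otherwise. -/
def merge (asc : Bool) : List (ℝ × ℝ) → List (ℝ × ℝ) → Timed (List (ℝ × ℝ))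
  | [], l => do tick; pure l
  | a :: k, [] => do tick; pure (a :: k)
  | a :: k, b :: l => do
    tick
    let c ← if asc then le a.1 b.1 else le b.1 a.1
    if c then
      let m ← merge asc k (b :: l)
      pure (a :: m)
    else
      let m ← merge asc (a :: k) l
      pure (b :: m)
  termination_by k l => k.length + l.length

/-- Merge sort by key; the first argument bounds the depth of the recursion. -/
def mergeSortAux (asc : Bool) : ℕ → List (ℝ × ℝ) → Timed (List (ℝ × ℝ))
  | 0, l => pure l
  | _ + 1, [] => do tick; pure []
  | _ + 1, [a] => do tick; pure [a]
  | n + 1, a :: b :: l => do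
    tick
    let p ← split (a :: b :: l)
    let k₁ ← mergeSortAux asc n p.1
    let k₂ ← mergeSortAux asc n p.2
    merge asc k₁ k₂

def mergeSort (asc : Bool) (l : List (ℝ × ℝ)) : Timed (List (ℝ × ℝ)) :=
  mergeSortAux asc l.length l

end RAM

/-! ### The exact projection for a directed hyperedge -/

/-- One vertex of the stored list of a hyperedge, with its membership flags for head and tail. -/
structure Entry (N : ℕ) where
  vtx : Fin N
  inH : Bool
  inT : Bool

/-- An entry together with the coordinate `a_i` of the point to be projected and `V_i = 1/W̃_ii`. -/
structure Item (N : ℕ) extends Entry N where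
  a : ℝ
  V : ℝ

/-- An item together with `b_i = a_i / (2 V_i)` and the weight `V_i / w` used by the line search. -/
structure Keyed (N : ℕ) extends Item N where
  b : ℝ
  u : ℝ

namespace Projection

open RAM

/-- Compute `b = ½ V⁻¹ a` and the weights `V / w`. -/
def keys {N : ℕ} (w : ℝ) : List (Item N) → Timed (List (Keyed N)) :=
  mapL fun e => do
    let v2 ← mul 2 e.V
    let b ← div e.a v2
    let u ← div e.V w
    pure ⟨e, b, u⟩

/-- The pairs `(b_i, W_ii)` of the head vertices. -/
def heads {N : ℕ} (l : List (Keyed N)) : Timed (List (ℝ × ℝ)) :=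
  forEach (fun acc e => do
    tick
    pure (if e.inH then (e.b, e.u) :: acc else acc)) l []

/-- The pairs `(b_j, W_jj)` of the tail vertices. -/
def tails {N : ℕ} (l : List (Keyed N)) : Timed (List (ℝ × ℝ)) :=
  forEach (fun acc e => do
    tick
    pure (if e.inT then (e.b, e.u) :: acc else acc)) l []

/-- The final step: move `γ` down by `w_T △ / (w_T w_H + w_T + w_H)` and `δ` up by
`w_H △ / (w_T w_H + w_T + w_H)`, after which the derivative `△` vanishes. -/
def finish (γ δ wH wT Δ : ℝ) : Timed (ℝ × ℝ) := do
  let m ← mul wT wH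
  let m₁ ← add m wT
  let m₂ ← add m₁ wH
  let q ← div Δ m₂
  let s ← mul wT q
  let t ← mul wH q
  let γ' ← sub γ s
  let δ' ← add δ t
  pure (γ', δ')

/-- The derivative `△` after the move from `(γ, δ)` to `(γ', δ')`, where `△` is the derivative at
`(γ, δ)`. -/
def newDeriv (γ δ γ' δ' wH Δ : ℝ) : Timed ℝ := do
  let s ← sub γ γ'
  let t ← sub δ' δ
  let st ← add s t
  let ws ← mul wH s
  let Δ₁ ← sub Δ st
  sub Δ₁ ws

/-- `γ ≤ δ` or `△ ≤ 0`. -/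
def stopTest (γ δ Δ : ℝ) : Timed Bool := do
  let b₁ ← le γ δ
  let b₂ ← le Δ 0
  tick
  pure (b₁ || b₂)

/-- `δ₁ = δ + (γ - γ₁) w_H / w_T`, the partner of the next head breakpoint `γ₁`. -/
def partnerH (γ δ wH wT γ₁ : ℝ) : Timed ℝ := do
  let s ← sub γ γ₁
  let m ← mul s wH
  let q ← div m wT
  add δ q

/-- `γ₂ = γ - (δ₂ - δ) w_T / w_H`, the partner of the next tail breakpoint `δ₂`. -/
def partnerT (γ δ wH wT δ₂ : ℝ) : Timed ℝ := do
  let s ← sub δ₂ δ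
  let m ← mul s wT
  let q ← div m wH
  sub γ q

/-- The line search. The lists hold the head vertices outside `S_H(γ)` (descending in `b`) and the
tail vertices outside `S_T(δ)` (ascending in `b`); `wH`, `wT` and `Δ = △_γ = -△_δ` are tracked.
Vertices with equal `b` are passed one by one, by moves of length zero. -/
def search : List (ℝ × ℝ) → List (ℝ × ℝ) → ℝ → ℝ → ℝ → ℝ → ℝ → Timed (ℝ × ℝ)
  | [], [], γ, δ, wH, wT, Δ => do
    tick
    finish γ δ wH wT Δ
  | h :: hs, [], γ, δ, wH, wT, Δ => do
    tick
    let δ₁ ← partnerH γ δ wH wT h.1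
    let Δ₁ ← newDeriv γ δ h.1 δ₁ wH Δ
    let halt ← stopTest h.1 δ₁ Δ₁
    if halt then finish γ δ wH wT Δ
    else
      let wH' ← add wH h.2
      search hs [] h.1 δ₁ wH' wT Δ₁
  | [], t :: ts, γ, δ, wH, wT, Δ => do
    tick
    let γ₂ ← partnerT γ δ wH wT t.1
    let Δ₂ ← newDeriv γ δ γ₂ t.1 wH Δ
    let halt ← stopTest γ₂ t.1 Δ₂
    if halt then finish γ δ wH wT Δ
    else
      let wT' ← add wT t.2
      search [] ts γ₂ t.1 wH wT' Δ₂
  | h :: hs, t :: ts, γ, δ, wH, wT, Δ => do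
    tick
    let δ₁ ← partnerH γ δ wH wT h.1
    let γ₂ ← partnerT γ δ wH wT t.1
    let first ← le δ₁ t.1
    if first then
      let Δ₁ ← newDeriv γ δ h.1 δ₁ wH Δ
      let halt ← stopTest h.1 δ₁ Δ₁
      if halt then finish γ δ wH wT Δ
      else
        let wH' ← add wH h.2
        search hs (t :: ts) h.1 δ₁ wH' wT Δ₁
    else
      let Δ₂ ← newDeriv γ δ γ₂ t.1 wH Δ
      let halt ← stopTest γ₂ t.1 Δ₂
      if halt then finish γ δ wH wT Δ
      else
        let wT' ← add wT t.2
        search (h :: hs) ts γ₂ t.1 wH wT' Δ₂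
  termination_by hs ts => hs.length + ts.length

/-- `y_i = a_i - 2 V_i z_i`, where `z_i = γ` if `i ∈ H, b_i ≥ γ`, `z_i = δ` if `i ∈ T, b_i ≤ δ`, and
`z_i = b_i` otherwise. -/
def recover {N : ℕ} (γ δ : ℝ) : List (Keyed N) → Timed (List (Fin N × ℝ)) :=
  mapL fun e => do
    let c₁ ← le γ e.b
    let c₂ ← le e.b δ
    tick
    let z := if e.inH && c₁ then γ else if e.inT && c₂ then δ else e.b
    let v2 ← mul 2 e.V
    let m ← mul v2 z
    let y ← sub e.a m
    pure (e.vtx, y)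

/-- The projection of `a` onto the cone of the hyperedge with weight `w`: the vertices of the
hyperedge with the values `y_i`, and `φ = 2 √w f(z)`. If `γ ≤ δ` at the start then `z = b`, that is,
`y = 0` and `φ = 0`. -/
def project {N : ℕ} (w : ℝ) (items : List (Item N)) : Timed (List (Fin N × ℝ) × ℝ) := do
  let ks ← keys w items
  let hs₀ ← heads ks
  let ts₀ ← tails ks
  let hs ← mergeSort false hs₀
  let ts ← mergeSort true ts₀
  tick
  let zero : Timed (List (Fin N × ℝ) × ℝ) := do
    let ys ← mapL (fun e : Keyed N => do tick; pure (e.vtx, (0 : ℝ))) ks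
    pure (ys, 0)
  match hs, ts with
  | h :: hs', t :: ts' =>
    let done ← le h.1 t.1
    if done then zero
    else
      let Δ ← sub h.1 t.1
      let p ← search hs' ts' h.1 t.1 h.2 t.2 Δ
      let ys ← recover p.1 p.2 ks
      let s ← sub p.1 p.2
      let q ← sqrt w
      let m ← mul 2 q
      let φ ← mul m s
      pure (ys, φ)
  | _, _ => zero

/-- The vector in `ℝ^N` with the listed coordinates and zeros elsewhere. -/
def scatter {N : ℕ} (l : List (Fin N × ℝ)) : Fin N → ℝ :=
  l.foldl (fun y p => Function.update y p.1 p.2) 0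

end Projection

/-! ### The RCD and AP methods for hypergraph PageRank -/

/-- Memory of the two methods. Beside the dual variables there are the diagonal of `W`, the vectors
`a = D⁻¹ p₀` and `c = 2 W a`, the diagonal `V` of `Ψ⁻¹ W`, and the running sum `s = ∑_r y_r`. -/
structure Mem (N R : ℕ) where
  W : Fin N → ℝ
  a : Fin N → ℝ
  c : Fin N → ℝ
  V : Fin N → ℝ
  s : Fin N → ℝ
  y : Fin R → Fin N → ℝ
  φ : Fin R → ℝ

/-- What the methods return: the dual variables and the primal vector
`x = a - ½ W⁻¹ ∑_r y_r`. -/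
structure Output (N R : ℕ) where
  dual : DualVar N R
  primal : Fin N → ℝ

namespace DirHypergraph

open RAM

variable {N R : ℕ} (G : DirHypergraph N R)

/-- The stored vertex list of a hyperedge (part of the input). -/
def entries (r : Fin R) : List (Entry N) :=
  ((G.S r).sort (· ≤ ·)).map fun i => ⟨i, decide (i ∈ G.H r), decide (i ∈ G.T r)⟩

/-- Zeros for all `y_{r,i}` with `i ∈ S_r`; one step per cell, only these cells are ever used. -/
def allocY : Timed (Fin R → Fin N → ℝ) := ⟨fun _ _ => 0, ∑ r, (G.S r).card⟩

/-- The arrays of the degrees `d_i` and of the numbers `Ψ_ii`. -/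
def degrees : Timed ((Fin N → ℝ) × (Fin N → ℝ)) := do
  let d₀ ← alloc N
  let k₀ ← alloc N
  forEach (fun p r => do
    let w ← read G.w r
    forEach (fun q (e : Entry N) => do
      let di ← read q.1 e.vtx
      let di' ← add di w
      let d' ← write q.1 e.vtx di'
      let ki ← read q.2 e.vtx
      let ki' ← add ki 1
      let k' ← write q.2 e.vtx ki'
      pure (d', k')) (G.entries r) p) (List.finRange R) (d₀, k₀)

/-- Initialization: `W = α/(1-α) D`, `a = D⁻¹ p₀`, `c = 2 W a`, `V = Ψ⁻¹ W`, `y = 0`, `φ = 0`. -/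
def initMem (α : ℝ) (p₀ : Fin N → ℝ) : Timed (Mem N R) := do
  let dk ← G.degrees
  let W₀ ← alloc N
  let a₀ ← alloc N
  let c₀ ← alloc N
  let V₀ ← alloc N
  let s₀ ← alloc N
  let y₀ ← G.allocY
  let φ₀ ← alloc R
  let α' ← sub 1 α
  let β ← div α α'
  forEach (fun (M : Mem N R) i => do
    let di ← read dk.1 i
    let ki ← read dk.2 i
    let pi ← read p₀ i
    let wi ← mul β di
    let ai ← div pi di
    let wi2 ← mul 2 wi
    let ci ← mul wi2 ai
    let vi ← div wi ki
    let W' ← write M.W i wi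
    let a' ← write M.a i ai
    let c' ← write M.c i ci
    let V' ← write M.V i vi
    pure { M with W := W', a := a', c := c', V := V' })
    (List.finRange N) ⟨W₀, a₀, c₀, V₀, s₀, y₀, φ₀⟩

/-- Replace `(y_r, φ_r)` and update the running sum. -/
def store (r : Fin R) (res : List (Fin N × ℝ) × ℝ) (M : Mem N R) : Timed (Mem N R) := do
  let φ' ← write M.φ r res.2
  forEach (fun (M : Mem N R) (p : Fin N × ℝ) => do
    let yi ← read (M.y r) p.1
    let si ← read M.s p.1
    let si₁ ← sub si yi
    let si₂ ← add si₁ p.2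
    let s' ← write M.s p.1 si₂
    let yr' ← write (M.y r) p.1 p.2
    pure { M with s := s', y := Function.update M.y r yr' }) res.1 { M with φ := φ' }

/-- Iteration of RCD with the hyperedge `r`:
`(y_r, φ_r) ← Π_{C_r}(2Wa - ∑_{r' ≠ r} y_{r'}; W⁻¹)`. -/
def rcdStep (r : Fin R) (M : Mem N R) : Timed (Mem N R) := do
  let items ← mapL (fun e : Entry N => do
    let yi ← read (M.y r) e.vtx
    let si ← read M.s e.vtx
    let ci ← read M.c e.vtx
    let wi ← read M.W e.vtx
    let others ← sub si yi
    let ai ← sub ci others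
    pure (⟨e, ai, wi⟩ : Item N)) (G.entries r)
  let w ← read G.w r
  let res ← Projection.project w items
  store r res M

/-- Iteration of AP: `q ← 2 W⁻¹ ∑_r y_r - 4 a`, then for all `r`:
`λ_{r,i} ← y_{r,i} - ½ (Ψ⁻¹ W q)_i` for `i ∈ S_r` and `(y_r, φ_r) ← Π_{C_r}(λ_r; Ψ W⁻¹)`. -/
def apStep (M : Mem N R) : Timed (Mem N R) := do
  let q₀ ← alloc N
  let q ← forEach (fun (q : Fin N → ℝ) i => do
    let si ← read M.s i
    let wi ← read M.W i
    let ai ← read M.a i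
    let s2 ← mul 2 si
    let sw ← div s2 wi
    let a4 ← mul 4 ai
    let qi ← sub sw a4
    write q i qi) (List.finRange N) q₀
  forEach (fun (M : Mem N R) r => do
    let items ← mapL (fun e : Entry N => do
      let yi ← read (M.y r) e.vtx
      let vi ← read M.V e.vtx
      let qi ← read q e.vtx
      let m ← mul vi qi
      let h ← div m 2
      let li ← sub yi h
      pure (⟨e, li, vi⟩ : Item N)) (G.entries r)
    let w ← read G.w r
    let res ← Projection.project w items
    store r res M) (List.finRange R) M

/-- Return `(y, φ)` and `x = a - ½ W⁻¹ ∑_r y_r`. -/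
def output (M : Mem N R) : Timed (Output N R) := do
  let x₀ ← alloc N
  let x ← forEach (fun (x : Fin N → ℝ) i => do
    let si ← read M.s i
    let wi ← read M.W i
    let ai ← read M.a i
    let w2 ← mul 2 wi
    let q ← div si w2
    let xi ← sub ai q
    write x i xi) (List.finRange N) x₀
  pure ⟨(M.y, M.φ), x⟩

/-- `k` iterations of RCD; iteration `j` picks the hyperedge `ω j` (one step for the draw). -/
def rcdLoop (ω : ℕ → Fin R) : ℕ → Mem N R → Timed (Mem N R)
  | 0, M => pure M
  | k + 1, M => do
    let M' ← rcdLoop ω k M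
    tick
    tick
    G.rcdStep (ω k) M'

/-- `k` iterations of AP. -/
def apLoop : ℕ → Mem N R → Timed (Mem N R)
  | 0, M => pure M
  | k + 1, M => do
    let M' ← apLoop k M
    tick
    G.apStep M'

/-- The RCD method with the exact projection, run for `k` iterations with the draws `ω`. -/
def rcd (α : ℝ) (p₀ : Fin N → ℝ) (ω : ℕ → Fin R) (k : ℕ) : Timed (Output N R) := do
  let M₀ ← G.initMem α p₀
  let M ← G.rcdLoop ω k M₀
  output M

/-- The AP method with the exact projection, run for `k` iterations. -/
def ap (α : ℝ) (p₀ : Fin N → ℝ) (k : ℕ) : Timed (Output N R) := do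
  let M₀ ← G.initMem α p₀
  let M ← G.apLoop k M₀
  output M

/-! ### Quantities of the complexity bounds -/

/-- The dual solution set of the PageRank problem. -/
def prSol (α : ℝ) (p₀ : Fin N → ℝ) : Set (DualVar N R) := dualSol G.wcut (G.W α) (G.x0 p₀)

/-- `g(y, φ) - g*`. -/
def dualGap (α : ℝ) (p₀ : Fin N → ℝ) (z : DualVar N R) : ℝ :=
  dualObj (G.W α) (G.x0 p₀) z - dualOpt G.wcut (G.W α) (G.x0 p₀)

/-- `d((y, φ), Ξ)`, the distance in the norm of `W⁻¹`. -/
def rcdDist (α : ℝ) (p₀ : Fin N → ℝ) (z : DualVar N R) : ℝ :=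
  dualDist (G.W α)⁻¹ z (G.prSol α p₀)

/-- `d_{ΨW⁻¹}((y, φ), Ξ)`. -/
def apDist (α : ℝ) (p₀ : Fin N → ℝ) (z : DualVar N R) : ℝ :=
  dualDist (fun i => G.psi i / G.W α i) z (G.prSol α p₀)

/-- `∑_r |S_r| log |S_r|`. -/
def sortCost : ℝ := ∑ r, ((G.S r).card : ℝ) * Real.log (G.S r).card

/-- `N² max{1, 9 (1-α)/α} max_{i,j} D_ii/D_jj ∑_r |S_r| log |S_r|`. -/
def rcdRate (α : ℝ) : ℝ :=
  (N : ℝ) ^ 2 * max 1 (9 * ((1 - α) / α)) *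
    (⨆ ij : Fin N × Fin N, G.deg ij.1 / G.deg ij.2) * G.sortCost

/-- `N² max{1, 9 (1-α)/α} max_{i,j} Ψ_jj D_ii/D_jj ∑_r |S_r| log |S_r|`. -/
def apRate (α : ℝ) : ℝ :=
  (N : ℝ) ^ 2 * max 1 (9 * ((1 - α) / α)) *
    (⨆ ij : Fin N × Fin N, G.psi ij.2 * G.deg ij.1 / G.deg ij.2) * G.sortCost

end DirHypergraph

/-- The law of a sequence of independent uniform draws from the hyperedges. -/
def uniformDraws (R : ℕ) [NeZero R] : Measure (ℕ → Fin R) :=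
  Measure.infinitePi fun _ => (PMF.uniformOfFintype (Fin R)).toMeasure

end

/-!
The set function `F'_r` has Lovász extension `f'_r(x) = √w_r (max_{H_r} x - min_{T_r} x)⁺`
(`lovasz_wcut`), and its cone `C_r` consists of the transports from tails to heads of total mass
at most `√w_r φ` (`mem_polyCone_wcut`). With these descriptions everything becomes elementary.

*Duality.* The dual objective attains its minimum on the cones because `y_r` is controlled by
`φ_r` (`dualSol_nonempty`). First-order optimality says that each block `y_r` of a dual solution
is a subgradient of `f'_r²` at `x = x₀ - ½ W⁻¹ ∑_r y_r` (`isDualPair_of_mem_dualSol`), and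
subgradients that sum to `-2 W (x - x₀)` make `x` the unique primal minimizer (`qdsfm_growth`,
`isMinOn_iff_eq_primalOf`). A subgradient is the same as a transport between the extreme vertices
`argmin_{T_r} x` and `argmax_{H_r} x`, that is, the flux of admissible pairwise weights; so the
PageRank equation is the stationarity condition of the primal problem (`isPageRank_iff`).

*Error bound.* Membership in the solution set `Ξ` depends only on `∑_r y_r` and `φ`. Given a
feasible point and a solution, rescale the blocks to the `φ` of the solution and then correct the
sum of the blocks. For the correction, regard the blocks as flows in a network with two extra
nodes per hyperedge: the difference of two flows contains an acyclic flow with the same net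
outflows (`exists_acyclic_flow`), and the inflow at a node of an acyclic flow is at most the total
supply. Hence no coordinate changes, in total over `r`, by more than the `ℓ¹` distance of the sums
up to a constant (`exists_reroute_cone`). This gives `d² ≤ 99 κ (g - g*)` with `κ` the condition
number of the respective method (`exists_dualSol_near`, `error_const_le`).

*Convergence.* The three-point inequality for projections, applied to the blocks, gives `∑_r (g -
g* + d²)(z⁺ʳ) ≤ R (g - g* + d²)(z) - (g - g*)(z)` for the possible RCD iterations (`rcd_descent`)
and `d₊² + (g₊ - g*) ≤ d²` for AP (`ap_descent`). With the error bound, the potential `g - g* +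
d²` contracts in the mean by `1 - 1 / (100 κ R)`, and the squared distance of AP by `1 - 1 / (100
κ)`.

*Projection.* The minimizer of `‖z - b'‖_V² + f'_r(z)²` clamps the heads at `γ` and the tails at
`δ`, where the mass removed on either side equals `γ - δ` (`isDualPair_of_clamp`). The line search
lowers `γ` and raises `δ` from breakpoint to breakpoint, keeping the masses moved on both sides
equal, until they reach `γ - δ` (`search_balanced`). Sorting dominates the number of steps
(`project_time_le`).

*Time.* The memory of each method carries the dual point, its block sum and constants (`MemInv`),
so an iteration costs a constant times the sorting costs of the hyperedges it treats. The draw of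
an iteration is independent of the memory before it (`lintegral_draw_mem`); this yields the
expected decay of the potential and the expected time. In the bound for the hitting time, an
iteration is charged with the probability that the distance still exceeds `ε`, which decays
geometrically (`lintegral_hitting_time_le`).
-/

/-! ### The cut function, its cone and its Lovász extension -/

namespace DirHypergraph

variable {N R : ℕ} (G : DirHypergraph N R)

/-- `max_{i ∈ H_r} x_i`. -/
noncomputable def headMax (r : Fin R) (x : Fin N → ℝ) : ℝ := (G.H r).sup' (G.H_nonempty r) x

/-- `min_{i ∈ T_r} x_i`. -/
noncomputable def tailMin (r : Fin R) (x : Fin N → ℝ) : ℝ := (G.T r).inf' (G.T_nonempty r) x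

/-- `√w_r (max_{H_r} x - min_{T_r} x)⁺`, the closed form of the Lovász extension `f'_r`. -/
noncomputable def spread (r : Fin R) (x : Fin N → ℝ) : ℝ :=
  √(G.w r) * max 0 (G.headMax r x - G.tailMin r x)

/-- The cone `C_r` described by linear inequalities: `y` is a transport from tails to heads of total
mass at most `√w_r φ`. -/
def InCone (r : Fin R) (y : Fin N → ℝ) (φ : ℝ) : Prop :=
  0 ≤ φ ∧ (∀ i ∉ G.H r, y i ≤ 0) ∧ (∀ i ∉ G.T r, 0 ≤ y i) ∧ ∑ i, y i = 0 ∧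
    ∑ i, max (y i) 0 ≤ √(G.w r) * φ

theorem le_headMax {r : Fin R} {x : Fin N → ℝ} {i : Fin N} (hi : i ∈ G.H r) :
    x i ≤ G.headMax r x := Finset.le_sup' x hi

theorem tailMin_le {r : Fin R} {x : Fin N → ℝ} {i : Fin N} (hi : i ∈ G.T r) :
    G.tailMin r x ≤ x i := Finset.inf'_le x hi

theorem exists_headMax (r : Fin R) (x : Fin N → ℝ) : ∃ i ∈ G.H r, G.headMax r x = x i :=
  Finset.exists_mem_eq_sup' _ _

theorem exists_tailMin (r : Fin R) (x : Fin N → ℝ) : ∃ i ∈ G.T r, G.tailMin r x = x i :=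
  Finset.exists_mem_eq_inf' _ _

theorem spread_nonneg (r : Fin R) (x : Fin N → ℝ) : 0 ≤ G.spread r x :=
  mul_nonneg (Real.sqrt_nonneg _) (le_max_left _ _)

theorem isNormalizedSubmodular_wcut (r : Fin R) : IsNormalizedSubmodular (G.wcut r) := by
  refine ⟨by simp [wcut, cut], fun A => ?_, fun A B => ?_⟩
  · unfold wcut cut
    split_ifs <;> simp
  · have key : G.cut r (A ∪ B) + G.cut r (A ∩ B) ≤ G.cut r A + G.cut r B := by
      -- if `A ∪ B` and `A ∩ B` are both cut, then so are `A` and `B`; if one is, then so is one of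
      -- `A` and `B`
      have h1 : ((A ∪ B) ∩ G.H r).Nonempty ↔ (A ∩ G.H r).Nonempty ∨ (B ∩ G.H r).Nonempty := by
        rw [Finset.union_inter_distrib_right, Finset.union_nonempty]
      have h2 : ((A ∩ B)ᶜ ∩ G.T r).Nonempty ↔ (Aᶜ ∩ G.T r).Nonempty ∨ (Bᶜ ∩ G.T r).Nonempty := by
        rw [Finset.compl_inter, Finset.union_inter_distrib_right, Finset.union_nonempty]
      have h3 : ((A ∪ B)ᶜ ∩ G.T r).Nonempty →
          (Aᶜ ∩ G.T r).Nonempty ∧ (Bᶜ ∩ G.T r).Nonempty := by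
        rintro ⟨i, hi⟩
        simp only [Finset.mem_inter, Finset.mem_compl, Finset.mem_union, not_or] at hi
        exact ⟨⟨i, by simp [hi]⟩, ⟨i, by simp [hi]⟩⟩
      have h4 : ((A ∩ B) ∩ G.H r).Nonempty → (A ∩ G.H r).Nonempty ∧ (B ∩ G.H r).Nonempty := by
        rintro ⟨i, hi⟩
        simp only [Finset.mem_inter] at hi
        exact ⟨⟨i, by simp [hi]⟩, ⟨i, by simp [hi]⟩⟩
      unfold cut
      by_cases ha₁ : (A ∩ G.H r).Nonempty <;> by_cases ha₂ : (Aᶜ ∩ G.T r).Nonempty <;>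
        by_cases hb₁ : (B ∩ G.H r).Nonempty <;> by_cases hb₂ : (Bᶜ ∩ G.T r).Nonempty <;>
        simp only [ha₁, ha₂, hb₁, hb₂, and_true, and_false, if_true, if_false, or_true,
          or_false, imp_false, iff_true, iff_false]
          at h1 h2 h3 h4 ⊢ <;> split_ifs <;> first | (norm_num; done) | simp_all
    have := mul_le_mul_of_nonneg_left key (Real.sqrt_nonneg (G.w r))
    simp only [wcut]
    linarith

theorem wcut_le (r : Fin R) (A : Finset (Fin N)) : G.wcut r A ≤ √(G.w r) := by
  unfold wcut cut
  split_ifs <;> simp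

theorem mem_basePolytope_wcut {r : Fin R} {y : Fin N → ℝ} :
    y ∈ basePolytope (G.wcut r) ↔ (∀ i ∉ G.H r, y i ≤ 0) ∧ (∀ i ∉ G.T r, 0 ≤ y i) ∧
      ∑ i, y i = 0 ∧ ∑ i, max (y i) 0 ≤ √(G.w r) := by
  have huniv : G.wcut r Finset.univ = 0 := by simp [wcut, cut]
  constructor
  · rintro ⟨h, h0⟩
    rw [huniv] at h0
    refine ⟨fun i hi => ?_, fun i hi => ?_, h0, ?_⟩
    · have := h {i}
      have hz : G.wcut r {i} = 0 := by simp [wcut, cut, Finset.singleton_inter_of_notMem hi]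
      simpa [hz] using this
    · have := h {i}ᶜ
      have hz : G.wcut r {i}ᶜ = 0 := by simp [wcut, cut, Finset.singleton_inter_of_notMem hi]
      have h2 := Finset.sum_add_sum_compl {i} y
      rw [hz] at this
      simp only [Finset.sum_singleton] at h2
      linarith
    · have := (h (Finset.univ.filter fun i => 0 < y i)).trans (G.wcut_le r _)
      refine le_of_eq_of_le ?_ this
      rw [Finset.sum_filter]
      refine Finset.sum_congr rfl fun i _ => ?_
      split_ifs with hi
      · exact max_eq_left hi.le
      · exact max_eq_right (not_lt.1 hi)
  · rintro ⟨h1, h2, h3, h4⟩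
    refine ⟨fun A => ?_, by rw [huniv, h3]⟩
    by_cases hA : (A ∩ G.H r).Nonempty ∧ (Aᶜ ∩ G.T r).Nonempty
    · have hw : G.wcut r A = √(G.w r) := by simp [wcut, cut, hA]
      rw [hw]
      calc ∑ i ∈ A, y i ≤ ∑ i ∈ A, max (y i) 0 := Finset.sum_le_sum fun i _ => le_max_left _ _
        _ ≤ ∑ i, max (y i) 0 := Finset.sum_le_sum_of_subset_of_nonneg (Finset.subset_univ _)
            fun i _ _ => le_max_right _ _
        _ ≤ _ := h4
    · have hw : G.wcut r A = 0 := by simp only [wcut, cut, if_neg hA, mul_zero]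
      rw [hw]
      rw [not_and_or, Finset.not_nonempty_iff_eq_empty, Finset.not_nonempty_iff_eq_empty] at hA
      rcases hA with hA | hA
      · refine Finset.sum_nonpos fun i hi => h1 i fun hH => ?_
        have : i ∈ A ∩ G.H r := Finset.mem_inter.2 ⟨hi, hH⟩
        simp [hA] at this
      · have := Finset.sum_add_sum_compl A y
        have hc : 0 ≤ ∑ i ∈ Aᶜ, y i := by
          refine Finset.sum_nonneg fun i hi => h2 i fun hT => ?_
          have : i ∈ Aᶜ ∩ G.T r := Finset.mem_inter.2 ⟨hi, hT⟩
          simp [hA] at this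
        linarith

theorem inCone_zero (r : Fin R) {φ : ℝ} (hφ : 0 ≤ φ) : G.InCone r 0 φ :=
  ⟨hφ, by simp, by simp, by simp, by simpa using mul_nonneg (Real.sqrt_nonneg _) hφ⟩

variable {G}

theorem InCone.smul {r : Fin R} {y : Fin N → ℝ} {φ c : ℝ} (h : G.InCone r y φ) (hc : 0 ≤ c) :
    G.InCone r (c • y) (c * φ) := by
  obtain ⟨h0, h1, h2, h3, h4⟩ := h
  refine ⟨mul_nonneg hc h0, fun i hi => mul_nonpos_of_nonneg_of_nonpos hc (h1 i hi),
    fun i hi => mul_nonneg hc (h2 i hi), ?_, ?_⟩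
  · simp [← Finset.mul_sum, h3]
  · have : ∀ i, max ((c • y) i) 0 = c * max (y i) 0 := fun i => by
      simp [mul_max_of_nonneg _ _ hc]
    simp only [this, ← Finset.mul_sum]
    nlinarith

theorem InCone.add {r : Fin R} {y y' : Fin N → ℝ} {φ φ' : ℝ} (h : G.InCone r y φ)
    (h' : G.InCone r y' φ') : G.InCone r (y + y') (φ + φ') := by
  obtain ⟨h0, h1, h2, h3, h4⟩ := h
  obtain ⟨h0', h1', h2', h3', h4'⟩ := h'
  refine ⟨add_nonneg h0 h0', fun i hi => add_nonpos (h1 i hi) (h1' i hi),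
    fun i hi => add_nonneg (h2 i hi) (h2' i hi), ?_, ?_⟩
  · simp [Finset.sum_add_distrib, h3, h3']
  · have : ∑ i, max ((y + y') i) 0 ≤ ∑ i, (max (y i) 0 + max (y' i) 0) :=
      Finset.sum_le_sum fun i _ => max_le (add_le_add (le_max_left _ _) (le_max_left _ _))
        (add_nonneg (le_max_right _ _) (le_max_right _ _))
    rw [Finset.sum_add_distrib] at this
    linarith

/-- For `φ = 0` the transported mass is zero. -/
theorem InCone.eq_zero {r : Fin R} {y : Fin N → ℝ} (h : G.InCone r y 0) : y = 0 := by
  obtain ⟨-, -, -, h3, h4⟩ := h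
  have hle : ∑ i, max (y i) 0 ≤ 0 := by simpa using h4
  have hz := (Finset.sum_eq_zero_iff_of_nonneg (fun i _ => le_max_right (y i) 0)).1
    (le_antisymm hle (Finset.sum_nonneg fun i _ => le_max_right (y i) 0))
  have hn : ∀ i, y i ≤ 0 := fun i => (le_max_left _ _).trans (hz i (Finset.mem_univ i)).le
  funext i
  exact (Finset.sum_eq_zero_iff_of_nonpos (fun i _ => hn i)).1 h3 i (Finset.mem_univ i)

variable (G) in
theorem mem_polyCone_wcut {r : Fin R} {y : Fin N → ℝ} {φ : ℝ} :
    (y, φ) ∈ polyCone (G.wcut r) ↔ G.InCone r y φ := by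
  have hbase : ∀ v, v ∈ basePolytope (G.wcut r) ↔ G.InCone r v 1 := fun v => by
    rw [mem_basePolytope_wcut]; simp [InCone]
  constructor
  · rintro ⟨h0, v, hv, hy⟩
    have := ((hbase v).1 hv).smul h0
    rw [mul_one] at this
    exact (show φ • v = y from hy) ▸ this
  · intro h
    refine ⟨h.1, ?_⟩
    rcases h.1.eq_or_lt with h0 | h0
    · have hy : y = 0 := InCone.eq_zero (h0 ▸ h)
      exact ⟨0, (hbase 0).2 (G.inCone_zero r zero_le_one), by simp [hy]⟩
    · refine ⟨φ⁻¹ • y, (hbase _).2 ?_, by simp [smul_smul, h0.ne']⟩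
      have := h.smul (inv_nonneg.2 h.1)
      rwa [inv_mul_cancel₀ h0.ne'] at this

theorem InCone.sum_neg {r : Fin R} {y : Fin N → ℝ} {φ : ℝ} (h : G.InCone r y φ) :
    ∑ i, max (-y i) 0 = ∑ i, max (y i) 0 := by
  have : ∑ i, (max (y i) 0 - max (-y i) 0) = 0 := by
    refine Eq.trans (Finset.sum_congr rfl fun i _ => ?_) h.2.2.2.1
    rcases le_total (y i) 0 with hi | hi
    · rw [max_eq_right hi, max_eq_left (by linarith)]; ring
    · rw [max_eq_left hi, max_eq_right (by linarith)]; ring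
  rw [Finset.sum_sub_distrib] at this
  linarith

/-- The deficit in `⟨y, x⟩ ≤ m (max_H x - min_T x)`, where `m` is the transported mass. -/
theorem InCone.pairing_eq {r : Fin R} {y : Fin N → ℝ} {φ : ℝ} (h : G.InCone r y φ)
    (x : Fin N → ℝ) :
    ∑ i, y i * x i = (∑ i, max (y i) 0) * (G.headMax r x - G.tailMin r x)
      - ∑ i, max (y i) 0 * (G.headMax r x - x i)
      - ∑ i, max (-y i) 0 * (x i - G.tailMin r x) := by
  have h1 : ∑ i, max (-y i) 0 * (x i - G.tailMin r x)
      = ∑ i, max (-y i) 0 * x i - (∑ i, max (y i) 0) * G.tailMin r x := by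
    rw [← h.sum_neg, Finset.sum_mul, ← Finset.sum_sub_distrib]
    exact Finset.sum_congr rfl fun i _ => by ring
  have h2 : ∑ i, max (y i) 0 * (G.headMax r x - x i)
      = (∑ i, max (y i) 0) * G.headMax r x - ∑ i, max (y i) 0 * x i := by
    rw [Finset.sum_mul, ← Finset.sum_sub_distrib]
    exact Finset.sum_congr rfl fun i _ => by ring
  have h3 : ∑ i, y i * x i = ∑ i, max (y i) 0 * x i - ∑ i, max (-y i) 0 * x i := by
    rw [← Finset.sum_sub_distrib]
    refine Finset.sum_congr rfl fun i _ => ?_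
    rcases le_total (y i) 0 with hi | hi
    · rw [max_eq_right hi, max_eq_left (by linarith)]; ring
    · rw [max_eq_left hi, max_eq_right (by linarith)]; ring
  rw [h1, h2, h3]; ring

theorem InCone.posPart_deficit_nonneg {r : Fin R} {y : Fin N → ℝ} {φ : ℝ} (h : G.InCone r y φ)
    (x : Fin N → ℝ) (i : Fin N) : 0 ≤ max (y i) 0 * (G.headMax r x - x i) := by
  by_cases hi : i ∈ G.H r
  · exact mul_nonneg (le_max_right _ _) (sub_nonneg.2 (G.le_headMax hi))
  · rw [max_eq_right (h.2.1 i hi), zero_mul]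

theorem InCone.negPart_deficit_nonneg {r : Fin R} {y : Fin N → ℝ} {φ : ℝ} (h : G.InCone r y φ)
    (x : Fin N → ℝ) (i : Fin N) : 0 ≤ max (-y i) 0 * (x i - G.tailMin r x) := by
  by_cases hi : i ∈ G.T r
  · exact mul_nonneg (le_max_right _ _) (sub_nonneg.2 (G.tailMin_le hi))
  · rw [max_eq_right (by linarith [h.2.2.1 i hi]), zero_mul]

/-- `⟨y, x⟩ ≤ φ f'_r(x)` on the cone: the Lovász extension is the support function of `B_r`. -/
theorem InCone.pairing_le {r : Fin R} {y : Fin N → ℝ} {φ : ℝ} (h : G.InCone r y φ)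
    (x : Fin N → ℝ) : ∑ i, y i * x i ≤ φ * G.spread r x := by
  have h1 := Finset.sum_nonneg fun i (_ : i ∈ Finset.univ) => h.posPart_deficit_nonneg x i
  have h2 := Finset.sum_nonneg fun i (_ : i ∈ Finset.univ) => h.negPart_deficit_nonneg x i
  have hm : 0 ≤ ∑ i, max (y i) 0 := Finset.sum_nonneg fun i _ => le_max_right _ _
  rw [h.pairing_eq x]
  have h3 := mul_le_mul_of_nonneg_left (le_max_right 0 (G.headMax r x - G.tailMin r x)) hm
  have h4 := mul_le_mul_of_nonneg_right h.2.2.2.2 (le_max_left 0 (G.headMax r x - G.tailMin r x))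
  unfold spread
  nlinarith

variable (G)

/-- In the order of descending coordinates the sets `{i₁, …, i_k}` cut by `r` are those with
`p ≤ k < q`, where `i_p` is the first head and `i_q` the last tail, so the sum telescopes. -/
theorem lovasz_wcut (r : Fin R) (x : Fin N → ℝ) : lovasz (G.wcut r) x = G.spread r x := by
  set σ := descOrder x with hσ
  have hanti : Antitone (x ∘ σ) := by
    intro a b hab
    have := Tuple.monotone_sort (fun i => -x i) hab
    simpa [hσ, descOrder] using this
  -- positions of the first head and of the last tail
  obtain ⟨p, hpH, hp⟩ : ∃ p, σ p ∈ G.H r ∧ ∀ k, σ k ∈ G.H r → p ≤ k := by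
    have hne : (Finset.univ.filter fun k => σ k ∈ G.H r).Nonempty := by
      obtain ⟨i, hi⟩ := G.H_nonempty r
      exact ⟨σ.symm i, by simpa using hi⟩
    refine ⟨_, (Finset.mem_filter.1 (Finset.min'_mem _ hne)).2, fun k hk => ?_⟩
    exact Finset.min'_le _ _ (by simpa using hk)
  obtain ⟨q, hqT, hq⟩ : ∃ q, σ q ∈ G.T r ∧ ∀ k, σ k ∈ G.T r → k ≤ q := by
    have hne : (Finset.univ.filter fun k => σ k ∈ G.T r).Nonempty := by
      obtain ⟨i, hi⟩ := G.T_nonempty r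
      exact ⟨σ.symm i, by simpa using hi⟩
    refine ⟨_, (Finset.mem_filter.1 (Finset.max'_mem _ hne)).2, fun k hk => ?_⟩
    exact Finset.le_max' _ _ (by simpa using hk)
  have hmax : G.headMax r x = x (σ p) := by
    refine le_antisymm (Finset.sup'_le _ _ fun i hi => ?_) (G.le_headMax hpH)
    have := hanti (hp (σ.symm i) (by simpa using hi))
    simpa using this
  have hmin : G.tailMin r x = x (σ q) := by
    refine le_antisymm (G.tailMin_le hqT) (Finset.le_inf' _ _ fun i hi => ?_)
    have := hanti (hq (σ.symm i) (by simpa using hi))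
    simpa using this
  have hcut : ∀ k : Fin N, G.wcut r ((Finset.Iic k).image σ)
      = if p ≤ k ∧ k < q then √(G.w r) else 0 := by
    intro k
    have e1 : ((Finset.Iic k).image σ ∩ G.H r).Nonempty ↔ p ≤ k := by
      constructor
      · rintro ⟨i, hi⟩
        simp only [Finset.mem_inter, Finset.mem_image, Finset.mem_Iic] at hi
        obtain ⟨⟨j, hj, rfl⟩, hi⟩ := hi
        exact (hp j hi).trans hj
      · intro h
        exact ⟨σ p, by simpa [hpH] using h⟩
    have e2 : (((Finset.Iic k).image σ)ᶜ ∩ G.T r).Nonempty ↔ k < q := by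
      constructor
      · rintro ⟨i, hi⟩
        simp only [Finset.mem_inter, Finset.mem_compl, Finset.mem_image, Finset.mem_Iic,
          not_exists, not_and] at hi
        obtain ⟨hi, hT⟩ := hi
        have h1 := hq (σ.symm i) (by simpa using hT)
        by_contra h2
        exact hi (σ.symm i) (h1.trans (not_lt.1 h2)) (by simp)
      · intro h
        exact ⟨σ q, by simpa [hqT] using h⟩
    simp only [wcut, cut, e1, e2]
    split_ifs <;> simp
  -- the coordinates in descending order, continued by `0` as in the last term of `lovasz`
  let g : ℕ → ℝ := fun k => if h : k < N then x (σ ⟨k, h⟩) else 0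
  have hsum : lovasz (G.wcut r) x
      = ∑ k ∈ Finset.range N,
          if (p : ℕ) ≤ k ∧ k < (q : ℕ) then √(G.w r) * (g k - g (k + 1)) else 0 := by
    rw [Finset.sum_range]
    unfold lovasz
    refine Finset.sum_congr rfl fun k _ => ?_
    rw [← hσ, hcut k]
    have : g k = x (σ k) := by simp [g]
    rw [this]
    simp only [Fin.le_def, Fin.lt_def, g]
    split_ifs <;> simp
  have hfil : (Finset.range N).filter (fun k => (p : ℕ) ≤ k ∧ k < (q : ℕ))
      = Finset.Ico (p : ℕ) q := by
    ext k
    simp only [Finset.mem_filter, Finset.mem_range, Finset.mem_Ico]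
    have := q.2
    omega
  rw [hsum, ← Finset.sum_filter, hfil, ← Finset.mul_sum, spread, hmax, hmin]
  congr 1
  have hgp : g p = x (σ p) := by simp [g]
  have hgq : g q = x (σ q) := by simp [g]
  rcases le_total p q with h | h
  · have h1 := hanti h
    simp only [Function.comp] at h1
    rw [max_eq_right (by linarith), ← hgp, ← hgq]
    have := Finset.sum_Ico_sub g (show (p : ℕ) ≤ q from h)
    rw [← neg_inj, ← Finset.sum_neg_distrib]
    simpa using this
  · have h1 := hanti h
    simp only [Function.comp] at h1
    rw [max_eq_left (by linarith), Finset.Ico_eq_empty (by simpa using h), Finset.sum_empty]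

end DirHypergraph

/-! ### Optimality conditions and duality -/

/-- The quadratic part `‖∑_r h_r‖_{W⁻¹}² + ‖h_φ‖²` of the dual objective. -/
noncomputable def dualQuad {N R : ℕ} (W : Fin N → ℝ) (h : DualVar N R) : ℝ :=
  wNormSq W⁻¹ (∑ r, h.1 r) + ∑ r, h.2 r ^ 2

/-- The primal vector `x = a - ½ W⁻¹ ∑_r y_r` of a dual point. -/
noncomputable def primalOf {N R : ℕ} (W a : Fin N → ℝ) (z : DualVar N R) (i : Fin N) : ℝ :=
  a i - (∑ r, z.1 r i) / (2 * W i)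

/-- The derivative of the dual objective at `z` in the direction `h`; its gradient in the block
`y_r` is `-4 x`. -/
noncomputable def dualLin {N R : ℕ} (W a : Fin N → ℝ) (z h : DualVar N R) : ℝ :=
  ∑ r, (-4 * ∑ i, h.1 r i * primalOf W a z i + 2 * z.2 r * h.2 r)

theorem wNormSq_nonneg {N : ℕ} {W : Fin N → ℝ} (hW : ∀ i, 0 < W i) (x : Fin N → ℝ) :
    0 ≤ wNormSq W x := Finset.sum_nonneg fun i _ => mul_nonneg (hW i).le (sq_nonneg _)

theorem pi_inv_pos {N : ℕ} {W : Fin N → ℝ} (hW : ∀ i, 0 < W i) (i : Fin N) : 0 < W⁻¹ i :=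
  inv_pos.2 (hW i)

theorem dualQuad_nonneg {N R : ℕ} {W : Fin N → ℝ} (hW : ∀ i, 0 < W i) (h : DualVar N R) :
    0 ≤ dualQuad W h :=
  add_nonneg (wNormSq_nonneg (pi_inv_pos hW) _) (Finset.sum_nonneg fun _ _ => sq_nonneg _)

theorem dualObj_add {N R : ℕ} {W : Fin N → ℝ} (hW : ∀ i, 0 < W i) (a : Fin N → ℝ)
    (z h : DualVar N R) (t : ℝ) :
    dualObj W a (z + t • h) = dualObj W a z + t * dualLin W a z h + t ^ 2 * dualQuad W h := by
  have hy : wNormSq W⁻¹ (∑ r, (z + t • h).1 r - 2 • (W * a))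
      = wNormSq W⁻¹ (∑ r, z.1 r - 2 • (W * a))
        + t * (-4 * ∑ i, (∑ r, h.1 r i) * primalOf W a z i)
        + t ^ 2 * wNormSq W⁻¹ (∑ r, h.1 r) := by
    unfold wNormSq
    rw [Finset.mul_sum, Finset.mul_sum, Finset.mul_sum, ← Finset.sum_add_distrib,
      ← Finset.sum_add_distrib]
    refine Finset.sum_congr rfl fun i _ => ?_
    have hi := (hW i).ne'
    simp only [Prod.fst_add, Prod.smul_fst, Pi.add_apply, Pi.smul_apply, Pi.sub_apply,
      Finset.sum_apply, Finset.sum_add_distrib, smul_eq_mul, nsmul_eq_mul, Pi.mul_apply,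
      Pi.inv_apply, primalOf, ← Finset.mul_sum, Pi.ofNat_apply, Nat.cast_ofNat]
    field_simp
    ring
  have hφ : ∑ r, (z + t • h).2 r ^ 2
      = ∑ r, z.2 r ^ 2 + t * ∑ r, 2 * z.2 r * h.2 r + t ^ 2 * ∑ r, h.2 r ^ 2 := by
    rw [Finset.mul_sum, Finset.mul_sum, ← Finset.sum_add_distrib, ← Finset.sum_add_distrib]
    refine Finset.sum_congr rfl fun r _ => ?_
    simp only [Prod.snd_add, Prod.smul_snd, Pi.add_apply, Pi.smul_apply, smul_eq_mul]
    ring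
  have hL : dualLin W a z h = -4 * ∑ i, (∑ r, h.1 r i) * primalOf W a z i
      + ∑ r, 2 * z.2 r * h.2 r := by
    unfold dualLin
    rw [Finset.sum_add_distrib, ← Finset.mul_sum, Finset.sum_comm]
    simp only [Finset.sum_mul]
  unfold dualObj dualQuad
  rw [hy, hφ, hL]
  ring

theorem dualObj_eq {N R : ℕ} {W : Fin N → ℝ} (hW : ∀ i, 0 < W i) (a : Fin N → ℝ)
    (z z' : DualVar N R) :
    dualObj W a z' = dualObj W a z + dualLin W a z (z' - z) + dualQuad W (z' - z) := by
  have := dualObj_add hW a z (z' - z) 1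
  simpa using this

/-- A quadratic in `t` that is nonnegative on `(0, 1]` and vanishes at `0` has nonnegative slope at
`0`. -/
theorem slope_nonneg_of_quadratic_nonneg {L Q : ℝ}
    (h : ∀ t, 0 < t → t ≤ 1 → 0 ≤ t * L + t ^ 2 * Q) : 0 ≤ L := by
  by_contra hL
  push Not at hL
  have hq : 0 < |Q| + 1 := by positivity
  set t := min 1 (-L / (2 * (|Q| + 1))) with ht
  have ht0 : 0 < t := lt_min one_pos (div_pos (by linarith) (by linarith))
  have h1 := h t ht0 (min_le_left _ _)
  have h2 : t * (2 * (|Q| + 1)) ≤ -L := by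
    have := min_le_right 1 (-L / (2 * (|Q| + 1)))
    rwa [← ht, le_div_iff₀ (by linarith)] at this
  have h3 : t * Q ≤ t * |Q| := mul_le_mul_of_nonneg_left (le_abs_self Q) ht0.le
  have h4 : 0 ≤ L + t * Q := by
    have : 0 ≤ t * (L + t * Q) := by nlinarith
    exact nonneg_of_mul_nonneg_right this ht0
  nlinarith

namespace DirHypergraph

variable {N R : ℕ} (G : DirHypergraph N R)

theorem mem_prodCone_wcut {z : DualVar N R} :
    z ∈ prodCone G.wcut ↔ ∀ r, G.InCone r (z.1 r) (z.2 r) :=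
  forall_congr' fun _ => G.mem_polyCone_wcut

theorem zero_mem_prodCone : (0 : DualVar N R) ∈ prodCone G.wcut :=
  G.mem_prodCone_wcut.2 fun r => G.inCone_zero r le_rfl

theorem segment_mem_prodCone {z z' : DualVar N R} (hz : z ∈ prodCone G.wcut)
    (hz' : z' ∈ prodCone G.wcut) {t : ℝ} (h0 : 0 ≤ t) (h1 : t ≤ 1) :
    z + t • (z' - z) ∈ prodCone G.wcut := by
  rw [mem_prodCone_wcut] at *
  intro r
  have := ((hz r).smul (sub_nonneg.2 h1)).add ((hz' r).smul h0)
  convert this using 1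
  · funext i
    simp
    ring
  · simp
    ring

section Dual

variable {W : Fin N → ℝ} (a : Fin N → ℝ)

/-- First-order optimality of a dual solution. -/
theorem dualLin_nonneg_of_mem_dualSol (hW : ∀ i, 0 < W i) {z z' : DualVar N R}
    (hz : z ∈ dualSol G.wcut W a) (hz' : z' ∈ prodCone G.wcut) : 0 ≤ dualLin W a z (z' - z) := by
  refine slope_nonneg_of_quadratic_nonneg (Q := dualQuad W (z' - z)) fun t h0 h1 => ?_
  have := hz.2 (G.segment_mem_prodCone hz.1 hz' h0.le h1)
  simp only [Set.mem_ofPred_eq] at this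
  rw [dualObj_add hW] at this
  linarith

/-- The dual objective grows at least like its quadratic part away from a solution. -/
theorem dualQuad_le_of_mem_dualSol (hW : ∀ i, 0 < W i) {z z' : DualVar N R}
    (hz : z ∈ dualSol G.wcut W a) (hz' : z' ∈ prodCone G.wcut) :
    dualQuad W (z' - z) ≤ dualObj W a z' - dualObj W a z := by
  have := G.dualLin_nonneg_of_mem_dualSol a hW hz hz'
  rw [dualObj_eq hW a z z']
  linarith

theorem isClosed_prodCone : IsClosed (prodCone G.wcut) := by
  have : prodCone G.wcut = ⋂ r, {z : DualVar N R | G.InCone r (z.1 r) (z.2 r)} := by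
    ext z
    simp [mem_prodCone_wcut]
  rw [this]
  refine isClosed_iInter fun r => ?_
  simp only [InCone, Set.ofPred_and, Set.ofPred_forall]
  refine (isClosed_le (by fun_prop) (by fun_prop)).inter
    ((isClosed_iInter fun i => isClosed_iInter fun _ =>
      isClosed_le (by fun_prop) (by fun_prop)).inter
    ((isClosed_iInter fun i => isClosed_iInter fun _ =>
      isClosed_le (by fun_prop) (by fun_prop)).inter
    ((isClosed_eq (by fun_prop) (by fun_prop)).inter (isClosed_le (by fun_prop) (by fun_prop)))))

theorem InCone.abs_apply_le {G : DirHypergraph N R} {r : Fin R} {y : Fin N → ℝ} {φ : ℝ}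
    (h : G.InCone r y φ) (i : Fin N) : |y i| ≤ √(G.w r) * φ := by
  have h1 : max (y i) 0 ≤ ∑ i, max (y i) 0 :=
    Finset.single_le_sum (f := fun i => max (y i) 0) (fun i _ => le_max_right _ _)
      (Finset.mem_univ i)
  have h2 : max (-y i) 0 ≤ ∑ i, max (-y i) 0 :=
    Finset.single_le_sum (f := fun i => max (-y i) 0) (fun i _ => le_max_right _ _)
      (Finset.mem_univ i)
  rw [h.sum_neg] at h2
  exact abs_le.2 ⟨by linarith [le_max_left (-y i) 0, h.2.2.2.2],
    by linarith [le_max_left (y i) 0, h.2.2.2.2]⟩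

/-- On the cones the dual objective is coercive, since `‖y_r‖` is controlled by `φ_r`. -/
theorem dualSol_nonempty (hW : ∀ i, 0 < W i) : (dualSol G.wcut W a).Nonempty := by
  have hcont : Continuous (dualObj (R := R) W a) := by
    unfold dualObj wNormSq
    simp only [Pi.sub_apply, Finset.sum_apply]
    fun_prop
  set K := prodCone G.wcut ∩
    {z : DualVar N R | dualObj W a z ≤ dualObj W a (0 : DualVar N R)} with hK
  have hKc : IsClosed K := G.isClosed_prodCone.inter (isClosed_le hcont continuous_const)
  set c := √(dualObj W a (0 : DualVar N R)) with hc
  have hφ : ∀ z ∈ K, ∀ r, |z.2 r| ≤ c := by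
    rintro z ⟨-, hz⟩ r
    refine Real.abs_le_sqrt (le_trans ?_ hz)
    have h1 : z.2 r ^ 2 ≤ ∑ r, z.2 r ^ 2 :=
      Finset.single_le_sum (f := fun r => z.2 r ^ 2) (fun r _ => sq_nonneg _) (Finset.mem_univ r)
    have h2 := wNormSq_nonneg (pi_inv_pos hW) (∑ r, z.1 r - 2 • (W * a))
    unfold dualObj
    linarith
  have hc0 : 0 ≤ c := Real.sqrt_nonneg _
  set s := ∑ r, √(G.w r) with hs
  have hs0 : 0 ≤ s := Finset.sum_nonneg fun r _ => Real.sqrt_nonneg _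
  have hb : Bornology.IsBounded K := by
    refine (Metric.isBounded_closedBall (x := (0 : DualVar N R)) (r := max (s * c) c)).subset ?_
    intro z hz
    rw [Metric.mem_closedBall, dist_zero_right, Prod.norm_def]
    refine max_le_max ?_ ?_
    · refine (pi_norm_le_iff_of_nonneg (by positivity)).2 fun r =>
        (pi_norm_le_iff_of_nonneg (by positivity)).2 fun i => ?_
      have h1 := (G.mem_prodCone_wcut.1 hz.1 r).abs_apply_le i
      have h2 : √(G.w r) ≤ s := Finset.single_le_sum (f := fun r => √(G.w r))
        (fun r _ => Real.sqrt_nonneg _) (Finset.mem_univ r)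
      have h3 := (le_abs_self _).trans (hφ z hz r)
      have h4 := (G.mem_prodCone_wcut.1 hz.1 r).1
      rw [Real.norm_eq_abs]
      exact h1.trans (mul_le_mul h2 h3 h4 hs0)
    · exact (pi_norm_le_iff_of_nonneg hc0).2 fun r => hφ z hz r
  obtain ⟨z, hz, hmin⟩ := (Metric.isCompact_of_isClosed_isBounded hKc hb).exists_isMinOn
    ⟨0, G.zero_mem_prodCone, le_refl (dualObj W a 0)⟩ hcont.continuousOn
  refine ⟨z, hz.1, fun z' hz' => ?_⟩
  by_cases h : dualObj W a z' ≤ dualObj W a (0 : DualVar N R)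
  · exact hmin ⟨hz', h⟩
  · exact hz.2.trans (not_le.1 h).le

end Dual

/-- `y` is a subgradient of `f'_r²` at `x`: it lies in `2 f'_r(x) B_r` and attains the maximum
`2 f'_r(x)²` of `⟨·, x⟩` there. -/
def IsDualPair (r : Fin R) (x y : Fin N → ℝ) : Prop :=
  G.InCone r y (2 * G.spread r x) ∧ ∑ i, y i * x i = 2 * G.spread r x ^ 2

variable {G}

/-- The stationarity condition `-2 W (x - a) ∈ ∑_r ∂ f'_r(x)²` makes `x` a minimizer, with quadratic
growth. -/
theorem qdsfm_growth {W a x : Fin N → ℝ} {y : Fin R → Fin N → ℝ}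
    (hy : ∀ r, G.IsDualPair r x (y r)) (hsum : ∀ i, ∑ r, y r i = -2 * W i * (x i - a i))
    (x' : Fin N → ℝ) :
    qdsfm G.wcut W a x + wNormSq W (x' - x) ≤ qdsfm G.wcut W a x' := by
  have h1 : ∀ r, G.spread r x ^ 2 + ∑ i, y r i * (x' i - x i) ≤ G.spread r x' ^ 2 := by
    intro r
    have h2 := (hy r).1.pairing_le x'
    have h3 := (hy r).2
    simp only [mul_sub, Finset.sum_sub_distrib]
    -- `⟨y, x'⟩ ≤ 2 f(x) f(x') ≤ f(x)² + f(x')²`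
    nlinarith [sq_nonneg (G.spread r x - G.spread r x')]
  have h4 := Finset.sum_le_sum fun r (_ : r ∈ Finset.univ) => h1 r
  rw [Finset.sum_add_distrib, Finset.sum_comm] at h4
  simp only [← Finset.sum_mul, hsum] at h4
  have h5 : wNormSq W (x' - a) = wNormSq W (x - a) + wNormSq W (x' - x)
      - ∑ i, -2 * W i * (x i - a i) * (x' i - x i) := by
    unfold wNormSq
    rw [← Finset.sum_add_distrib, ← Finset.sum_sub_distrib]
    refine Finset.sum_congr rfl fun i _ => ?_
    simp only [Pi.sub_apply]
    ring
  unfold qdsfm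
  simp only [lovasz_wcut]
  linarith

variable (G)

/-- The blocks of a dual solution are subgradients at the primal vector: minimality over the cone
`C_r` says that `-4 x` paired with `C_r` is bounded below by `-2 φ_r φ`, with equality at the
block. -/
theorem isDualPair_of_mem_dualSol {W : Fin N → ℝ} (hW : ∀ i, 0 < W i) (a : Fin N → ℝ)
    {z : DualVar N R} (hz : z ∈ dualSol G.wcut W a) (r : Fin R) :
    z.2 r = 2 * G.spread r (primalOf W a z) ∧ G.IsDualPair r (primalOf W a z) (z.1 r) := by
  set x := primalOf W a z with hx
  have hzc := G.mem_prodCone_wcut.1 hz.1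
  -- variation of the block `r` alone
  have hvar : ∀ v φ, G.InCone r v φ →
      0 ≤ -4 * (∑ i, v i * x i - ∑ i, z.1 r i * x i) + 2 * z.2 r * (φ - z.2 r) := by
    intro v φ hv
    have hmem : ((Function.update z.1 r v, Function.update z.2 r φ) : DualVar N R)
        ∈ prodCone G.wcut := by
      refine G.mem_prodCone_wcut.2 fun s => ?_
      by_cases hs : s = r
      · subst hs; simpa using hv
      · simpa [hs] using hzc s
    have := G.dualLin_nonneg_of_mem_dualSol a hW hz hmem
    unfold dualLin at this
    rw [Finset.sum_eq_single r] at this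
    · simpa [sub_mul, Finset.sum_sub_distrib, ← hx] using this
    · intro s _ hs
      simp [hs]
    · simp
  -- the points `0` and `2 z_r` of the ray of `z_r` give equality along the ray
  have h0 := hvar 0 0 (G.inCone_zero r le_rfl)
  have h2 := hvar ((2 : ℝ) • z.1 r) (2 * z.2 r) ((hzc r).smul (by norm_num))
  simp only [Pi.zero_apply, zero_mul, Finset.sum_const_zero] at h0
  simp only [Pi.smul_apply, smul_eq_mul, mul_assoc, ← Finset.mul_sum] at h2
  have hpair : 2 * ∑ i, z.1 r i * x i = z.2 r ^ 2 := by nlinarith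
  have hφ0 := (hzc r).1
  have hf0 := G.spread_nonneg r x
  -- testing with a single edge from an `argmin` tail to an `argmax` head
  have hge : 2 * G.spread r x ≤ z.2 r := by
    by_cases hΔ : G.headMax r x - G.tailMin r x ≤ 0
    · have : G.spread r x = 0 := by simp [spread, max_eq_left hΔ]
      linarith
    obtain ⟨i, hi, hxi⟩ := G.exists_headMax r x
    obtain ⟨j, hj, hxj⟩ := G.exists_tailMin r x
    have hij : i ≠ j := by
      rintro rfl
      exact hΔ (by linarith)
    have hs : G.spread r x = √(G.w r) * (x i - x j) := by
      rw [spread, max_eq_right (not_le.1 hΔ).le, hxi, hxj]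
    set v : Fin N → ℝ := √(G.w r) • (Pi.single i 1 - Pi.single j 1) with hv
    have hvc : G.InCone r v 1 := by
      have hw := Real.sqrt_nonneg (G.w r)
      refine ⟨zero_le_one, fun k hk => ?_, fun k hk => ?_, ?_, ?_⟩
      · have : k ≠ i := fun h => hk (h ▸ hi)
        by_cases hkj : k = j
        · subst hkj; simp [hv, this]
        · simp [hv, this, hkj]
      · have : k ≠ j := fun h => hk (h ▸ hj)
        by_cases hki : k = i
        · subst hki; simp [hv, this]
        · simp [hv, this, hki]
      · simp [hv, ← Finset.mul_sum]
      · have : ∀ k, max (v k) 0 ≤ (Pi.single i √(G.w r) : Fin N → ℝ) k := by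
          intro k
          by_cases hki : k = i
          · subst hki; simp [hv, hij]
          · by_cases hkj : k = j
            · subst hkj; simp [hv, hki]
            · simp [hv, hki, hkj]
        refine (Finset.sum_le_sum fun k _ => this k).trans ?_
        simp
    have hpv : ∑ k, v k * x k = √(G.w r) * (x i - x j) := by
      simp only [hv, Pi.smul_apply, Pi.sub_apply, smul_eq_mul, mul_assoc, sub_mul,
        ← Finset.mul_sum, Finset.sum_sub_distrib]
      simp [Pi.single_apply]
    have := hvar v 1 hvc
    rw [hpv, ← hs] at this
    nlinarith
  have hle := (hzc r).pairing_le x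
  have heq : z.2 r = 2 * G.spread r x := by
    refine le_antisymm ?_ hge
    rcases hφ0.eq_or_lt with h | h
    · rw [← h]; linarith
    · nlinarith
  refine ⟨heq, heq ▸ hzc r, ?_⟩
  rw [heq] at hpair
  linarith

/-- The stationarity condition of the primal problem holds for `primalOf` by its definition. -/
theorem sum_of_primalOf {W : Fin N → ℝ} (hW : ∀ i, 0 < W i) (a : Fin N → ℝ) (z : DualVar N R)
    (i : Fin N) : ∑ r, z.1 r i = -2 * W i * (primalOf W a z i - a i) := by
  have := (hW i).ne'
  unfold primalOf
  field_simp
  ring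

/-- Strong duality: the primal vector of any dual solution is the unique primal solution. -/
theorem isMinOn_iff_eq_primalOf {W : Fin N → ℝ} (hW : ∀ i, 0 < W i) (a : Fin N → ℝ)
    {z : DualVar N R} (hz : z ∈ dualSol G.wcut W a) (x : Fin N → ℝ) :
    IsMinOn (qdsfm G.wcut W a) Set.univ x ↔ x = primalOf W a z := by
  have hg := qdsfm_growth (W := W) (a := a)
    (fun r => (G.isDualPair_of_mem_dualSol hW a hz r).2) (sum_of_primalOf hW a z)
  constructor
  · intro h
    have h1 : qdsfm G.wcut W a x ≤ qdsfm G.wcut W a (primalOf W a z) := h (Set.mem_univ _)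
    have h2 := hg x
    have h3 : wNormSq W (x - primalOf W a z) = 0 :=
      le_antisymm (by linarith) (wNormSq_nonneg hW _)
    funext i
    have h4 := (Finset.sum_eq_zero_iff_of_nonneg
      (fun i _ => mul_nonneg (hW i).le (sq_nonneg _))).1 h3 i (Finset.mem_univ i)
    rcases mul_eq_zero.1 h4 with h5 | h5
    · exact absurd h5 (hW i).ne'
    · have := pow_eq_zero_iff (two_ne_zero) |>.1 h5
      simpa [sub_eq_zero] using this
  · rintro rfl x' -
    have := hg x'
    have h2 := wNormSq_nonneg hW (x' - primalOf W a z)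
    show qdsfm _ _ _ _ ≤ qdsfm _ _ _ _
    linarith

end DirHypergraph

/-! ### PageRank vectors -/

namespace DirHypergraph

variable {N R : ℕ} (G : DirHypergraph N R)

theorem deg_pos (i : Fin N) : 0 < G.deg i := by
  obtain ⟨r, hr⟩ := G.covered i
  refine Finset.sum_pos' (fun r _ => ?_) ⟨r, Finset.mem_univ r, by simp [hr, G.w_pos r]⟩
  split_ifs
  · exact (G.w_pos r).le
  · exact le_rfl

theorem W_pos {α : ℝ} (h0 : 0 < α) (h1 : α < 1) (i : Fin N) : 0 < G.W α i :=
  mul_pos (div_pos h0 (sub_pos.2 h1)) (G.deg_pos i)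

/-- `max_{H_r} x - min_{T_r} x`. -/
noncomputable def gap (r : Fin R) (x : Fin N → ℝ) : ℝ := G.headMax r x - G.tailMin r x

theorem active_iff {x : Fin N → ℝ} {r : Fin R} : G.Active x r ↔ 0 < G.gap r x := by
  constructor
  · rintro ⟨i, hi, j, hj, h⟩
    have := G.le_headMax (x := x) hi
    have := G.tailMin_le (x := x) hj
    unfold gap
    linarith
  · intro h
    obtain ⟨i, hi, hxi⟩ := G.exists_headMax r x
    obtain ⟨j, hj, hxj⟩ := G.exists_tailMin r x
    refine ⟨i, hi, j, hj, ?_⟩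
    unfold gap at h
    linarith

theorem spread_of_active {x : Fin N → ℝ} {r : Fin R} (h : G.Active x r) :
    G.spread r x = √(G.w r) * G.gap r x := by
  rw [active_iff] at h
  unfold gap at *
  rw [spread, max_eq_right h.le]

theorem spread_of_not_active {x : Fin N → ℝ} {r : Fin R} (h : ¬ G.Active x r) :
    G.spread r x = 0 := by
  rw [active_iff, not_lt] at h
  unfold gap at *
  rw [spread, max_eq_left h, mul_zero]

theorem mem_upSet_iff {x : Fin N → ℝ} {r : Fin R} {i : Fin N} :
    i ∈ G.upSet x r ↔ i ∈ G.H r ∧ x i = G.headMax r x := by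
  refine and_congr_right fun hi => ⟨fun h => ?_, fun h j hj => h ▸ G.le_headMax hj⟩
  exact le_antisymm (G.le_headMax hi) (Finset.sup'_le _ _ h)

theorem mem_downSet_iff {x : Fin N → ℝ} {r : Fin R} {i : Fin N} :
    i ∈ G.downSet x r ↔ i ∈ G.T r ∧ x i = G.tailMin r x := by
  refine and_congr_right fun hi => ⟨fun h => ?_, fun h j hj => h ▸ G.tailMin_le hj⟩
  exact le_antisymm (Finset.le_inf' _ _ h) (G.tailMin_le hi)

/-- The net inflow of `i` when the weight `c i j` is transported from `j` to `i`. -/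
def flux (c : Fin N → Fin N → ℝ) (i : Fin N) : ℝ := ∑ j, (c i j - c j i)

theorem diffMatrix_mulVec (c : Fin R → Fin N → Fin N → ℝ) (x : Fin N → ℝ) (i : Fin N) :
    (G.diffMatrix c).mulVec x i
      = G.deg i * x i + ∑ j, offDiag c i j * (x j - x i) := by
  unfold Matrix.mulVec dotProduct diffMatrix
  rw [← Finset.add_sum_erase _ _ (Finset.mem_univ i),
    ← Finset.add_sum_erase _ (fun j => offDiag c i j * (x j - x i)) (Finset.mem_univ i)]
  beta_reduce
  rw [if_pos rfl, sub_self, mul_zero, zero_add, sub_mul, Finset.sum_mul]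
  simp only [mul_sub, Finset.sum_sub_distrib]
  have : ∑ j ∈ Finset.univ.erase i,
      (if i = j then G.deg i - ∑ k ∈ Finset.univ.erase i, offDiag c i k else offDiag c i j) * x j
      = ∑ j ∈ Finset.univ.erase i, offDiag c i j * x j :=
    Finset.sum_congr rfl fun j hj => by rw [if_neg (Finset.ne_of_mem_erase hj).symm]
  rw [this]
  ring

variable {G}

theorem Admissible.mul_sub {x : Fin N → ℝ} {c : Fin R → Fin N → Fin N → ℝ}
    (hc : G.Admissible x c) (r : Fin R) (i j : Fin N) :
    c r i j * (x i - x j) = c r i j * G.gap r x := by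
  by_cases h : G.Active x r ∧ i ∈ G.upSet x r ∧ j ∈ G.downSet x r
  · rw [(G.mem_upSet_iff.1 h.2.1).2, (G.mem_downSet_iff.1 h.2.2).2, gap]
  · simp [hc.2.2 r i j h]

/-- The stationarity equation of PageRank in terms of the fluxes of the pairwise weights. -/
theorem Admissible.stationary_iff {α : ℝ} (h1 : α < 1) {p₀ p : Fin N → ℝ}
    {c : Fin R → Fin N → Fin N → ℝ} (hc : G.Admissible (G.x0 p) c) :
    α • (p₀ - p) + (1 - α) • ((G.diffMatrix c).mulVec (G.x0 p) - p) = 0 ↔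
      ∀ i, ∑ r, 2 * G.gap r (G.x0 p) * flux (c r) i
        = -2 * G.W α i * (G.x0 p i - G.x0 p₀ i) := by
  rw [funext_iff]
  refine forall_congr' fun i => ?_
  have hd := (G.deg_pos i).ne'
  have h1' : (1 - α) ≠ 0 := by linarith
  have hp : ∀ q : Fin N → ℝ, G.deg i * G.x0 q i = q i := fun q => by
    unfold x0; field_simp
  have hA : (G.diffMatrix c).mulVec (G.x0 p) i - p i
      = -∑ r, G.gap r (G.x0 p) * flux (c r) i := by
    rw [diffMatrix_mulVec, hp, add_sub_cancel_left, ← Finset.sum_neg_distrib]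
    unfold offDiag flux
    simp only [Finset.sum_mul]
    rw [Finset.sum_comm]
    refine Finset.sum_congr rfl fun r _ => ?_
    rw [Finset.mul_sum, ← Finset.sum_neg_distrib]
    refine Finset.sum_congr rfl fun j _ => ?_
    have e1 := hc.mul_sub r i j
    have e2 := hc.mul_sub r j i
    linear_combination -e1 + e2
  have hW : G.W α i * (G.x0 p i - G.x0 p₀ i) = α / (1 - α) * (p i - p₀ i) := by
    unfold W
    rw [mul_assoc, _root_.mul_sub, hp, hp]
  have hs : ∑ r, 2 * G.gap r (G.x0 p) * flux (c r) i
      = 2 * ∑ r, G.gap r (G.x0 p) * flux (c r) i := by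
    rw [Finset.mul_sum]
    exact Finset.sum_congr rfl fun r _ => by ring
  simp only [Pi.add_apply, Pi.smul_apply, Pi.sub_apply, smul_eq_mul, Pi.zero_apply]
  rw [hA, hs, mul_assoc (-2), hW]
  constructor
  · intro h
    field_simp
    linarith
  · intro h
    field_simp at h
    linarith

/-- The flux of admissible weights, scaled by `2 (max_{H_r} x - min_{T_r} x)`, is a subgradient of
`f'_r²` at `x`. -/
theorem Admissible.isDualPair {x : Fin N → ℝ} {c : Fin R → Fin N → Fin N → ℝ}
    (hc : G.Admissible x c) (r : Fin R) :
    G.IsDualPair r x (fun i => 2 * G.gap r x * flux (c r) i) := by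
  by_cases ha : G.Active x r
  · have hg := G.active_iff.1 ha
    have hsw := Real.mul_self_sqrt (G.w_pos r).le
    have hcomm : ∑ i, ∑ j, c r j i = ∑ i, ∑ j, c r i j := Finset.sum_comm
    have htot := hc.2.1 r ha
    refine ⟨⟨by linarith [G.spread_nonneg r x], fun i hi => ?_, fun i hi => ?_, ?_, ?_⟩, ?_⟩
    · refine mul_nonpos_of_nonneg_of_nonpos (by linarith) (Finset.sum_nonpos fun j _ => ?_)
      rw [hc.2.2 r i j fun h => hi h.2.1.1]
      linarith [hc.1 r j i]
    · refine mul_nonneg (by linarith) (Finset.sum_nonneg fun j _ => ?_)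
      rw [hc.2.2 r j i fun h => hi h.2.2.1]
      linarith [hc.1 r i j]
    · simp only [flux, ← Finset.mul_sum, Finset.sum_sub_distrib]
      rw [hcomm, sub_self, mul_zero]
    · have : ∀ i, max (2 * G.gap r x * flux (c r) i) 0 ≤ 2 * G.gap r x * ∑ j, c r i j := by
        intro i
        have hi : 0 ≤ ∑ j, c r i j := Finset.sum_nonneg fun j _ => hc.1 r i j
        refine max_le (mul_le_mul_of_nonneg_left ?_ (by linarith)) (by positivity)
        exact Finset.sum_le_sum fun j _ => by linarith [hc.1 r j i]
      refine (Finset.sum_le_sum fun i _ => this i).trans (le_of_eq ?_)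
      rw [← Finset.mul_sum, htot, G.spread_of_active ha]
      linear_combination (-2 * G.gap r x) * hsw
    · have e : ∑ i, 2 * G.gap r x * flux (c r) i * x i
          = 2 * G.gap r x * ∑ i, ∑ j, c r i j * (x i - x j) := by
        have : ∑ i, ∑ j, c r j i * x i = ∑ i, ∑ j, c r i j * x j := Finset.sum_comm
        simp only [flux, _root_.mul_sub, Finset.sum_sub_distrib, Finset.mul_sum, Finset.sum_mul,
          sub_mul] at this ⊢
        simp only [mul_assoc, ← Finset.mul_sum] at this ⊢
        rw [this]
      rw [e]
      simp only [hc.mul_sub, ← Finset.sum_mul]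
      rw [htot, G.spread_of_active ha]
      linear_combination (-2 * G.gap r x ^ 2) * hsw
  · have hz : (fun i => 2 * G.gap r x * flux (c r) i) = 0 := by
      funext i
      have : flux (c r) i = 0 := Finset.sum_eq_zero fun j _ => by
        rw [hc.2.2 r i j fun h => ha h.1, hc.2.2 r j i fun h => ha h.1, sub_zero]
      simp [this]
    rw [hz]
    refine ⟨G.inCone_zero r (by linarith [G.spread_nonneg r x]), ?_⟩
    simp [G.spread_of_not_active ha]

/-- A subgradient is the flux of pairwise weights: equality in `⟨y, x⟩ ≤ 2 f'_r(x)²` forces the full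
mass `2 w_r (max x - min x)` to be transported from `argmin_{T_r}` to `argmax_{H_r}`; distribute it
as a product. -/
theorem IsDualPair.exists_weights {x y : Fin N → ℝ} {r : Fin R} (h : G.IsDualPair r x y) :
    ∃ c : Fin N → Fin N → ℝ, (∀ i j, 0 ≤ c i j) ∧ (G.Active x r → ∑ i, ∑ j, c i j = G.w r) ∧
      (∀ i j, ¬ (G.Active x r ∧ i ∈ G.upSet x r ∧ j ∈ G.downSet x r) → c i j = 0) ∧
      ∀ i, y i = 2 * G.gap r x * flux c i := by
  by_cases ha : G.Active x r
  · obtain ⟨hc, hp⟩ := h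
    have hg := G.active_iff.1 ha
    have hsw := Real.mul_self_sqrt (G.w_pos r).le
    have hw := G.w_pos r
    have hm := hc.2.2.2.2
    have hpe := hc.pairing_eq x
    rw [G.spread_of_active ha] at hp hm
    change _ = _ * G.gap r x - _ - _ at hpe
    set m := ∑ i, max (y i) 0 with hmdef
    have hd1 := Finset.sum_nonneg fun i (_ : i ∈ Finset.univ) => hc.posPart_deficit_nonneg x i
    have hd2 := Finset.sum_nonneg fun i (_ : i ∈ Finset.univ) => hc.negPart_deficit_nonneg x i
    have hm' : m ≤ 2 * G.w r * G.gap r x := by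
      calc m ≤ _ := hm
        _ = 2 * (√(G.w r) * √(G.w r)) * G.gap r x := by ring
        _ = _ := by rw [hsw]
    have hp' : ∑ i, y i * x i = 2 * G.w r * G.gap r x * G.gap r x := by
      rw [hp]
      linear_combination (2 * G.gap r x ^ 2) * hsw
    have hmg := mul_le_mul_of_nonneg_right hm' hg.le
    -- both deficits in `⟨y, x⟩ ≤ m (max x - min x)` vanish, which locates the support of `y`
    have hz1 := (Finset.sum_eq_zero_iff_of_nonneg
      (fun i _ => hc.posPart_deficit_nonneg x i)).1 (le_antisymm (by linarith) hd1)
    have hz2 := (Finset.sum_eq_zero_iff_of_nonneg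
      (fun i _ => hc.negPart_deficit_nonneg x i)).1 (le_antisymm (by linarith) hd2)
    have hmeq : m = 2 * G.w r * G.gap r x := by
      refine le_antisymm hm' (le_of_mul_le_mul_right ?_ hg)
      linarith
    have hneg : ∑ i, max (-y i) 0 = m := hc.sum_neg
    -- `c i j = y_i⁺ y_j⁻ / (4 w Δ²)` with `Δ = max x - min x` and total mass `m = 2 w Δ` of `y`
    have hK : 0 < 4 * G.w r * G.gap r x ^ 2 := by positivity
    have hrow : ∀ i, ∑ j, max (y i) 0 * max (-y j) 0 / (4 * G.w r * G.gap r x ^ 2)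
        = max (y i) 0 / (2 * G.gap r x) := by
      intro i
      rw [← Finset.sum_div, ← Finset.mul_sum, hneg, hmeq]
      field_simp
      norm_num
    have hcol : ∀ i, ∑ j, max (y j) 0 * max (-y i) 0 / (4 * G.w r * G.gap r x ^ 2)
        = max (-y i) 0 / (2 * G.gap r x) := by
      intro i
      rw [← Finset.sum_div, ← Finset.sum_mul, ← hmdef, hmeq]
      field_simp
      ring
    refine ⟨fun i j => max (y i) 0 * max (-y j) 0 / (4 * G.w r * G.gap r x ^ 2), fun i j => ?_,
      fun _ => ?_, fun i j hij => ?_, fun i => ?_⟩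
    · exact div_nonneg (mul_nonneg (le_max_right _ _) (le_max_right _ _)) hK.le
    · simp only [hrow, ← Finset.sum_div]
      rw [← hmdef, hmeq]
      field_simp
    · by_contra hne
      have hi : max (y i) 0 ≠ 0 := fun h0 => hne (by simp [h0])
      have hj : max (-y j) 0 ≠ 0 := fun h0 => hne (by simp [h0])
      refine hij ⟨ha, G.mem_upSet_iff.2 ⟨?_, ?_⟩, G.mem_downSet_iff.2 ⟨?_, ?_⟩⟩
      · by_contra hiH
        exact hi (max_eq_right (hc.2.1 i hiH))
      · rcases mul_eq_zero.1 (hz1 i (Finset.mem_univ i)) with h0 | h0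
        · exact absurd h0 hi
        · linarith
      · by_contra hjT
        exact hj (max_eq_right (by linarith [hc.2.2.1 j hjT]))
      · rcases mul_eq_zero.1 (hz2 j (Finset.mem_univ j)) with h0 | h0
        · exact absurd h0 hj
        · linarith
    · rw [flux, Finset.sum_sub_distrib, hrow, hcol]
      have : y i = max (y i) 0 - max (-y i) 0 := by
        rcases le_total (y i) 0 with hi | hi
        · rw [max_eq_right hi, max_eq_left (by linarith)]; ring
        · rw [max_eq_left hi, max_eq_right (by linarith)]; ring
      field_simp
      exact this
  · have hz : y = 0 := by
      have := h.1
      rw [G.spread_of_not_active ha, mul_zero] at this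
      exact this.eq_zero
    exact ⟨fun _ _ => 0, by simp, fun h => absurd h ha, by simp, by simp [hz, flux]⟩

variable (G)

/-- The PageRank vectors are the primal solution, scaled by `D`: the stationarity equation says that
the fluxes of the weights form a family of subgradients as in `qdsfm_growth`. -/
theorem isPageRank_iff {α : ℝ} (h0 : 0 < α) (h1 : α < 1) {p₀ p : Fin N → ℝ} {z : DualVar N R}
    (hz : z ∈ G.prSol α p₀) :
    G.IsPageRank α p₀ p ↔ G.x0 p = primalOf (G.W α) (G.x0 p₀) z := by
  have hW := G.W_pos h0 h1
  constructor
  · rintro ⟨c, hc, heq⟩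
    rw [← G.isMinOn_iff_eq_primalOf hW _ hz]
    intro x' _
    have := qdsfm_growth (W := G.W α) (a := G.x0 p₀) hc.isDualPair ((hc.stationary_iff h1).1 heq) x'
    have h2 := wNormSq_nonneg hW (x' - G.x0 p)
    show qdsfm _ _ _ _ ≤ qdsfm _ _ _ _
    linarith
  · intro hx
    have hpair := fun r => (G.isDualPair_of_mem_dualSol hW _ hz r).2
    rw [← hx] at hpair
    choose c hc0 hc1 hc2 hc3 using fun r => (hpair r).exists_weights
    have hc : G.Admissible (G.x0 p) c := ⟨hc0, hc1, hc2⟩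
    refine ⟨c, hc, (hc.stationary_iff h1).2 fun i => ?_⟩
    simp only [← hc3]
    rw [sum_of_primalOf hW (G.x0 p₀) z i, hx]

end DirHypergraph

/-! ### Acyclic flows -/

section Flow

variable {X E : Type*} [DecidableEq X] [Fintype E]

/-- The net outflow at the node `v` of a flow `f` on the arcs `s e → t e`. -/
def netOut (s t : E → X) (f : E → ℝ) (v : X) : ℝ :=
  ∑ e, ((if s e = v then f e else 0) - (if t e = v then f e else 0))

theorem netOut_add_smul (s t : E → X) (f g : E → ℝ) (c : ℝ) (v : X) :
    netOut s t (f + c • g) v = netOut s t f v + c * netOut s t g v := by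
  unfold netOut
  rw [Finset.mul_sum, ← Finset.sum_add_distrib]
  refine Finset.sum_congr rfl fun e _ => ?_
  simp only [Pi.add_apply, Pi.smul_apply, smul_eq_mul]
  split_ifs <;> ring

/-- A walk along arcs with positive flow carries a unit flow from its start to its end. -/
theorem exists_unit_flow [DecidableEq E] {s t : E → X} {g : E → ℝ} {u v : X}
    (h : Relation.TransGen (fun a b => ∃ e, 0 < g e ∧ s e = a ∧ t e = b) u v) :
    ∃ c : E → ℝ, (∀ e, 0 ≤ c e) ∧ (∀ e, 0 < c e → 0 < g e) ∧ (∃ e, 0 < c e) ∧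
      ∀ w, netOut s t c w = (if u = w then 1 else 0) - (if v = w then 1 else 0) := by
  have harc : ∀ e w, netOut s t (Pi.single e 1) w
      = (if s e = w then 1 else 0) - (if t e = w then 1 else 0) := by
    intro e w
    unfold netOut
    rw [Finset.sum_eq_single e]
    · simp
    · intro e' _ he
      simp [he]
    · simp
  have hsingle : ∀ e, 0 < g e → ∀ e', 0 < (Pi.single e 1 : E → ℝ) e' → 0 < g e' := by
    intro e he e' he'
    by_cases h : e' = e
    · exact h ▸ he
    · simp [h] at he'
  have hnn : ∀ e e', 0 ≤ (Pi.single e 1 : E → ℝ) e' := fun e e' => by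
    by_cases h : e' = e
    · subst h; simp
    · simp [h]
  induction h with
  | single h =>
    obtain ⟨e, he, rfl, rfl⟩ := h
    exact ⟨Pi.single e 1, hnn e, hsingle e he, ⟨e, by simp⟩, harc e⟩
  | tail _ h ih =>
    obtain ⟨e, he, rfl, rfl⟩ := h
    obtain ⟨c, h0, h1, ⟨e₀, h2⟩, h3⟩ := ih
    refine ⟨c + (1 : ℝ) • Pi.single e 1, fun e' => ?_, fun e' he' => ?_, ⟨e₀, ?_⟩, fun w => ?_⟩
    · simpa using add_nonneg (h0 e') (hnn e e')
    · by_contra hg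
      have hc : c e' = 0 := le_antisymm (not_lt.1 fun h => hg (h1 e' h)) (h0 e')
      have hs : ¬ 0 < (Pi.single e 1 : E → ℝ) e' := fun h => hg (hsingle e he e' h)
      simp [hc] at he'
      exact hs he'
    · have := hnn e e₀
      simp only [Pi.add_apply, Pi.smul_apply, smul_eq_mul, one_mul]
      linarith
    · rw [netOut_add_smul, h3, harc]
      ring

/-- Every flow contains an acyclic flow with the same net outflows; the inflow at a node `v` of an
acyclic flow is at most the total supply, since it is bounded by the net outflow of the set of nodes
from which `v` can be reached. -/
theorem exists_acyclic_flow [Fintype X] (s t : E → X) {f : E → ℝ} (hf : ∀ e, 0 ≤ f e) :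
    ∃ g : E → ℝ, (∀ e, 0 ≤ g e) ∧ (∀ e, g e ≤ f e) ∧ (∀ v, netOut s t g v = netOut s t f v) ∧
      ∀ v, ∑ e, (if t e = v then g e else 0) ≤ ∑ u, |netOut s t f u| := by
  classical
  set K : Set (E → ℝ) := Set.Icc 0 f ∩ {g | ∀ v, netOut s t g v = netOut s t f v} with hK
  have hcl : IsClosed {g : E → ℝ | ∀ v, netOut s t g v = netOut s t f v} := by
    simp only [Set.ofPred_forall]
    refine isClosed_iInter fun v => isClosed_eq ?_ continuous_const
    unfold netOut
    refine continuous_finsetSum _ fun e _ => ?_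
    split_ifs <;> fun_prop
  obtain ⟨g, hgK, hmin⟩ := (isCompact_Icc.inter_right hcl).exists_isMinOn
    (f := fun g : E → ℝ => ∑ e, g e) ⟨f, ⟨hf, le_rfl⟩, fun _ => rfl⟩ (by fun_prop)
  obtain ⟨⟨hg0, hgf⟩, hgn⟩ := hgK
  refine ⟨g, hg0, hgf, hgn, fun v => ?_⟩
  set r : X → X → Prop := fun a b => ∃ e, 0 < g e ∧ s e = a ∧ t e = b with hr
  -- a cycle through `v` could be subtracted from a minimal flow
  have hacyc : ¬ Relation.TransGen r v v := by
    intro hcyc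
    obtain ⟨c, h0, h1, ⟨e₀, he₀⟩, h3⟩ := exists_unit_flow hcyc
    obtain ⟨e₁, he₁, hmin₁⟩ := Finset.exists_min_image (Finset.univ.filter fun e => 0 < c e)
      (fun e => g e / c e) ⟨e₀, by simpa using he₀⟩
    have hc₁ : 0 < c e₁ := by simpa using he₁
    set ε := g e₁ / c e₁ with hε
    have hε0 : 0 < ε := div_pos (h1 _ hc₁) hc₁
    have hsub : g + (-ε) • c ∈ K := by
      refine ⟨⟨fun e => ?_, fun e => ?_⟩, fun w => ?_⟩
      · rcases (h0 e).eq_or_lt with he | he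
        · simpa [← he] using hg0 e
        · have := hmin₁ e (by simpa using he)
          rw [le_div_iff₀ he] at this
          simp only [Pi.zero_apply, Pi.add_apply, Pi.smul_apply, smul_eq_mul]
          linarith
      · have := mul_nonneg hε0.le (h0 e)
        have := hgf e
        simp only [Pi.add_apply, Pi.smul_apply, smul_eq_mul]
        linarith
      · rw [netOut_add_smul, h3, hgn]
        ring
    have h4 : ∑ e, g e ≤ ∑ e, (g + (-ε) • c) e := hmin hsub
    have h5 : ∑ e, (g + (-ε) • c) e = ∑ e, g e - ε * ∑ e, c e := by
      simp only [Pi.add_apply, Pi.smul_apply, smul_eq_mul, Finset.sum_add_distrib,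
        ← Finset.mul_sum]
      ring
    have h6 : 0 < ∑ e, c e := Finset.sum_pos' (fun e _ => h0 e) ⟨e₀, Finset.mem_univ _, he₀⟩
    have := mul_pos hε0 h6
    linarith
  -- the nodes from which `v` can be reached: no positive arc enters `U`, and `v ∉ U`
  set U : Finset X := Finset.univ.filter fun u => Relation.TransGen r u v with hU
  have hmem : ∀ u, u ∈ U ↔ Relation.TransGen r u v := fun u => by simp [hU]
  have hcut : ∑ u ∈ U, netOut s t g u
      = ∑ e, ((if s e ∈ U then g e else 0) - (if t e ∈ U then g e else 0)) := by
    unfold netOut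
    rw [Finset.sum_comm]
    refine Finset.sum_congr rfl fun e _ => ?_
    rw [Finset.sum_sub_distrib, Finset.sum_ite_eq, Finset.sum_ite_eq]
  calc ∑ e, (if t e = v then g e else 0)
      ≤ ∑ e, ((if s e ∈ U then g e else 0) - (if t e ∈ U then g e else 0)) := by
        refine Finset.sum_le_sum fun e _ => ?_
        rcases (hg0 e).eq_or_lt with he | he
        · simp [← he]
        have he' : 0 < g e := he
        by_cases htv : t e = v
        · have h1 : s e ∈ U := (hmem _).2 (.single ⟨e, he', rfl, htv⟩)
          have h2 : t e ∉ U := fun h => hacyc (htv ▸ (hmem _).1 h)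
          simp [htv, h1, htv ▸ h2]
        · by_cases htU : t e ∈ U
          · have h1 : s e ∈ U := (hmem _).2 (.head ⟨e, he', rfl, rfl⟩ ((hmem _).1 htU))
            simp [htv, htU, h1]
          · simp only [htv, htU, if_false, sub_zero]
            split_ifs <;> linarith
    _ = ∑ u ∈ U, netOut s t g u := hcut.symm
    _ ≤ ∑ u ∈ U, |netOut s t f u| := Finset.sum_le_sum fun u _ => (hgn u) ▸ le_abs_self _
    _ ≤ _ := Finset.sum_le_sum_of_subset_of_nonneg (Finset.subset_univ _)
        fun u _ _ => abs_nonneg _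

/-- A flow `a` can be turned into one with the net outflows of `b` by moving it towards `b` so
little that the change at every node is controlled by the total change of the net outflows. -/
theorem exists_reroute [Fintype X] (s t : E → X) (a b : E → ℝ) :
    ∃ c : E → ℝ, (∀ e, c e ∈ Set.uIcc (a e) (b e)) ∧ (∀ v, netOut s t c v = netOut s t b v) ∧
      ∀ v, ∑ e, ((if s e = v then |c e - a e| else 0) + (if t e = v then |c e - a e| else 0))
        ≤ 3 * ∑ u, |netOut s t b u - netOut s t a u| := by
  -- reverse the arcs on which `b - a` is negative
  set s' : E → X := fun e => if a e ≤ b e then s e else t e with hs'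
  set t' : E → X := fun e => if a e ≤ b e then t e else s e with ht'
  have hnet : ∀ g : E → ℝ, ∀ v, netOut s' t' g v
      = netOut s t (fun e => if a e ≤ b e then g e else -g e) v := by
    intro g v
    unfold netOut
    refine Finset.sum_congr rfl fun e _ => ?_
    simp only [hs', ht']
    split_ifs <;> ring
  obtain ⟨g, h0, h1, h2, h3⟩ := exists_acyclic_flow s' t' (f := fun e => |b e - a e|)
    fun e => abs_nonneg _
  have hdiff : ∀ v, netOut s' t' (fun e => |b e - a e|) v
      = netOut s t b v - netOut s t a v := by
    intro v
    rw [hnet]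
    have h := netOut_add_smul s t b a (-1) v
    rw [neg_one_mul, ← sub_eq_add_neg] at h
    rw [← h]
    congr 1
    funext e
    simp only [Pi.add_apply, Pi.smul_apply, smul_eq_mul]
    split_ifs with hab
    · rw [abs_of_nonneg (by linarith)]; ring
    · rw [abs_of_neg (by linarith)]; ring
  have habs : ∀ e, |(if a e ≤ b e then g e else -g e)| = g e := by
    intro e
    split_ifs
    · exact abs_of_nonneg (h0 e)
    · rw [abs_neg, abs_of_nonneg (h0 e)]
  refine ⟨fun e => a e + (if a e ≤ b e then g e else -g e), fun e => ?_, fun v => ?_, fun v => ?_⟩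
  · have := h1 e
    have := h0 e
    by_cases hab : a e ≤ b e
    · rw [Set.uIcc_of_le hab]
      rw [abs_of_nonneg (by linarith)] at *
      simp only [hab, if_true]
      constructor <;> linarith
    · rw [Set.uIcc_of_ge (by linarith)]
      rw [abs_of_neg (by linarith)] at *
      simp only [hab, if_false]
      constructor <;> linarith
  · have h4 := netOut_add_smul s t a (fun e => if a e ≤ b e then g e else -g e) 1 v
    rw [one_smul, one_mul, ← hnet, h2, hdiff] at h4
    calc _ = _ := h4
      _ = _ := by ring
  · simp only [add_sub_cancel_left, habs]
    have h5 := h3 v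
    simp only [hdiff] at h5
    have h6 : netOut s' t' g v ≤ ∑ u, |netOut s t b u - netOut s t a u| := by
      rw [h2, hdiff]
      exact (le_abs_self _).trans (Finset.single_le_sum
        (f := fun u => |netOut s t b u - netOut s t a u|) (fun u _ => abs_nonneg _)
        (Finset.mem_univ v))
    have h7 : ∑ e, ((if s e = v then g e else 0) + (if t e = v then g e else 0))
        = netOut s' t' g v + 2 * ∑ e, (if t' e = v then g e else 0) := by
      unfold netOut
      rw [Finset.mul_sum, ← Finset.sum_add_distrib]
      refine Finset.sum_congr rfl fun e _ => ?_
      simp only [hs', ht']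
      split_ifs <;> ring
    -- the throughput at `v` is the net outflow plus twice the inflow
    rw [h7]
    linarith

end Flow

/-! ### The error bound for the dual problem -/

namespace DirHypergraph

variable {N R : ℕ} (G : DirHypergraph N R)

section Network

variable (N R) in
/-- The arcs of the network of the hypergraph: `i → h_r`, `h_r → t_r` and `t_r → i`. -/
abbrev Arc : Type := (Fin R × Fin N) ⊕ (Fin R ⊕ (Fin R × Fin N))

/-- Sources of the arcs; the nodes are the vertices `i` and two nodes `h_r`, `t_r` per hyperedge. -/
def arcSrc : Arc N R → Fin N ⊕ (Fin R ⊕ Fin R) :=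
  Sum.elim (fun p => .inl p.2) (Sum.elim (fun r => .inr (.inl r)) (fun p => .inr (.inr p.1)))

/-- Targets of the arcs. -/
def arcTgt : Arc N R → Fin N ⊕ (Fin R ⊕ Fin R) :=
  Sum.elim (fun p => .inr (.inl p.1)) (Sum.elim (fun r => .inr (.inr r)) (fun p => .inl p.2))

/-- The flow of `y`: positive parts enter `h_r`, negative parts leave `t_r`, and the arc `h_r → t_r`
carries the transported mass. -/
noncomputable def arcFlow (y : Fin R → Fin N → ℝ) : Arc N R → ℝ :=
  Sum.elim (fun p => max (y p.1 p.2) 0)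
    (Sum.elim (fun r => ∑ i, max (y r i) 0) (fun p => max (-y p.1 p.2) 0))

theorem netOut_vertex (f : Arc N R → ℝ) (i : Fin N) :
    netOut arcSrc arcTgt f (.inl i)
      = ∑ r, (f (.inl (r, i)) - f (.inr (.inr (r, i)))) := by
  unfold netOut
  simp [arcSrc, arcTgt, Fintype.sum_prod_type, sub_eq_add_neg, Finset.sum_add_distrib]

theorem netOut_head (f : Arc N R → ℝ) (r : Fin R) :
    netOut arcSrc arcTgt f (.inr (.inl r)) = f (.inr (.inl r)) - ∑ i, f (.inl (r, i)) := by
  unfold netOut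
  rw [Fintype.sum_sum_type, Fintype.sum_sum_type, Fintype.sum_prod_type]
  simp only [arcSrc, arcTgt, Sum.elim_inl, Sum.elim_inr, Sum.inr.injEq, Sum.inl.injEq, reduceCtorEq,
    if_false, zero_sub, sub_zero, Finset.sum_const_zero, add_zero, sub_self]
  rw [Finset.sum_comm]
  simp [Finset.sum_neg_distrib]
  ring

theorem netOut_tail (f : Arc N R → ℝ) (r : Fin R) :
    netOut arcSrc arcTgt f (.inr (.inr r))
      = ∑ i, f (.inr (.inr (r, i))) - f (.inr (.inl r)) := by
  unfold netOut
  rw [Fintype.sum_sum_type, Fintype.sum_sum_type, Fintype.sum_prod_type, Fintype.sum_prod_type]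
  simp only [arcSrc, arcTgt, Sum.elim_inl, Sum.elim_inr, Sum.inr.injEq, reduceCtorEq,
    if_false, zero_sub, sub_zero, Finset.sum_const_zero, zero_add, sub_self]
  rw [Finset.sum_comm (s := Finset.univ (α := Fin R))]
  simp
  ring

variable {G}

/-- Points of the cones can be moved to ones with a prescribed feasible sum, changing the
coordinates at each vertex by no more than the `ℓ¹` distance of the sums. -/
theorem exists_reroute_cone {φ : Fin R → ℝ} {y y' : Fin R → Fin N → ℝ}
    (hy : ∀ r, G.InCone r (y r) (φ r)) (hy' : ∀ r, G.InCone r (y' r) (φ r)) :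
    ∃ v : Fin R → Fin N → ℝ, (∀ r, G.InCone r (v r) (φ r)) ∧
      (∀ i, ∑ r, v r i = ∑ r, y' r i) ∧
      ∀ i, ∑ r, |v r i - y r i| ≤ 3 * ∑ j, |∑ r, y' r j - ∑ r, y r j| := by
  have hmax : ∀ x : ℝ, max x 0 - max (-x) 0 = x := by
    intro x
    rcases le_total x 0 with h | h
    · rw [max_eq_right h, max_eq_left (by linarith)]; ring
    · rw [max_eq_left h, max_eq_right (by linarith)]; ring
  obtain ⟨c, hc, hnet, hbd⟩ := exists_reroute arcSrc arcTgt (arcFlow y) (arcFlow y')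
  have hvert : ∀ (u : Fin R → Fin N → ℝ) i, netOut arcSrc arcTgt (arcFlow u) (.inl i)
      = ∑ r, u r i := by
    intro u i
    rw [netOut_vertex]
    exact Finset.sum_congr rfl fun r _ => hmax _
  have hhead : ∀ (u : Fin R → Fin N → ℝ) r, netOut arcSrc arcTgt (arcFlow u) (.inr (.inl r))
      = 0 := by
    intro u r
    rw [netOut_head]
    simp [arcFlow]
  have htail : ∀ (u : Fin R → Fin N → ℝ), (∀ r, G.InCone r (u r) (φ r)) → ∀ r,
      netOut arcSrc arcTgt (arcFlow u) (.inr (.inr r)) = 0 := by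
    intro u hu r
    rw [netOut_tail]
    simp [arcFlow, (hu r).sum_neg]
  have hp0 : ∀ r i, 0 ≤ c (.inl (r, i)) := fun r i =>
    (le_min (le_max_right _ _) (le_max_right _ _)).trans (hc (.inl (r, i))).1
  have hq0 : ∀ r i, 0 ≤ c (.inr (.inr (r, i))) := fun r i =>
    (le_min (le_max_right _ _) (le_max_right _ _)).trans (hc (.inr (.inr (r, i)))).1
  have hmid : ∀ r, c (.inr (.inl r)) = ∑ i, c (.inl (r, i)) := fun r => by
    have := hnet (.inr (.inl r))
    rw [hhead, netOut_head] at this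
    linarith
  have hmid' : ∀ r, c (.inr (.inl r)) = ∑ i, c (.inr (.inr (r, i))) := fun r => by
    have := hnet (.inr (.inr r))
    rw [htail y' hy', netOut_tail] at this
    linarith
  refine ⟨fun r i => c (.inl (r, i)) - c (.inr (.inr (r, i))), fun r => ⟨(hy r).1, fun i hi => ?_,
    fun i hi => ?_, ?_, ?_⟩, fun i => ?_, fun i => ?_⟩
  · have h1 : c (.inl (r, i)) ≤ 0 := (hc (.inl (r, i))).2.trans
      (max_le (max_le ((hy r).2.1 i hi) le_rfl) (max_le ((hy' r).2.1 i hi) le_rfl))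
    have := hq0 r i
    linarith
  · have h1 : c (.inr (.inr (r, i))) ≤ 0 := (hc (.inr (.inr (r, i)))).2.trans
      (max_le (max_le (by linarith [(hy r).2.2.1 i hi]) le_rfl)
        (max_le (by linarith [(hy' r).2.2.1 i hi]) le_rfl))
    have := hp0 r i
    linarith
  · rw [Finset.sum_sub_distrib, ← hmid, ← hmid', sub_self]
  · calc ∑ i, max (c (.inl (r, i)) - c (.inr (.inr (r, i)))) 0 ≤ ∑ i, c (.inl (r, i)) :=
          Finset.sum_le_sum fun i _ => max_le (by linarith [hq0 r i]) (hp0 r i)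
      _ = c (.inr (.inl r)) := (hmid r).symm
      _ ≤ _ := (hc (.inr (.inl r))).2.trans (max_le (hy r).2.2.2.2 (hy' r).2.2.2.2)
  · rw [← netOut_vertex, hnet, hvert]
  · have h1 := hbd (.inl i)
    have h2 : ∑ u, |netOut arcSrc arcTgt (arcFlow y') u - netOut arcSrc arcTgt (arcFlow y) u|
        = ∑ j, |∑ r, y' r j - ∑ r, y r j| := by
      rw [Fintype.sum_sum_type, Fintype.sum_sum_type]
      simp [hvert, hhead, htail y hy, htail y' hy']
    rw [h2] at h1
    refine le_trans ?_ h1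
    rw [Fintype.sum_sum_type, Fintype.sum_sum_type, Fintype.sum_prod_type, Fintype.sum_prod_type]
    simp only [arcSrc, arcTgt, Sum.elim_inl, Sum.elim_inr, reduceCtorEq, if_false, add_zero,
      zero_add, Finset.sum_const_zero, Sum.inl.injEq, Finset.sum_ite_eq', Finset.mem_univ, if_true]
    rw [← Finset.sum_add_distrib]
    refine Finset.sum_le_sum fun r _ => ?_
    have h3 : y r i = arcFlow y (.inl (r, i)) - arcFlow y (.inr (.inr (r, i))) := (hmax _).symm
    rw [h3]
    calc _ = |(c (.inl (r, i)) - arcFlow y (.inl (r, i)))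
          - (c (.inr (.inr (r, i))) - arcFlow y (.inr (.inr (r, i))))| := by congr 1; ring
      _ ≤ _ := abs_sub _ _

end Network

end DirHypergraph

/-- The squared norm `∑_r ‖y_r‖_{W'}² + ‖φ‖²` on the dual space. -/
noncomputable def dualNormSq (W' : Fin N → ℝ) (h : DualVar N R) : ℝ :=
  ∑ r, wNormSq W' (h.1 r) + ∑ r, h.2 r ^ 2

theorem sum_sq_le_sq_sum_abs {ι : Type*} (s : Finset ι) (f : ι → ℝ) :
    ∑ i ∈ s, f i ^ 2 ≤ (∑ i ∈ s, |f i|) ^ 2 := by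
  calc ∑ i ∈ s, f i ^ 2 = ∑ i ∈ s, |f i| ^ 2 := by simp only [sq_abs]
    _ ≤ _ := Finset.sum_sq_le_sq_sum_of_nonneg fun i _ => abs_nonneg _

namespace DirHypergraph

variable {N R : ℕ} {G : DirHypergraph N R}

theorem InCone.mono {r : Fin R} {y : Fin N → ℝ} {φ φ' : ℝ} (h : G.InCone r y φ) (hφ : φ ≤ φ') :
    G.InCone r y φ' :=
  ⟨h.1.trans hφ, h.2.1, h.2.2.1, h.2.2.2.1,
    h.2.2.2.2.trans (mul_le_mul_of_nonneg_left hφ (Real.sqrt_nonneg _))⟩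

/-- Changing `φ` to `φ'` costs at most `√w |φ - φ'|` in every coordinate and twice that in `ℓ¹`. -/
theorem InCone.exists_rescale {r : Fin R} {y : Fin N → ℝ} {φ φ' : ℝ} (h : G.InCone r y φ)
    (h0 : 0 ≤ φ') : ∃ v, G.InCone r v φ' ∧ (∀ i, |v i - y i| ≤ √(G.w r) * |φ' - φ|) ∧
      ∑ i, |v i - y i| ≤ 2 * (√(G.w r) * |φ' - φ|) := by
  have hw := Real.sqrt_nonneg (G.w r)
  rcases le_or_gt φ φ' with hle | hlt
  · exact ⟨y, h.mono hle, fun i => by simpa using by positivity, by simpa using by positivity⟩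
  · have hφ : 0 < φ := h0.trans_lt hlt
    have hc : 0 ≤ φ' / φ := div_nonneg h0 hφ.le
    have hc1 : 0 ≤ 1 - φ' / φ := by
      rw [sub_nonneg, div_le_one hφ]; exact hlt.le
    have hv := h.smul hc
    rw [div_mul_cancel₀ _ hφ.ne'] at hv
    have habs : |φ' - φ| = (1 - φ' / φ) * φ := by
      rw [abs_of_neg (by linarith)]; field_simp; ring
    have hd : ∀ i, |((φ' / φ) • y) i - y i| = (1 - φ' / φ) * |y i| := by
      intro i
      have : ((φ' / φ) • y) i - y i = -((1 - φ' / φ) * y i) := by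
        simp only [Pi.smul_apply, smul_eq_mul]
        ring
      rw [this, abs_neg, abs_mul, abs_of_nonneg hc1]
    refine ⟨_, hv, fun i => ?_, ?_⟩
    · rw [hd, habs]
      have := mul_le_mul_of_nonneg_left (h.abs_apply_le i) hc1
      linarith
    · simp only [hd, habs, ← Finset.mul_sum]
      have h1 : ∑ i, |y i| = 2 * ∑ i, max (y i) 0 := by
        rw [two_mul]
        nth_rewrite 2 [← h.sum_neg]
        rw [← Finset.sum_add_distrib]
        refine Finset.sum_congr rfl fun i _ => ?_
        rcases le_total (y i) 0 with hi | hi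
        · rw [max_eq_right hi, max_eq_left (by linarith), abs_of_nonpos hi]; ring
        · rw [max_eq_left hi, max_eq_right (by linarith), abs_of_nonneg hi]; ring
      rw [h1]
      have := mul_le_mul_of_nonneg_left h.2.2.2.2 hc1
      linarith

/-- The error bound: the squared distance of a feasible point to the dual solution set is controlled
by the dual gap. The sum `∑_r y_r` and `φ` determine membership in the solution set, so it suffices
to correct them by rescaling and rerouting. -/
theorem exists_dualSol_near {W W' : Fin N → ℝ} (hW : ∀ i, 0 < W i) (hW' : ∀ i, 0 ≤ W' i)
    (a : Fin N → ℝ) {z z' : DualVar N R} (hz : z ∈ prodCone G.wcut)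
    (hz' : z' ∈ dualSol G.wcut W a) :
    ∃ v ∈ dualSol G.wcut W a, dualNormSq W' (z - v)
      ≤ (98 * (∑ i, W' i) * max (∑ i, W i) (∑ r, G.w r) + 1)
        * (dualObj W a z - dualObj W a z') := by
  have hzc := G.mem_prodCone_wcut.1 hz
  have hzc' := G.mem_prodCone_wcut.1 hz'.1
  -- first change `φ` to `φ'`, then the sum of the blocks to that of `z'`
  choose u hu hu1 hu2 using fun r => (hzc r).exists_rescale (hzc' r).1
  obtain ⟨v, hv, hvs, hvd⟩ := exists_reroute_cone hu hzc'
  set e := ∑ r, √(G.w r) * |z'.2 r - z.2 r| with he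
  set D := ∑ j, |∑ r, z.1 r j - ∑ r, z'.1 r j| with hD
  have he0 : 0 ≤ e := Finset.sum_nonneg fun r _ => by positivity
  have hD0 : 0 ≤ D := Finset.sum_nonneg fun r _ => by positivity
  have hsolv : ((v, z'.2) : DualVar N R) ∈ dualSol G.wcut W a := by
    have hobj : dualObj W a (v, z'.2) = dualObj W a z' := by
      have : ∑ r, v r = ∑ r, z'.1 r := by
        funext i; simpa using hvs i
      simp only [dualObj, this]
    refine ⟨G.mem_prodCone_wcut.2 hv, fun x hx => ?_⟩
    show dualObj W a _ ≤ _
    rw [hobj]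
    exact hz'.2 hx
  refine ⟨_, hsolv, ?_⟩
  have hcoord : ∀ i, ∑ r, |z.1 r i - v r i| ≤ 3 * D + 7 * e := by
    intro i
    have h1 : ∑ r, |u r i - z.1 r i| ≤ e := Finset.sum_le_sum fun r _ => hu1 r i
    have h2 : ∑ j, |∑ r, z'.1 r j - ∑ r, u r j| ≤ D + 2 * e := by
      calc ∑ j, |∑ r, z'.1 r j - ∑ r, u r j|
          ≤ ∑ j, (|∑ r, z.1 r j - ∑ r, z'.1 r j| + ∑ r, |u r j - z.1 r j|) := by
            refine Finset.sum_le_sum fun j _ => ?_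
            have h3 : ∑ r, z'.1 r j - ∑ r, u r j
                = -(∑ r, z.1 r j - ∑ r, z'.1 r j) + -(∑ r, (u r j - z.1 r j)) := by
              rw [Finset.sum_sub_distrib]; ring
            rw [h3]
            refine (abs_add_le _ _).trans ?_
            rw [abs_neg, abs_neg]
            exact add_le_add le_rfl (Finset.abs_sum_le_sum_abs _ _)
        _ = D + ∑ r, ∑ j, |u r j - z.1 r j| := by
            rw [Finset.sum_add_distrib, ← hD, Finset.sum_comm]
        _ ≤ D + ∑ r, 2 * (√(G.w r) * |z'.2 r - z.2 r|) :=
            add_le_add le_rfl (Finset.sum_le_sum fun r _ => hu2 r)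
        _ = _ := by rw [← Finset.mul_sum]
    have h3 : ∑ r, |z.1 r i - v r i| ≤ ∑ r, (|v r i - u r i| + |u r i - z.1 r i|) := by
      refine Finset.sum_le_sum fun r _ => ?_
      have : z.1 r i - v r i = -(v r i - u r i) + -(u r i - z.1 r i) := by ring
      rw [this]
      refine (abs_add_le _ _).trans ?_
      rw [abs_neg, abs_neg]
    rw [Finset.sum_add_distrib] at h3
    have := hvd i
    linarith
  set q₁ := wNormSq W⁻¹ (∑ r, (z - z').1 r) with hq₁
  set q₂ := ∑ r, (z - z').2 r ^ 2 with hq₂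
  have hq₁0 : 0 ≤ q₁ := wNormSq_nonneg (pi_inv_pos hW) _
  have hq₂0 : 0 ≤ q₂ := Finset.sum_nonneg fun _ _ => sq_nonneg _
  have hgap : q₁ + q₂ ≤ dualObj W a z - dualObj W a z' := G.dualQuad_le_of_mem_dualSol a hW hz' hz
  -- Cauchy–Schwarz bounds both `ℓ¹` changes by the quadratic part of the dual objective
  have hDq : D ^ 2 ≤ (∑ i, W i) * q₁ := by
    refine Finset.sum_sq_le_sum_mul_sum_of_sq_le_mul _ (fun i _ => (hW i).le)
      (fun i _ => mul_nonneg (pi_inv_pos hW i).le (sq_nonneg _)) fun i _ => le_of_eq ?_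
    have := (hW i).ne'
    simp only [sq_abs, Pi.inv_apply, Finset.sum_apply, Prod.fst_sub, Pi.sub_apply,
      Finset.sum_sub_distrib]
    field_simp
  have heq : e ^ 2 ≤ (∑ r, G.w r) * q₂ := by
    refine Finset.sum_sq_le_sum_mul_sum_of_sq_le_mul _ (fun r _ => (G.w_pos r).le)
      (fun r _ => sq_nonneg _) fun r _ => le_of_eq ?_
    rw [mul_pow, Real.sq_sqrt (G.w_pos r).le, sq_abs]
    simp only [Prod.snd_sub, Pi.sub_apply]
    ring
  have hnorm : ∑ r, wNormSq W' ((z - (v, z'.2)).1 r) ≤ (∑ i, W' i) * (3 * D + 7 * e) ^ 2 := by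
    unfold wNormSq
    rw [Finset.sum_comm, Finset.sum_mul]
    refine Finset.sum_le_sum fun i _ => ?_
    rw [← Finset.mul_sum]
    refine mul_le_mul_of_nonneg_left ?_ (hW' i)
    refine (sum_sq_le_sq_sum_abs _ _).trans ?_
    exact pow_le_pow_left₀ (Finset.sum_nonneg fun _ _ => abs_nonneg _) (hcoord i) 2
  have hS : 0 ≤ ∑ i, W' i := Finset.sum_nonneg fun i _ => hW' i
  set M := max (∑ i, W i) (∑ r, G.w r) with hM
  have h1 : (3 * D + 7 * e) ^ 2 ≤ 98 * (M * (q₁ + q₂)) := by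
    have h2 := mul_le_mul_of_nonneg_right (le_max_left (∑ i, W i) (∑ r, G.w r)) hq₁0
    have h3 := mul_le_mul_of_nonneg_right (le_max_right (∑ i, W i) (∑ r, G.w r)) hq₂0
    rw [← hM] at h2 h3
    nlinarith [sq_nonneg (3 * D - 7 * e)]
  have h4 : dualNormSq W' (z - (v, z'.2)) ≤ (98 * (∑ i, W' i) * M + 1) * (q₁ + q₂) := by
    have h5 := mul_le_mul_of_nonneg_left h1 hS
    have h6 : ∑ r, (z - (v, z'.2)).2 r ^ 2 = q₂ := rfl
    unfold dualNormSq
    rw [h6]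
    nlinarith
  refine h4.trans (mul_le_mul_of_nonneg_left hgap ?_)
  have hM0 : 0 ≤ M := (Finset.sum_nonneg fun i _ => (hW i).le).trans (le_max_left _ _)
  positivity

end DirHypergraph

/-! ### One iteration of the two methods -/

theorem dualDist_nonneg {N R : ℕ} (W' : Fin N → ℝ) (z : DualVar N R) (X : Set (DualVar N R)) :
    0 ≤ dualDist W' z X := by
  refine Real.sInf_nonneg ?_
  rintro _ ⟨z', -, rfl⟩
  exact Real.sqrt_nonneg _

theorem dualNormSq_nonneg {N R : ℕ} {W' : Fin N → ℝ} (hW' : ∀ i, 0 < W' i) (h : DualVar N R) :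
    0 ≤ dualNormSq W' h :=
  add_nonneg (Finset.sum_nonneg fun _ _ => wNormSq_nonneg hW' _)
    (Finset.sum_nonneg fun _ _ => sq_nonneg _)

theorem dualDist_sq_le {N R : ℕ} {W' : Fin N → ℝ} (hW' : ∀ i, 0 < W' i) {z z' : DualVar N R}
    {X : Set (DualVar N R)} (hz' : z' ∈ X) : dualDist W' z X ^ 2 ≤ dualNormSq W' (z - z') := by
  have h1 : dualDist W' z X ≤ √(dualNormSq W' (z - z')) := by
    refine csInf_le ⟨0, ?_⟩ ⟨z', hz', rfl⟩
    rintro _ ⟨_, -, rfl⟩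
    exact Real.sqrt_nonneg _
  calc _ ≤ √(dualNormSq W' (z - z')) ^ 2 := pow_le_pow_left₀ (dualDist_nonneg _ _ _) h1 2
    _ = _ := Real.sq_sqrt (dualNormSq_nonneg hW' _)

theorem le_dualDist_sq {N R : ℕ} {W' : Fin N → ℝ} {z : DualVar N R} {X : Set (DualVar N R)}
    (hX : X.Nonempty) {c : ℝ} (h : ∀ z' ∈ X, c ≤ dualNormSq W' (z - z')) :
    c ≤ dualDist W' z X ^ 2 := by
  rcases le_or_gt c 0 with hc | hc
  · exact hc.trans (sq_nonneg _)
  have h1 : √c ≤ dualDist W' z X := by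
    refine le_csInf (hX.image _) ?_
    rintro _ ⟨z', hz', rfl⟩
    exact Real.sqrt_le_sqrt (h z' hz')
  calc c = √c ^ 2 := (Real.sq_sqrt hc.le).symm
    _ ≤ _ := pow_le_pow_left₀ (Real.sqrt_nonneg _) h1 2

theorem wNormSq_add_smul {N : ℕ} (W x h : Fin N → ℝ) (t : ℝ) :
    wNormSq W (x + t • h) = wNormSq W x + t * (2 * ∑ i, W i * x i * h i)
      + t ^ 2 * wNormSq W h := by
  unfold wNormSq
  rw [Finset.mul_sum, Finset.mul_sum, Finset.mul_sum, ← Finset.sum_add_distrib,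
    ← Finset.sum_add_distrib]
  refine Finset.sum_congr rfl fun i _ => ?_
  simp only [Pi.add_apply, Pi.smul_apply, smul_eq_mul]
  ring

/-- Replacement of the block `r` of a dual point. -/
def setBlock {N R : ℕ} (z : DualVar N R) (r : Fin R) (p : (Fin N → ℝ) × ℝ) : DualVar N R :=
  (Function.update z.1 r p.1, Function.update z.2 r p.2)

/-- The part of the derivative of the dual objective that belongs to the block `r`. -/
noncomputable def blockLin {N R : ℕ} (W a : Fin N → ℝ) (z h : DualVar N R) (r : Fin R) : ℝ :=
  -4 * ∑ i, h.1 r i * primalOf W a z i + 2 * z.2 r * h.2 r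

theorem dualObj_setBlock {N R : ℕ} {W : Fin N → ℝ} (hW : ∀ i, 0 < W i) (a : Fin N → ℝ)
    (z z' : DualVar N R) (r : Fin R) :
    dualObj W a (setBlock z r (z'.1 r, z'.2 r)) = dualObj W a z + blockLin W a z (z' - z) r
      + (wNormSq W⁻¹ ((z' - z).1 r) + (z' - z).2 r ^ 2) := by
  set h := setBlock z r (z'.1 r, z'.2 r) - z with hh
  have e1 : ∀ s, s ≠ r → h.1 s = 0 := fun s hs => by simp [hh, setBlock, hs]
  have e2 : ∀ s, s ≠ r → h.2 s = 0 := fun s hs => by simp [hh, setBlock, hs]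
  have e3 : h.1 r = (z' - z).1 r := by simp [hh, setBlock]
  have e4 : h.2 r = (z' - z).2 r := by simp [hh, setBlock]
  have s1 : ∑ s, h.1 s = (z' - z).1 r := by
    rw [Finset.sum_eq_single r (fun s _ hs => e1 s hs) (by simp), e3]
  have s2 : ∑ s, h.2 s ^ 2 = (z' - z).2 r ^ 2 := by
    rw [Finset.sum_eq_single r (fun s _ hs => by simp [e2 s hs]) (by simp), e4]
  have s3 : dualLin W a z h = blockLin W a z (z' - z) r := by
    unfold dualLin
    rw [Finset.sum_eq_single r (fun s _ hs => by simp [e1 s hs, e2 s hs]) (by simp), e3, e4]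
    rfl
  rw [dualObj_eq hW a z, ← hh, s3, dualQuad, s1, s2]

theorem dualNormSq_setBlock {N R : ℕ} (W' : Fin N → ℝ) (z z' : DualVar N R) (r : Fin R)
    (p : (Fin N → ℝ) × ℝ) :
    dualNormSq W' (setBlock z r p - z') + (wNormSq W' ((z' - z).1 r) + (z' - z).2 r ^ 2)
      = dualNormSq W' (z - z') + (wNormSq W' (z'.1 r - p.1) + (z'.2 r - p.2) ^ 2) := by
  have hsym : ∀ u v : Fin N → ℝ, wNormSq W' (u - v) = wNormSq W' (v - u) := fun u v => by
    unfold wNormSq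
    exact Finset.sum_congr rfl fun i _ => by simp only [Pi.sub_apply]; ring
  have key : ∀ w : DualVar N R, dualNormSq W' (w - z')
      = (wNormSq W' (w.1 r - z'.1 r) + (w.2 r - z'.2 r) ^ 2)
        + ∑ s ∈ Finset.univ.erase r, (wNormSq W' (w.1 s - z'.1 s) + (w.2 s - z'.2 s) ^ 2) := by
    intro w
    rw [Finset.add_sum_erase _ (fun s => wNormSq W' (w.1 s - z'.1 s) + (w.2 s - z'.2 s) ^ 2)
      (Finset.mem_univ r), Finset.sum_add_distrib]
    rfl
  have hrest : ∑ s ∈ Finset.univ.erase r, (wNormSq W' ((setBlock z r p).1 s - z'.1 s)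
        + ((setBlock z r p).2 s - z'.2 s) ^ 2)
      = ∑ s ∈ Finset.univ.erase r, (wNormSq W' (z.1 s - z'.1 s) + (z.2 s - z'.2 s) ^ 2) := by
    refine Finset.sum_congr rfl fun s hs => ?_
    have := Finset.ne_of_mem_erase hs
    simp [setBlock, this]
  rw [key, key, hrest]
  simp only [setBlock, Function.update_self, Prod.fst_sub, Prod.snd_sub, Pi.sub_apply]
  rw [hsym p.1, hsym (z'.1 r) (z.1 r)]
  ring

namespace DirHypergraph

variable {N R : ℕ} {G : DirHypergraph N R}

/-- A projection onto a convex set beats every other point by their squared distance. -/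
theorem IsConeProj.three_point {r : Fin R} {b W' : Fin N → ℝ} {p q : (Fin N → ℝ) × ℝ}
    (hp : IsConeProj (G.wcut r) b W' p) (hq : q ∈ polyCone (G.wcut r)) :
    wNormSq W' (p.1 - b) + p.2 ^ 2 + (wNormSq W' (q.1 - p.1) + (q.2 - p.2) ^ 2)
      ≤ wNormSq W' (q.1 - b) + q.2 ^ 2 := by
  set L := 2 * ∑ i, W' i * (p.1 - b) i * (q.1 - p.1) i + 2 * p.2 * (q.2 - p.2) with hL
  set Q := wNormSq W' (q.1 - p.1) + (q.2 - p.2) ^ 2 with hQ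
  have hexp : ∀ t : ℝ, wNormSq W' (p.1 + t • (q.1 - p.1) - b) + (p.2 + t * (q.2 - p.2)) ^ 2
      = wNormSq W' (p.1 - b) + p.2 ^ 2 + (t * L + t ^ 2 * Q) := by
    intro t
    have : p.1 + t • (q.1 - p.1) - b = (p.1 - b) + t • (q.1 - p.1) := by abel
    rw [this, wNormSq_add_smul, hL, hQ]
    ring
  have hslope : 0 ≤ L := by
    refine slope_nonneg_of_quadratic_nonneg (Q := Q) fun t h0 h1 => ?_
    have hmem : (p.1 + t • (q.1 - p.1), p.2 + t * (q.2 - p.2)) ∈ polyCone (G.wcut r) := by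
      have h2 := (((G.mem_polyCone_wcut).1 hp.1).smul (sub_nonneg.2 h1)).add
        (((G.mem_polyCone_wcut).1 hq).smul h0.le)
      refine G.mem_polyCone_wcut.2 ?_
      convert h2 using 1
      · funext i
        simp
        ring
      · ring
    have := hp.2 _ hmem
    rw [hexp] at this
    linarith
  have h1 := hexp 1
  have h2 : p.1 + (1 : ℝ) • (q.1 - p.1) - b = q.1 - b := by rw [one_smul]; abel
  rw [h2] at h1
  have h3 : (p.2 + 1 * (q.2 - p.2)) = q.2 := by ring
  rw [h3] at h1
  rw [h1]
  linarith

/-- The point projected by RCD: `2 W a - ∑_{r' ≠ r} y_{r'}`. -/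
def rcdPoint (W a : Fin N → ℝ) (z : DualVar N R) (r : Fin R) : Fin N → ℝ :=
  2 • (W * a) - (∑ s, z.1 s - z.1 r)

theorem dualObj_setBlock_eq (W a : Fin N → ℝ) (z : DualVar N R) (r : Fin R)
    (p : (Fin N → ℝ) × ℝ) :
    dualObj W a (setBlock z r p) = wNormSq W⁻¹ (p.1 - rcdPoint W a z r) + p.2 ^ 2
      + ∑ s ∈ Finset.univ.erase r, z.2 s ^ 2 := by
  have h1 : ∑ s, (setBlock z r p).1 s - 2 • (W * a) = p.1 - rcdPoint W a z r := by
    rw [← Finset.add_sum_erase _ _ (Finset.mem_univ r), rcdPoint,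
      ← Finset.add_sum_erase _ z.1 (Finset.mem_univ r)]
    have : ∑ s ∈ Finset.univ.erase r, (setBlock z r p).1 s = ∑ s ∈ Finset.univ.erase r, z.1 s :=
      Finset.sum_congr rfl fun s hs => by
        have := Finset.ne_of_mem_erase hs
        simp [setBlock, this]
    rw [this]
    simp only [setBlock, Function.update_self]
    abel
  have h2 : ∑ s, (setBlock z r p).2 s ^ 2 = p.2 ^ 2 + ∑ s ∈ Finset.univ.erase r, z.2 s ^ 2 := by
    rw [← Finset.add_sum_erase _ _ (Finset.mem_univ r)]
    congr 1
    · simp [setBlock]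
    · exact Finset.sum_congr rfl fun s hs => by
        have := Finset.ne_of_mem_erase hs
        simp [setBlock, this]
  rw [dualObj, h1, h2, add_assoc]

/-- Averaged descent of RCD towards a solution `z'`. Exact minimization over the block `r` beats the
block of `z'` by its squared distance. -/
theorem rcd_descent {W : Fin N → ℝ} (hW : ∀ i, 0 < W i) (a : Fin N → ℝ) {z z' : DualVar N R}
    (hz' : z' ∈ prodCone G.wcut) (p : Fin R → (Fin N → ℝ) × ℝ)
    (hp : ∀ r, IsConeProj (G.wcut r) (rcdPoint W a z r) W⁻¹ (p r)) :
    ∑ r, (dualObj W a (setBlock z r (p r)) + dualNormSq W⁻¹ (setBlock z r (p r) - z'))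
      ≤ R * (dualObj W a z + dualNormSq W⁻¹ (z - z')) - (dualObj W a z - dualObj W a z') := by
  -- the expansion of `g` in the block `r` has the same quadratic part as the norm, so the distances
  -- cancel and only the linear term of the block is left
  have hr : ∀ r, dualObj W a (setBlock z r (p r)) + dualNormSq W⁻¹ (setBlock z r (p r) - z')
      ≤ dualObj W a z + dualNormSq W⁻¹ (z - z') + blockLin W a z (z' - z) r := by
    intro r
    have h1 := IsConeProj.three_point (hp r) (hz' r)
    have h2 := dualObj_setBlock_eq W a z r (p r)
    have h3 := dualObj_setBlock_eq W a z r (z'.1 r, z'.2 r)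
    have h4 := dualObj_setBlock hW a z z' r
    have h5 := dualNormSq_setBlock W⁻¹ z z' r (p r)
    simp only at h1 h3
    linarith
  refine (Finset.sum_le_sum fun r _ => hr r).trans ?_
  rw [Finset.sum_add_distrib, Finset.sum_const, Finset.card_univ, Fintype.card_fin, nsmul_eq_mul]
  have h1 := dualObj_eq hW a z z'
  have h2 := dualQuad_nonneg hW (z' - z)
  have h3 : ∑ r, blockLin W a z (z' - z) r = dualLin W a z (z' - z) := rfl
  linarith

theorem psi_pos (G : DirHypergraph N R) (i : Fin N) : 0 < G.psi i := by
  obtain ⟨r, hr⟩ := G.covered i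
  exact Nat.cast_pos.2 (Finset.card_pos.2 ⟨r, by simpa using hr⟩)

theorem InCone.eq_zero_of_notMem {r : Fin R} {y : Fin N → ℝ} {φ : ℝ} (h : G.InCone r y φ)
    {i : Fin N} (hi : i ∉ G.S r) : y i = 0 :=
  le_antisymm (h.2.1 i fun hH => hi (G.H_sub r hH)) (h.2.2.1 i fun hT => hi (G.T_sub r hT))

/-- Every coordinate `i` is shared by `Ψ_ii` blocks. -/
theorem dualQuad_le_dualNormSq {W : Fin N → ℝ} (hW : ∀ i, 0 < W i) {h : DualVar N R}
    (hh : ∀ r, ∀ i ∉ G.S r, h.1 r i = 0) :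
    dualQuad W h ≤ dualNormSq (fun i => G.psi i / W i) h := by
  refine add_le_add ?_ le_rfl
  unfold wNormSq
  rw [Finset.sum_comm]
  refine Finset.sum_le_sum fun i _ => ?_
  rw [← Finset.mul_sum, Pi.inv_apply]
  beta_reduce
  rw [div_eq_inv_mul, mul_assoc]
  refine mul_le_mul_of_nonneg_left ?_ (inv_pos.2 (hW i)).le
  rw [Finset.sum_apply]
  have h1 : ∑ r, h.1 r i = ∑ r ∈ Finset.univ.filter (fun r => i ∈ G.S r), h.1 r i := by
    rw [Finset.sum_filter]
    refine Finset.sum_congr rfl fun r _ => ?_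
    split_ifs with hi
    · rfl
    · exact hh r i hi
  rw [h1]
  refine sq_sum_le_card_mul_sum_sq.trans ?_
  refine mul_le_mul_of_nonneg_left ?_ (Nat.cast_nonneg _)
  exact Finset.sum_le_sum_of_subset_of_nonneg (Finset.subset_univ _) fun _ _ _ => sq_nonneg _

/-- The point projected by AP, `y_r - Ψ⁻¹ (∑_{r'} y_{r'} - 2 W a)`, written with the primal
vector. -/
noncomputable def apPoint (G : DirHypergraph N R) (W a : Fin N → ℝ) (z : DualVar N R) (r : Fin R) :
    Fin N → ℝ :=
  fun i => z.1 r i + 2 * W i * primalOf W a z i / G.psi i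

/-- Descent of AP, a projected gradient method: in the norm of `Ψ W⁻¹` the dual objective lies below
its linearization plus the squared distance. -/
theorem ap_descent {W : Fin N → ℝ} (hW : ∀ i, 0 < W i) (a : Fin N → ℝ) {z z' z₁ : DualVar N R}
    (hz : z ∈ prodCone G.wcut) (hz' : z' ∈ prodCone G.wcut)
    (hp : ∀ r, IsConeProj (G.wcut r) (G.apPoint W a z r) (fun i => G.psi i / W i)
      (z₁.1 r, z₁.2 r)) :
    dualObj W a z₁ + dualNormSq (fun i => G.psi i / W i) (z₁ - z')
      ≤ dualObj W a z' + dualNormSq (fun i => G.psi i / W i) (z - z') := by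
  set W' : Fin N → ℝ := fun i => G.psi i / W i with hW'
  -- completing the square, the projection minimizes the linearization of `g` at `z` plus the
  -- squared distance to `z`
  have hexp : ∀ (r : Fin R) (v : Fin N → ℝ), wNormSq W' (v - G.apPoint W a z r)
      = wNormSq W' (v - z.1 r) - 4 * ∑ i, (v i - z.1 r i) * primalOf W a z i
        + wNormSq W' (z.1 r - G.apPoint W a z r) := by
    intro r v
    unfold wNormSq
    rw [Finset.mul_sum, ← Finset.sum_sub_distrib, ← Finset.sum_add_distrib]
    refine Finset.sum_congr rfl fun i _ => ?_
    have h1 := (hW i).ne'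
    have h2 := (G.psi_pos i).ne'
    simp only [Pi.sub_apply, apPoint, hW']
    field_simp
    ring
  have hsym : ∀ u v : DualVar N R, dualNormSq W' (u - v) = dualNormSq W' (v - u) := fun u v => by
    unfold dualNormSq wNormSq
    congr 1
    · exact Finset.sum_congr rfl fun r _ => Finset.sum_congr rfl fun i _ => by
        simp only [Pi.sub_apply, Prod.fst_sub]; ring
    · exact Finset.sum_congr rfl fun r _ => by
        simp only [Pi.sub_apply, Prod.snd_sub]; ring
  have hr : ∀ r, blockLin W a z (z₁ - z) r + (wNormSq W' ((z₁ - z).1 r) + (z₁ - z).2 r ^ 2)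
        + (wNormSq W' ((z' - z₁).1 r) + (z' - z₁).2 r ^ 2)
      ≤ blockLin W a z (z' - z) r + (wNormSq W' ((z' - z).1 r) + (z' - z).2 r ^ 2) := by
    intro r
    have h1 := IsConeProj.three_point (hp r) (hz' r)
    rw [hexp r (z₁.1 r, z₁.2 r).1, hexp r (z'.1 r, z'.2 r).1] at h1
    simp only [blockLin, Prod.fst_sub, Prod.snd_sub, Pi.sub_apply]
    linarith
  have hsum := Finset.sum_le_sum fun r (_ : r ∈ Finset.univ) => hr r
  simp only [Finset.sum_add_distrib] at hsum
  have h1 := dualObj_eq hW a z z'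
  have h2 := dualQuad_nonneg hW (z' - z)
  have h3 := dualObj_eq hW a z z₁
  have h4 : dualQuad W (z₁ - z) ≤ dualNormSq W' (z₁ - z) := by
    refine dualQuad_le_dualNormSq hW fun r i hi => ?_
    have e1 := InCone.eq_zero_of_notMem (G.mem_polyCone_wcut.1 (hp r).1) hi
    have e2 := InCone.eq_zero_of_notMem (G.mem_polyCone_wcut.1 (hz r)) hi
    simp [e1, e2]
  have h5 : ∑ r, blockLin W a z (z' - z) r = dualLin W a z (z' - z) := rfl
  have h6 : ∑ r, blockLin W a z (z₁ - z) r = dualLin W a z (z₁ - z) := rfl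
  rw [hsym z₁ z', hsym z z']
  unfold dualNormSq at h4 ⊢
  linarith

theorem primal_error_le {W : Fin N → ℝ} (hW : ∀ i, 0 < W i) (a : Fin N → ℝ) (z z' : DualVar N R) :
    wNormSq W (primalOf W a z - primalOf W a z') ≤ dualQuad W (z - z') := by
  have h1 : wNormSq W (primalOf W a z - primalOf W a z') * 4
      = wNormSq W⁻¹ (∑ r, (z - z').1 r) := by
    unfold wNormSq
    rw [Finset.sum_mul]
    refine Finset.sum_congr rfl fun i _ => ?_
    have := (hW i).ne'
    simp only [primalOf, Pi.sub_apply, Pi.inv_apply, Prod.fst_sub, Finset.sum_apply,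
      Finset.sum_sub_distrib]
    field_simp
    ring
  have h2 := wNormSq_nonneg hW (primalOf W a z - primalOf W a z')
  have h3 : 0 ≤ ∑ r, (z - z').2 r ^ 2 := Finset.sum_nonneg fun _ _ => sq_nonneg _
  unfold dualQuad
  linarith

end DirHypergraph

/-! ### Values and times of the elementary routines -/

namespace Timed

variable {α β : Type}

@[simp] theorem val_bind (m : Timed α) (f : α → Timed β) : (m >>= f).val = (f m.val).val := rfl
@[simp] theorem time_bind (m : Timed α) (f : α → Timed β) :
    (m >>= f).time = m.time + (f m.val).time := rfl
@[simp] theorem val_pure (a : α) : (pure a : Timed α).val = a := rfl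
@[simp] theorem time_pure (a : α) : (pure a : Timed α).time = 0 := rfl

end Timed

namespace RAM

@[simp] theorem tick_time : tick.time = 1 := rfl
@[simp] theorem add_val (x y : ℝ) : (add x y).val = x + y := rfl
@[simp] theorem add_time (x y : ℝ) : (add x y).time = 1 := rfl
@[simp] theorem sub_val (x y : ℝ) : (sub x y).val = x - y := rfl
@[simp] theorem sub_time (x y : ℝ) : (sub x y).time = 1 := rfl
@[simp] theorem mul_val (x y : ℝ) : (mul x y).val = x * y := rfl
@[simp] theorem mul_time (x y : ℝ) : (mul x y).time = 1 := rfl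
@[simp] theorem sqrt_val (x : ℝ) : (sqrt x).val = √x := rfl
@[simp] theorem sqrt_time (x : ℝ) : (sqrt x).time = 1 := rfl
@[simp] theorem le_val (x y : ℝ) : (le x y).val = decide (x ≤ y) := rfl
@[simp] theorem le_time (x y : ℝ) : (le x y).time = 1 := rfl

section Arrays
variable {ι : Type}
@[simp] theorem read_val (t : ι → ℝ) (i : ι) : (read t i).val = t i := rfl
@[simp] theorem read_time (t : ι → ℝ) (i : ι) : (read t i).time = 1 := rfl
@[simp] theorem alloc_time (n : ℕ) : (alloc n).time = n := rfl
end Arrays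

variable {α β σ : Type}

theorem forEach_val (f : σ → α → Timed σ) (l : List α) (s : σ) :
    (forEach f l s).val = l.foldl (fun s a => (f s a).val) s := by
  induction l generalizing s with
  | nil => rfl
  | cons a l ih => simp [forEach, ih]

theorem forEach_time_le (f : σ → α → Timed σ) (c : α → ℕ) (l : List α)
    (h : ∀ s, ∀ a ∈ l, (f s a).time ≤ c a) (s : σ) :
    (forEach f l s).time ≤ (l.map fun a => c a + 1).sum + 1 := by
  induction l generalizing s with
  | nil => simp [forEach]
  | cons a l ih =>
    have h1 := ih (fun s b hb => h s b (List.mem_cons_of_mem a hb)) (f s a).val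
    have h2 := h s a List.mem_cons_self
    simp only [forEach, Timed.time_bind, tick_time, List.map_cons, List.sum_cons]
    omega

theorem forEach_time_le_const (f : σ → α → Timed σ) (c : ℕ) (l : List α)
    (h : ∀ s, ∀ a ∈ l, (f s a).time ≤ c) (s : σ) :
    (forEach f l s).time ≤ l.length * (c + 1) + 1 := by
  have := forEach_time_le f (fun _ => c) l h s
  simpa using this

theorem mapL_val (f : α → Timed β) (l : List α) : (mapL f l).val = l.map fun a => (f a).val := by
  induction l with
  | nil => rfl
  | cons a l ih => simp [mapL, ih]

theorem mapL_time_le (f : α → Timed β) (c : ℕ) (l : List α) (h : ∀ a, (f a).time ≤ c) :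
    (mapL f l).time ≤ l.length * (c + 1) + 1 := by
  induction l with
  | nil => simp [mapL]
  | cons a l ih =>
    have := h a
    simp only [mapL, Timed.time_bind, tick_time, Timed.time_pure, List.length_cons]
    linarith

theorem split_perm (l : List α) : ((split l).val.1 ++ (split l).val.2).Perm l := by
  induction l with
  | nil => rfl
  | cons a l ih =>
    simp only [split, Timed.val_bind, Timed.val_pure, List.cons_append]
    exact (List.perm_append_comm.trans ih).cons a

theorem split_length (l : List α) :
    (split l).val.1.length = (l.length + 1) / 2 ∧ (split l).val.2.length = l.length / 2 := by
  induction l with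
  | nil => simp [split]
  | cons a l ih =>
    simp only [split, Timed.val_bind, Timed.val_pure, List.length_cons]
    omega

theorem split_time (l : List α) : (split l).time = l.length + 1 := by
  induction l with
  | nil => rfl
  | cons a l ih => simp [split, ih]; omega

/-- The order of the keys: ascending if `asc = true`, descending otherwise. -/
def KeyLe (asc : Bool) (a b : ℝ × ℝ) : Prop := if asc then a.1 ≤ b.1 else b.1 ≤ a.1

theorem KeyLe.trans {asc : Bool} {a b c : ℝ × ℝ} (h₁ : KeyLe asc a b) (h₂ : KeyLe asc b c) :
    KeyLe asc a c := by
  cases asc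
  · exact le_trans (show c.1 ≤ b.1 from h₂) h₁
  · exact le_trans (show a.1 ≤ b.1 from h₁) h₂

theorem KeyLe.of_not {asc : Bool} {a b : ℝ × ℝ} (h : ¬ KeyLe asc a b) : KeyLe asc b a := by
  cases asc
  · exact (not_le.1 (show ¬ b.1 ≤ a.1 from h)).le
  · exact (not_le.1 (show ¬ a.1 ≤ b.1 from h)).le

theorem merge_cons_cons_val (asc : Bool) (a b : ℝ × ℝ) (k l : List (ℝ × ℝ)) :
    (merge asc (a :: k) (b :: l)).val = open Classical in if KeyLe asc a b
      then a :: (merge asc k (b :: l)).val else b :: (merge asc (a :: k) l).val := by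
  rw [merge]
  cases asc
  · by_cases h : b.1 ≤ a.1 <;> simp [KeyLe, h]
  · by_cases h : a.1 ≤ b.1 <;> simp [KeyLe, h]

theorem merge_time_le (asc : Bool) (k l : List (ℝ × ℝ)) :
    (merge asc k l).time ≤ 2 * (k.length + l.length) + 1 := by
  match k, l with
  | [], l => simp [merge]
  | a :: k, [] => simp [merge]
  | a :: k, b :: l =>
    have h1 := merge_time_le asc k (b :: l)
    have h2 := merge_time_le asc (a :: k) l
    rw [merge]
    simp only [List.length_cons] at *
    cases asc
    · by_cases h : b.1 ≤ a.1
      · simp [h]; omega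
      · simp [h]; omega
    · by_cases h : a.1 ≤ b.1
      · simp [h]; omega
      · simp [h]; omega
  termination_by k.length + l.length

theorem merge_perm (asc : Bool) (k l : List (ℝ × ℝ)) : (merge asc k l).val.Perm (k ++ l) := by
  match k, l with
  | [], l => simp [merge]
  | a :: k, [] => simp [merge]
  | a :: k, b :: l =>
    have h1 := merge_perm asc k (b :: l)
    have h2 := merge_perm asc (a :: k) l
    rw [merge_cons_cons_val]
    split_ifs
    · exact h1.cons a
    · exact (h2.cons b).trans List.perm_middle.symm
  termination_by k.length + l.length

theorem merge_sorted (asc : Bool) (k l : List (ℝ × ℝ)) (hk : k.Pairwise (KeyLe asc))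
    (hl : l.Pairwise (KeyLe asc)) : (merge asc k l).val.Pairwise (KeyLe asc) := by
  match k, l with
  | [], l => simpa [merge] using hl
  | a :: k, [] => simpa [merge] using hk
  | a :: k, b :: l =>
    rw [List.pairwise_cons] at hk hl
    have h1 := merge_sorted asc k (b :: l) hk.2 (List.pairwise_cons.2 hl)
    have h2 := merge_sorted asc (a :: k) l (List.pairwise_cons.2 hk) hl.2
    rw [merge_cons_cons_val]
    split_ifs with h
    · refine List.pairwise_cons.2 ⟨fun c hc => ?_, h1⟩
      have := (merge_perm asc k (b :: l)).mem_iff.1 hc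
      simp only [List.mem_append, List.mem_cons] at this
      rcases this with hc | rfl | hc
      · exact hk.1 c hc
      · exact h
      · exact h.trans (hl.1 c hc)
    · have hba := KeyLe.of_not h
      refine List.pairwise_cons.2 ⟨fun c hc => ?_, h2⟩
      have := (merge_perm asc (a :: k) l).mem_iff.1 hc
      simp only [List.cons_append, List.mem_append, List.mem_cons] at this
      rcases this with rfl | hc | hc
      · exact hba
      · exact hba.trans (hk.1 c hc)
      · exact hl.1 c hc
  termination_by k.length + l.length

theorem mergeSortAux_perm (asc : Bool) (n : ℕ) (l : List (ℝ × ℝ)) :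
    (mergeSortAux asc n l).val.Perm l := by
  induction n generalizing l with
  | zero => rfl
  | succ n ih =>
    match l with
    | [] => rfl
    | [a] => rfl
    | a :: b :: l =>
      simp only [mergeSortAux, Timed.val_bind]
      exact (merge_perm _ _ _).trans (((ih _).append (ih _)).trans (split_perm _))

theorem mergeSortAux_sorted (asc : Bool) (n : ℕ) (l : List (ℝ × ℝ)) (hl : l.length ≤ n) :
    (mergeSortAux asc n l).val.Pairwise (KeyLe asc) := by
  induction n generalizing l with
  | zero =>
    have : l = [] := by simpa using hl
    subst this
    exact List.Pairwise.nil
  | succ n ih =>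
    match l with
    | [] => exact List.Pairwise.nil
    | [a] => exact List.pairwise_singleton _ _
    | a :: b :: l =>
      have h := split_length (a :: b :: l)
      simp only [List.length_cons] at h hl
      simp only [mergeSortAux, Timed.val_bind]
      exact merge_sorted _ _ _ (ih _ (by omega)) (ih _ (by omega))

/-- The bound satisfies the recursion of merge sort, since halving a list of length at least two
decreases `⌈log₂⌉` by one and the two halves have total length `n`. -/
theorem mergeSortAux_time_le (asc : Bool) (n : ℕ) (l : List (ℝ × ℝ)) :
    (mergeSortAux asc n l).time ≤ 1 + 5 * l.length * Nat.clog 2 l.length := by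
  induction n generalizing l with
  | zero => simp [mergeSortAux]
  | succ n ih =>
    match l with
    | [] => simp [mergeSortAux]
    | [a] => simp [mergeSortAux]
    | a :: b :: l =>
      obtain ⟨h1, h2⟩ := split_length (a :: b :: l)
      have h3 := ih (split (a :: b :: l)).val.1
      have h4 := ih (split (a :: b :: l)).val.2
      have h5 := merge_time_le asc (mergeSortAux asc n (split (a :: b :: l)).val.1).val
        (mergeSortAux asc n (split (a :: b :: l)).val.2).val
      rw [(mergeSortAux_perm asc n _).length_eq, (mergeSortAux_perm asc n _).length_eq] at h5
      have h6 := split_time (a :: b :: l)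
      have hn : 2 ≤ (a :: b :: l).length := by simp
      have h7 : (mergeSortAux asc (n + 1) (a :: b :: l)).time
          = 1 + ((split (a :: b :: l)).time + ((mergeSortAux asc n (split (a :: b :: l)).val.1).time
            + ((mergeSortAux asc n (split (a :: b :: l)).val.2).time
              + (merge asc (mergeSortAux asc n (split (a :: b :: l)).val.1).val
        (mergeSortAux asc n (split (a :: b :: l)).val.2).val).time))) := by
        simp only [mergeSortAux, Timed.time_bind, tick_time]
      rw [h7]
      generalize (a :: b :: l).length = m at *
      have h8 : Nat.clog 2 m = Nat.clog 2 ((m + 1) / 2) + 1 := Nat.clog_of_two_le one_lt_two hn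
      have h9 : Nat.clog 2 (m / 2) ≤ Nat.clog 2 ((m + 1) / 2) :=
        Nat.clog_mono_right 2 (by omega)
      rw [h1] at h3
      rw [h2] at h4
      have h10 : 5 * (m / 2) * Nat.clog 2 (m / 2) ≤ 5 * (m / 2) * Nat.clog 2 ((m + 1) / 2) :=
        Nat.mul_le_mul_left _ h9
      have h11 : (m + 1) / 2 + m / 2 = m := by omega
      have h12 : 5 * ((m + 1) / 2) * Nat.clog 2 ((m + 1) / 2)
            + 5 * (m / 2) * Nat.clog 2 ((m + 1) / 2)
          = 5 * m * Nat.clog 2 ((m + 1) / 2) := by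
        rw [← add_mul, ← mul_add, h11]
      have h13 : 5 * m * (Nat.clog 2 ((m + 1) / 2) + 1)
          = 5 * m * Nat.clog 2 ((m + 1) / 2) + 5 * m := by ring
      rw [h8, h13]
      omega

/-- Merge sort takes `O(n log n)` steps. -/
theorem mergeSort_time_le (asc : Bool) {l : List (ℝ × ℝ)} {n : ℕ} (hn : 2 ≤ n)
    (hl : l.length ≤ n) : ((mergeSort asc l).time : ℝ) ≤ 1 + 15 * (n * Real.log n) := by
  have h1 : (mergeSort asc l).time ≤ 1 + 5 * n * Nat.clog 2 n :=
    (mergeSortAux_time_le asc _ l).trans (Nat.add_le_add_left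
      (Nat.mul_le_mul (Nat.mul_le_mul_left _ hl) (Nat.clog_mono_right 2 hl)) _)
  have h2 : 2 ^ (Nat.clog 2 n).pred < n := Nat.pow_pred_clog_lt_self one_lt_two hn
  have hpos : 0 < Nat.clog 2 n := Nat.clog_pos one_lt_two hn
  have h3 : ((Nat.clog 2 n : ℝ) - 1) * Real.log 2 ≤ Real.log n := by
    have h4 : ((2 : ℝ) ^ (Nat.clog 2 n).pred) ≤ n := by exact_mod_cast h2.le
    have h5 := Real.log_le_log (by positivity) h4
    rw [Real.log_pow] at h5
    have h6 : ((Nat.clog 2 n).pred : ℝ) = (Nat.clog 2 n : ℝ) - 1 := by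
      rw [Nat.pred_eq_sub_one, Nat.cast_sub hpos, Nat.cast_one]
    rwa [h6] at h5
  have h7 : Real.log 2 ≤ Real.log n := Real.log_le_log two_pos (by exact_mod_cast hn)
  have h8 := Real.log_two_gt_d9
  have h9 : (Nat.clog 2 n : ℝ) ≤ 3 * Real.log n := by nlinarith
  have h10 : ((mergeSort asc l).time : ℝ) ≤ 1 + 5 * n * Nat.clog 2 n := by exact_mod_cast h1
  have h11 : (5 * (n : ℝ)) * Nat.clog 2 n ≤ 5 * n * (3 * Real.log n) :=
    mul_le_mul_of_nonneg_left h9 (by positivity)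
  linarith

theorem mergeSort_perm (asc : Bool) (l : List (ℝ × ℝ)) : (mergeSort asc l).val.Perm l :=
  mergeSortAux_perm _ _ _

theorem mergeSort_sorted (asc : Bool) (l : List (ℝ × ℝ)) :
    (mergeSort asc l).val.Pairwise (KeyLe asc) :=
  mergeSortAux_sorted _ _ _ le_rfl

end RAM

/-! ### The line search -/

namespace Projection

open RAM

/-- The sum `∑ u (b - γ)⁺` over the pairs `(b, u)` of a list. -/
noncomputable def excess (γ : ℝ) (l : List (ℝ × ℝ)) : ℝ :=
  (l.map fun p => p.2 * max (p.1 - γ) 0).sum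

/-- The sum `∑ u (δ - b)⁺` over the pairs `(b, u)` of a list. -/
noncomputable def deficit (δ : ℝ) (l : List (ℝ × ℝ)) : ℝ :=
  (l.map fun p => p.2 * max (δ - p.1) 0).sum

/-- The optimality conditions reached by the line search from the state `(γ, δ)`, where `m` is the
common value of the excess of the passed heads at `γ` and the deficit of the passed tails at `δ`,
and `wH`, `wT` are their total weights: at the point `p` found, excess and deficit equal
`p.1 - p.2`. -/
def Balanced (hs ts : List (ℝ × ℝ)) (γ δ wH wT m : ℝ) (p : ℝ × ℝ) : Prop :=
  p.1 ≤ γ ∧ δ ≤ p.2 ∧ p.2 < p.1 ∧ m + wH * (γ - p.1) + excess p.1 hs = p.1 - p.2 ∧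
    m + wT * (p.2 - δ) + deficit p.2 ts = p.1 - p.2

theorem excess_eq_zero {γ : ℝ} {l : List (ℝ × ℝ)} (h : ∀ p ∈ l, p.1 ≤ γ) : excess γ l = 0 := by
  refine List.sum_eq_zero fun x hx => ?_
  obtain ⟨p, hp, rfl⟩ := List.mem_map.1 hx
  rw [max_eq_right (sub_nonpos.2 (h p hp)), mul_zero]

theorem deficit_eq_zero {δ : ℝ} {l : List (ℝ × ℝ)} (h : ∀ p ∈ l, δ ≤ p.1) : deficit δ l = 0 := by
  refine List.sum_eq_zero fun x hx => ?_
  obtain ⟨p, hp, rfl⟩ := List.mem_map.1 hx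
  rw [max_eq_right (sub_nonpos.2 (h p hp)), mul_zero]

/-- Moving `(γ, δ)` by `(-wT σ, wH σ)` keeps excess and deficit equal and changes the derivative at
rate `-(wT wH + wT + wH)`; the final step is the zero of the derivative. -/
theorem balanced_finish {hs ts : List (ℝ × ℝ)} {γ δ wH wT m Δ q : ℝ} (hwH : 0 < wH) (hwT : 0 < wT)
    (hm : 0 ≤ m) (hΔ : 0 < Δ) (hΔm : Δ = γ - δ - m) (hq : q = Δ / (wT * wH + wT + wH))
    (hh : ∀ p ∈ hs, p.1 ≤ γ - wT * q) (ht : ∀ p ∈ ts, δ + wH * q ≤ p.1) :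
    Balanced hs ts γ δ wH wT m (γ - wT * q, δ + wH * q) := by
  have hK : 0 < wT * wH + wT + wH := by positivity
  have hq0 : 0 < q := hq ▸ div_pos hΔ hK
  have hqK : q * (wT * wH + wT + wH) = Δ := by rw [hq]; field_simp
  have h1 := mul_pos hwT hq0
  have h2 := mul_pos hwH hq0
  have h3 := mul_pos hwH h1
  refine ⟨by simp only; linarith, by simp only; linarith, ?_, ?_, ?_⟩
  · simp only; nlinarith
  · simp only [excess_eq_zero hh]; nlinarith
  · simp only [deficit_eq_zero ht]; nlinarith

/-- The point found after a move to the next head breakpoint is also balanced for the state before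
the move: the passed head enters the excess with its own term. -/
theorem Balanced.head {h : ℝ × ℝ} {hs ts : List (ℝ × ℝ)} {γ δ wH wT m σ : ℝ} {p : ℝ × ℝ}
    (hwH : 0 ≤ wH) (hσ : 0 ≤ σ) (hγ : wT * σ = γ - h.1) (hle : h.1 ≤ γ)
    (hb : Balanced hs ts h.1 (δ + wH * σ) (wH + h.2) wT (m + wH * wT * σ) p) :
    Balanced (h :: hs) ts γ δ wH wT m p := by
  obtain ⟨h1, h2, h3, h4, h5⟩ := hb
  have h6 := mul_nonneg hwH hσ
  refine ⟨h1.trans hle, by linarith, h3, ?_, ?_⟩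
  · rw [← h4]
    simp only [excess, List.map_cons, List.sum_cons]
    rw [max_eq_left (sub_nonneg.2 h1), mul_assoc wH wT σ, hγ]
    ring
  · rw [← h5]; ring

/-- The counterpart of `Balanced.head` for a tail breakpoint. -/
theorem Balanced.tail {t : ℝ × ℝ} {hs ts : List (ℝ × ℝ)} {γ δ wH wT m σ : ℝ} {p : ℝ × ℝ}
    (hwT : 0 ≤ wT) (hσ : 0 ≤ σ) (hδ : wH * σ = t.1 - δ) (hle : δ ≤ t.1)
    (hb : Balanced hs ts (γ - wT * σ) t.1 wH (wT + t.2) (m + wH * wT * σ) p) :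
    Balanced hs (t :: ts) γ δ wH wT m p := by
  obtain ⟨h1, h2, h3, h4, h5⟩ := hb
  have h6 := mul_nonneg hwT hσ
  refine ⟨by linarith, hle.trans h2, h3, ?_, ?_⟩
  · rw [← h4]; ring
  · rw [← h5]
    simp only [deficit, List.map_cons, List.sum_cons]
    rw [max_eq_left (sub_nonneg.2 h2), mul_right_comm wH wT σ, hδ]
    ring

/-- If the stopping test succeeds at the parameter `σ` of the next breakpoint, then the zero of the
derivative comes before it. -/
theorem zero_le_of_halt {γ δ wH wT m Δ σ : ℝ} (hwH : 0 < wH) (hwT : 0 < wT) (hm : 0 ≤ m)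
    (hσ : 0 ≤ σ) (hΔm : Δ = γ - δ - m)
    (hhalt : γ - wT * σ ≤ δ + wH * σ ∨ Δ - (wT * wH + wT + wH) * σ ≤ 0) :
    Δ / (wT * wH + wT + wH) ≤ σ := by
  have hK : 0 < wT * wH + wT + wH := by positivity
  rw [div_le_iff₀ hK]
  rcases hhalt with h | h
  · have := mul_nonneg (mul_pos hwT hwH).le hσ
    nlinarith
  · linarith

theorem finish_val (γ δ wH wT Δ : ℝ) : (finish γ δ wH wT Δ).val
    = (γ - wT * (Δ / (wT * wH + wT + wH)), δ + wH * (Δ / (wT * wH + wT + wH))) := rfl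

theorem newDeriv_val (γ δ γ' δ' wH Δ : ℝ) : (newDeriv γ δ γ' δ' wH Δ).val
    = Δ - (γ - γ' + (δ' - δ)) - wH * (γ - γ') := rfl

theorem stopTest_val (γ δ Δ : ℝ) : (stopTest γ δ Δ).val = (decide (γ ≤ δ) || decide (Δ ≤ 0)) := rfl

theorem partnerH_val (γ δ wH wT γ₁ : ℝ) : (partnerH γ δ wH wT γ₁).val
    = δ + (γ - γ₁) * wH / wT := rfl

theorem partnerT_val (γ δ wH wT δ₂ : ℝ) : (partnerT γ δ wH wT δ₂).val
    = γ - (δ₂ - δ) * wT / wH := rfl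

/-- The invariant of the line search: `Δ = γ - δ - m` is positive, where `m` is the mass moved so
far, and the remaining breakpoints lie outside `[γ, ∞)` and `(-∞, δ]` up to ties. -/
structure SearchInv (hs ts : List (ℝ × ℝ)) (γ δ wH wT Δ m : ℝ) : Prop where
  wH_pos : 0 < wH
  wT_pos : 0 < wT
  m_nonneg : 0 ≤ m
  Δ_pos : 0 < Δ
  Δ_eq : Δ = γ - δ - m
  hs_le : ∀ p ∈ hs, p.1 ≤ γ ∧ 0 < p.2
  le_ts : ∀ p ∈ ts, δ ≤ p.1 ∧ 0 < p.2
  hs_sorted : hs.Pairwise (KeyLe false)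
  ts_sorted : ts.Pairwise (KeyLe true)

/-- A move to the next head breakpoint: either the search stops before it, or the invariant is
kept. The last hypothesis says that no tail breakpoint is passed. -/
theorem SearchInv.head_step {h : ℝ × ℝ} {hs ts : List (ℝ × ℝ)} {γ δ wH wT Δ m : ℝ}
    (inv : SearchInv (h :: hs) ts γ δ wH wT Δ m)
    (hfirst : ∀ t ∈ ts, δ + (γ - h.1) * wH / wT ≤ t.1)
    (rec : SearchInv hs ts h.1 (δ + (γ - h.1) * wH / wT) (wH + h.2) wT
        (Δ - (γ - h.1 + (δ + (γ - h.1) * wH / wT - δ)) - wH * (γ - h.1))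
        (m + wH * (γ - h.1)) →
      Balanced hs ts h.1 (δ + (γ - h.1) * wH / wT) (wH + h.2) wT (m + wH * (γ - h.1))
        (search hs ts h.1 (δ + (γ - h.1) * wH / wT) (wH + h.2) wT
        (Δ - (γ - h.1 + (δ + (γ - h.1) * wH / wT - δ)) - wH * (γ - h.1))).val) :
    Balanced (h :: hs) ts γ δ wH wT m
      (if (decide (h.1 ≤ δ + (γ - h.1) * wH / wT) ||
          decide (Δ - (γ - h.1 + (δ + (γ - h.1) * wH / wT - δ)) - wH * (γ - h.1) ≤ 0)) = true
        then (finish γ δ wH wT Δ).val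
        else (search hs ts h.1 (δ + (γ - h.1) * wH / wT) (wH + h.2) wT
          (Δ - (γ - h.1 + (δ + (γ - h.1) * wH / wT - δ)) - wH * (γ - h.1))).val) := by
  have hwH := inv.wH_pos
  have hwT := inv.wT_pos
  have hhγ := (inv.hs_le h List.mem_cons_self).1
  have hsort := List.pairwise_cons.1 inv.hs_sorted
  set σ := (γ - h.1) / wT with hσdef
  have hσ : 0 ≤ σ := div_nonneg (sub_nonneg.2 hhγ) hwT.le
  have hγσ : wT * σ = γ - h.1 := by rw [hσdef]; field_simp
  have hδσ : δ + (γ - h.1) * wH / wT = δ + wH * σ := by rw [hσdef]; ring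
  have hΔσ : Δ - (γ - h.1 + (δ + wH * σ - δ)) - wH * (γ - h.1)
      = Δ - (wT * wH + wT + wH) * σ := by rw [← hγσ]; ring
  have hmσ : m + wH * (γ - h.1) = m + wH * wT * σ := by rw [← hγσ]; ring
  rw [hδσ] at hfirst ⊢
  rw [hδσ, hΔσ] at rec
  rw [hΔσ]
  split_ifs with hhalt
  · simp only [Bool.or_eq_true, decide_eq_true_eq] at hhalt
    have hq := zero_le_of_halt hwH hwT inv.m_nonneg hσ inv.Δ_eq
      (hhalt.imp_left fun h' => by linarith)
    rw [finish_val]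
    refine balanced_finish hwH hwT inv.m_nonneg inv.Δ_pos inv.Δ_eq rfl (fun p hp => ?_)
      fun p hp => ?_
    · have h1 := mul_le_mul_of_nonneg_left hq hwT.le
      have h2 : p.1 ≤ h.1 := by
        rcases List.mem_cons.1 hp with rfl | hp
        · exact le_rfl
        · exact hsort.1 p hp
      linarith
    · have h1 := mul_le_mul_of_nonneg_left hq hwH.le
      linarith [hfirst p hp]
  · simp only [Bool.or_eq_true, decide_eq_true_eq, not_or, not_le] at hhalt
    refine Balanced.head hwH.le hσ hγσ hhγ ?_
    rw [← hmσ]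
    have hmpos : 0 ≤ wH * (γ - h.1) := mul_nonneg hwH.le (sub_nonneg.2 hhγ)
    refine rec ⟨?_, hwT, ?_, hhalt.2, ?_, fun p hp => ⟨hsort.1 p hp, ?_⟩, fun p hp => ⟨?_, ?_⟩,
      hsort.2, inv.ts_sorted⟩
    · linarith [(inv.hs_le h List.mem_cons_self).2]
    · linarith [inv.m_nonneg]
    · rw [← hΔσ, inv.Δ_eq]; ring
    · exact (inv.hs_le p (List.mem_cons_of_mem _ hp)).2
    · exact hfirst p hp
    · exact (inv.le_ts p hp).2

/-- The counterpart of `SearchInv.head_step` for a tail breakpoint. -/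
theorem SearchInv.tail_step {t : ℝ × ℝ} {hs ts : List (ℝ × ℝ)} {γ δ wH wT Δ m : ℝ}
    (inv : SearchInv hs (t :: ts) γ δ wH wT Δ m)
    (hfirst : ∀ h ∈ hs, h.1 ≤ γ - (t.1 - δ) * wT / wH)
    (rec : SearchInv hs ts (γ - (t.1 - δ) * wT / wH) t.1 wH (wT + t.2)
        (Δ - (γ - (γ - (t.1 - δ) * wT / wH) + (t.1 - δ)) - wH * (γ - (γ - (t.1 - δ) * wT / wH)))
        (m + wT * (t.1 - δ)) →
      Balanced hs ts (γ - (t.1 - δ) * wT / wH) t.1 wH (wT + t.2) (m + wT * (t.1 - δ))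
        (search hs ts (γ - (t.1 - δ) * wT / wH) t.1 wH (wT + t.2)
        (Δ - (γ - (γ - (t.1 - δ) * wT / wH) + (t.1 - δ))
          - wH * (γ - (γ - (t.1 - δ) * wT / wH)))).val) :
    Balanced hs (t :: ts) γ δ wH wT m
      (if (decide (γ - (t.1 - δ) * wT / wH ≤ t.1) ||
          decide (Δ - (γ - (γ - (t.1 - δ) * wT / wH) + (t.1 - δ))
            - wH * (γ - (γ - (t.1 - δ) * wT / wH)) ≤ 0)) = true
        then (finish γ δ wH wT Δ).val
        else (search hs ts (γ - (t.1 - δ) * wT / wH) t.1 wH (wT + t.2)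
          (Δ - (γ - (γ - (t.1 - δ) * wT / wH) + (t.1 - δ))
            - wH * (γ - (γ - (t.1 - δ) * wT / wH)))).val) := by
  have hwH := inv.wH_pos
  have hwT := inv.wT_pos
  have htδ := (inv.le_ts t List.mem_cons_self).1
  have hsort := List.pairwise_cons.1 inv.ts_sorted
  set σ := (t.1 - δ) / wH with hσdef
  have hσ : 0 ≤ σ := div_nonneg (sub_nonneg.2 htδ) hwH.le
  have hδσ : wH * σ = t.1 - δ := by rw [hσdef]; field_simp
  have hγσ : γ - (t.1 - δ) * wT / wH = γ - wT * σ := by rw [hσdef]; ring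
  have hΔσ : Δ - (γ - (γ - wT * σ) + (t.1 - δ)) - wH * (γ - (γ - wT * σ))
      = Δ - (wT * wH + wT + wH) * σ := by rw [← hδσ]; ring
  have hmσ : m + wT * (t.1 - δ) = m + wH * wT * σ := by rw [← hδσ]; ring
  rw [hγσ] at hfirst ⊢
  rw [hγσ, hΔσ] at rec
  rw [hΔσ]
  split_ifs with hhalt
  · simp only [Bool.or_eq_true, decide_eq_true_eq] at hhalt
    have hq := zero_le_of_halt hwH hwT inv.m_nonneg hσ inv.Δ_eq
      (hhalt.imp_left fun h' => by linarith)
    rw [finish_val]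
    refine balanced_finish hwH hwT inv.m_nonneg inv.Δ_pos inv.Δ_eq rfl (fun p hp => ?_)
      fun p hp => ?_
    · have h1 := mul_le_mul_of_nonneg_left hq hwT.le
      linarith [hfirst p hp]
    · have h1 := mul_le_mul_of_nonneg_left hq hwH.le
      have h2 : t.1 ≤ p.1 := by
        rcases List.mem_cons.1 hp with rfl | hp
        · exact le_rfl
        · exact hsort.1 p hp
      linarith
  · simp only [Bool.or_eq_true, decide_eq_true_eq, not_or, not_le] at hhalt
    refine Balanced.tail hwT.le hσ hδσ htδ ?_
    rw [← hmσ]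
    have hmpos : 0 ≤ wT * (t.1 - δ) := mul_nonneg hwT.le (sub_nonneg.2 htδ)
    refine rec ⟨hwH, ?_, ?_, hhalt.2, ?_, fun p hp => ⟨?_, ?_⟩, fun p hp => ⟨hsort.1 p hp, ?_⟩,
      inv.hs_sorted, hsort.2⟩
    · linarith [(inv.le_ts t List.mem_cons_self).2]
    · linarith [inv.m_nonneg]
    · rw [hmσ, inv.Δ_eq]
      linear_combination (-1 : ℝ) * hδσ
    · exact hfirst p hp
    · exact (inv.hs_le p hp).2
    · exact (inv.le_ts p (List.mem_cons_of_mem _ hp)).2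

/-- The line search reaches the optimality conditions. -/
theorem search_balanced (hs ts : List (ℝ × ℝ)) (γ δ wH wT Δ m : ℝ)
    (inv : SearchInv hs ts γ δ wH wT Δ m) :
    Balanced hs ts γ δ wH wT m (search hs ts γ δ wH wT Δ).val := by
  match hs, ts with
  | [], [] =>
    rw [search]
    simp only [Timed.val_bind, finish_val]
    exact balanced_finish inv.wH_pos inv.wT_pos inv.m_nonneg inv.Δ_pos inv.Δ_eq rfl (by simp)
      (by simp)
  | h :: hs, [] =>
    rw [search]
    simp only [Timed.val_bind, apply_ite Timed.val]
    simp only [partnerH_val, newDeriv_val, stopTest_val, add_val]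
    exact inv.head_step (by simp) fun inv' => search_balanced _ _ _ _ _ _ _ _ inv'
  | [], t :: ts =>
    rw [search]
    simp only [Timed.val_bind, apply_ite Timed.val]
    simp only [partnerT_val, newDeriv_val, stopTest_val, add_val]
    exact inv.tail_step (by simp) fun inv' => search_balanced _ _ _ _ _ _ _ _ inv'
  | h :: hs, t :: ts =>
    have hwH := inv.wH_pos
    have hwT := inv.wT_pos
    rw [search]
    simp only [Timed.val_bind, apply_ite Timed.val]
    simp only [partnerH_val, partnerT_val, newDeriv_val, stopTest_val, add_val, le_val,
      decide_eq_true_eq]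
    by_cases hfirst : δ + (γ - h.1) * wH / wT ≤ t.1
    · rw [if_pos hfirst]
      refine inv.head_step (fun p hp => hfirst.trans ?_)
        fun inv' => search_balanced _ _ _ _ _ _ _ _ inv'
      rcases List.mem_cons.1 hp with rfl | hp
      · exact le_rfl
      · exact (List.pairwise_cons.1 inv.ts_sorted).1 p hp
    · rw [if_neg hfirst]
      -- the tail breakpoint is reached before the head breakpoint
      have hle : h.1 ≤ γ - (t.1 - δ) * wT / wH := by
        have h1 : t.1 - δ < (γ - h.1) * wH / wT := by linarith [not_le.1 hfirst]
        rw [lt_div_iff₀ hwT] at h1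
        have h2 : (t.1 - δ) * wT / wH ≤ γ - h.1 := by
          rw [div_le_iff₀ hwH]; exact h1.le
        linarith
      refine inv.tail_step (fun p hp => le_trans ?_ hle)
        fun inv' => search_balanced _ _ _ _ _ _ _ _ inv'
      rcases List.mem_cons.1 hp with rfl | hp
      · exact le_rfl
      · exact (List.pairwise_cons.1 inv.hs_sorted).1 p hp
  termination_by hs.length + ts.length

theorem search_time_le (hs ts : List (ℝ × ℝ)) (γ δ wH wT Δ : ℝ) :
    (search hs ts γ δ wH wT Δ).time ≤ 30 * (hs.length + ts.length) + 9 := by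
  have hf : ∀ γ δ wH wT Δ, (finish γ δ wH wT Δ).time = 8 := fun _ _ _ _ _ => rfl
  have hn : ∀ γ δ γ' δ' wH Δ, (newDeriv γ δ γ' δ' wH Δ).time = 6 := fun _ _ _ _ _ _ => rfl
  have hst : ∀ γ δ Δ, (stopTest γ δ Δ).time = 3 := fun _ _ _ => rfl
  have hpH : ∀ γ δ wH wT γ₁, (partnerH γ δ wH wT γ₁).time = 4 := fun _ _ _ _ _ => rfl
  have hpT : ∀ γ δ wH wT γ₁, (partnerT γ δ wH wT γ₁).time = 4 := fun _ _ _ _ _ => rfl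
  match hs, ts with
  | [], [] =>
    rw [search]
    simp [hf]
  | h :: hs, [] =>
    rw [search]
    simp only [Timed.time_bind, tick_time, hpH, hn, hst, apply_ite Timed.time, hf, add_time,
      List.length_cons]
    split_ifs
    · omega
    · have := fun γ δ wH wT Δ => search_time_le hs [] γ δ wH wT Δ
      refine (Nat.add_le_add_left (Nat.add_le_add_left (Nat.add_le_add_left (Nat.add_le_add_left
        (Nat.add_le_add_left (this _ _ _ _ _) _) _) _) _) _).trans ?_
      omega
  | [], t :: ts =>
    rw [search]
    simp only [Timed.time_bind, tick_time, hpT, hn, hst, apply_ite Timed.time, hf, add_time,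
      List.length_cons]
    split_ifs
    · omega
    · have := fun γ δ wH wT Δ => search_time_le [] ts γ δ wH wT Δ
      refine (Nat.add_le_add_left (Nat.add_le_add_left (Nat.add_le_add_left (Nat.add_le_add_left
        (Nat.add_le_add_left (this _ _ _ _ _) _) _) _) _) _).trans ?_
      omega
  | h :: hs, t :: ts =>
    have h1 := fun γ δ wH wT Δ => search_time_le hs (t :: ts) γ δ wH wT Δ
    have h2 := fun γ δ wH wT Δ => search_time_le (h :: hs) ts γ δ wH wT Δ
    rw [search]
    simp only [Timed.time_bind, tick_time, hpH, hpT, hn, hst, apply_ite Timed.time, hf, add_time,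
      le_time, List.length_cons] at h1 h2 ⊢
    split_ifs
    · omega
    · refine (Nat.add_le_add_left (Nat.add_le_add_left (Nat.add_le_add_left (Nat.add_le_add_left
        (Nat.add_le_add_left (Nat.add_le_add_left (Nat.add_le_add_left (h1 _ _ _ _ _)
          _) _) _) _) _) _) _).trans ?_
      omega
    · omega
    · refine (Nat.add_le_add_left (Nat.add_le_add_left (Nat.add_le_add_left (Nat.add_le_add_left
        (Nat.add_le_add_left (Nat.add_le_add_left (Nat.add_le_add_left (h2 _ _ _ _ _)
          _) _) _) _) _) _) _).trans ?_
      omega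
  termination_by hs.length + ts.length

end Projection

/-! ### Exactness of the projection -/

namespace DirHypergraph

variable {N R : ℕ} {G : DirHypergraph N R}

/-- Optimality conditions of the projection: `y = b - 2 V z` is a subgradient of `f'_r²` at `z`. -/
theorem isConeProj_of_isDualPair {r : Fin R} {b V z : Fin N → ℝ} (hV : ∀ i, 0 < V i)
    (h : G.IsDualPair r z (fun i => b i - 2 * V i * z i)) :
    IsConeProj (G.wcut r) b V⁻¹ (fun i => b i - 2 * V i * z i, 2 * G.spread r z) := by
  refine ⟨G.mem_polyCone_wcut.2 h.1, ?_⟩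
  rintro ⟨v, ψ⟩ hv
  have h1 := (G.mem_polyCone_wcut.1 hv).pairing_le z
  have h2 := h.2
  have h3 : wNormSq V⁻¹ (v - b) = wNormSq V⁻¹ ((fun i => b i - 2 * V i * z i) - b)
      + wNormSq V⁻¹ (v - fun i => b i - 2 * V i * z i)
      - 4 * (∑ i, v i * z i - ∑ i, (b i - 2 * V i * z i) * z i) := by
    unfold wNormSq
    rw [← Finset.sum_sub_distrib, Finset.mul_sum, ← Finset.sum_add_distrib,
      ← Finset.sum_sub_distrib]
    refine Finset.sum_congr rfl fun i _ => ?_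
    have := (hV i).ne'
    simp only [Pi.sub_apply, Pi.inv_apply]
    field_simp
    ring
  have h4 := wNormSq_nonneg (pi_inv_pos hV) (v - fun i => b i - 2 * V i * z i)
  simp only at *
  nlinarith [sq_nonneg (ψ - 2 * G.spread r z)]

/-- If some head reaches `γ` and some tail reaches `δ`, then `γ` and `δ` are the extremes of the
clamped vector. -/
theorem gap_eq_of_clamp {r : Fin R} {β z : Fin N → ℝ} {γ δ : ℝ} (hδγ : δ < γ)
    (hz : ∀ i, z i = if i ∈ G.H r ∧ γ ≤ β i then γ else if i ∈ G.T r ∧ β i ≤ δ then δ else β i)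
    (hH : ∃ i ∈ G.H r, γ ≤ β i) (hT : ∃ j ∈ G.T r, β j ≤ δ) :
    G.headMax r z = γ ∧ G.tailMin r z = δ := by
  constructor
  · obtain ⟨i, hi, hb⟩ := hH
    refine le_antisymm (Finset.sup'_le _ _ fun j hj => ?_) ?_
    · rw [hz]
      split_ifs with h1 h2
      · exact le_rfl
      · exact hδγ.le
      · exact (not_le.1 fun h => h1 ⟨hj, h⟩).le
    · have := G.le_headMax (x := z) hi
      rwa [hz, if_pos ⟨hi, hb⟩] at this
  · obtain ⟨i, hi, hb⟩ := hT
    refine le_antisymm ?_ (Finset.le_inf' _ _ fun j hj => ?_)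
    · have := G.tailMin_le (x := z) hi
      rwa [hz, if_neg fun h => absurd (h.2.trans hb) (not_le.2 hδγ), if_pos ⟨hi, hb⟩] at this
    · rw [hz]
      split_ifs with h1 h2
      · exact hδγ.le
      · exact le_rfl
      · exact (not_le.1 fun h => h2 ⟨hj, h⟩).le

/-- If clamping `β = ½ V⁻¹ b` at `γ` on the heads and at `δ` on the tails moves the mass `γ - δ`,
measured by `V / w`, on both sides, then the clamped vector solves the projection problem. -/
theorem isDualPair_of_clamp {r : Fin R} {b V z : Fin N → ℝ} (hV : ∀ i, 0 < V i) {γ δ : ℝ}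
    (hδγ : δ < γ)
    (hz : ∀ i, z i = if i ∈ G.H r ∧ γ ≤ b i / (2 * V i) then γ
      else if i ∈ G.T r ∧ b i / (2 * V i) ≤ δ then δ else b i / (2 * V i))
    (hH : ∑ i ∈ G.H r, V i / G.w r * max (b i / (2 * V i) - γ) 0 = γ - δ)
    (hT : ∑ i ∈ G.T r, V i / G.w r * max (δ - b i / (2 * V i)) 0 = γ - δ) :
    G.IsDualPair r z (fun i => b i - 2 * V i * z i) ∧ G.spread r z = √(G.w r) * (γ - δ) := by
  set β : Fin N → ℝ := fun i => b i / (2 * V i) with hβ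
  have hw := G.w_pos r
  have hsw := Real.mul_self_sqrt hw.le
  -- the positive and the negative part of `y`
  set P : Fin N → ℝ := fun i => if i ∈ G.H r then V i / G.w r * max (β i - γ) 0 else 0 with hP
  set Q : Fin N → ℝ := fun i => if i ∈ G.T r then V i / G.w r * max (δ - β i) 0 else 0 with hQ
  have hPsum : ∑ i, P i = γ - δ := by
    rw [← hH, hP, Finset.sum_ite_mem, Finset.univ_inter]
  have hQsum : ∑ i, Q i = γ - δ := by
    rw [← hT, hQ, Finset.sum_ite_mem, Finset.univ_inter]
  have hP0 : ∀ i, 0 ≤ P i := fun i => by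
    simp only [hP]; split_ifs
    · exact mul_nonneg (div_pos (hV i) hw).le (le_max_right _ _)
    · exact le_rfl
  have hQ0 : ∀ i, 0 ≤ Q i := fun i => by
    simp only [hQ]; split_ifs
    · exact mul_nonneg (div_pos (hV i) hw).le (le_max_right _ _)
    · exact le_rfl
  have hbβ : ∀ i, b i = 2 * V i * β i := fun i => by
    have := (hV i).ne'
    simp only [hβ]; field_simp
  have hcases : ∀ i, b i - 2 * V i * z i = 2 * G.w r * (P i - Q i) ∧ P i * z i = P i * γ ∧
      Q i * z i = Q i * δ := by
    intro i
    have hzi := hz i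
    change z i = if i ∈ G.H r ∧ γ ≤ β i then γ else if i ∈ G.T r ∧ β i ≤ δ then δ else β i at hzi
    by_cases h1 : i ∈ G.H r ∧ γ ≤ β i
    · rw [if_pos h1] at hzi
      have hQi : Q i = 0 := by
        simp only [hQ]; split_ifs
        · rw [max_eq_right (by linarith [h1.2]), mul_zero]
        · rfl
      have hPi : P i = V i / G.w r * (β i - γ) := by
        simp only [hP, if_pos h1.1]
        rw [max_eq_left (by linarith [h1.2])]
      refine ⟨?_, by rw [hzi], by rw [hQi]; ring⟩
      rw [hQi, hPi, hbβ, hzi]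
      field_simp
      ring
    · have hPi : P i = 0 := by
        simp only [hP]; split_ifs with h
        · rw [max_eq_right (by linarith [not_le.1 fun h' => h1 ⟨h, h'⟩]), mul_zero]
        · rfl
      rw [if_neg h1] at hzi
      by_cases h2 : i ∈ G.T r ∧ β i ≤ δ
      · rw [if_pos h2] at hzi
        have hQi : Q i = V i / G.w r * (δ - β i) := by
          simp only [hQ, if_pos h2.1]
          rw [max_eq_left (by linarith [h2.2])]
        refine ⟨?_, by rw [hPi]; ring, by rw [hzi]⟩
        rw [hQi, hPi, hbβ, hzi]
        field_simp
        ring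
      · rw [if_neg h2] at hzi
        have hQi : Q i = 0 := by
          simp only [hQ]; split_ifs with h
          · rw [max_eq_right (by linarith [not_le.1 fun h' => h2 ⟨h, h'⟩]), mul_zero]
          · rfl
        refine ⟨?_, by rw [hPi]; ring, by rw [hQi]; ring⟩
        rw [hQi, hPi, hbβ, hzi]
        ring
  obtain ⟨hmax, hmin⟩ := gap_eq_of_clamp (G := G) (β := β) hδγ hz
    (by
      by_contra hno
      push Not at hno
      have : ∑ i ∈ G.H r, V i / G.w r * max (β i - γ) 0 = 0 := Finset.sum_eq_zero fun i hi => by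
        rw [max_eq_right (by linarith [hno i hi]), mul_zero]
      simp only [hβ] at this
      linarith)
    (by
      by_contra hno
      push Not at hno
      have : ∑ i ∈ G.T r, V i / G.w r * max (δ - β i) 0 = 0 := Finset.sum_eq_zero fun i hi => by
        rw [max_eq_right (by linarith [hno i hi]), mul_zero]
      simp only [hβ] at this
      linarith)
  have hspread : G.spread r z = √(G.w r) * (γ - δ) := by
    rw [spread, hmax, hmin, max_eq_right (by linarith)]
  refine ⟨⟨⟨by linarith [G.spread_nonneg r z], fun i hi => ?_, fun i hi => ?_, ?_, ?_⟩, ?_⟩,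
    hspread⟩
  · have : P i = 0 := by simp [hP, hi]
    change b i - 2 * V i * z i ≤ 0
    rw [(hcases i).1, this]
    nlinarith [mul_nonneg hw.le (hQ0 i)]
  · have : Q i = 0 := by simp [hQ, hi]
    change 0 ≤ b i - 2 * V i * z i
    rw [(hcases i).1, this]
    nlinarith [mul_nonneg hw.le (hP0 i)]
  · simp only [(hcases _).1]
    rw [← Finset.mul_sum, Finset.sum_sub_distrib, hPsum, hQsum, sub_self, mul_zero]
  · have : ∀ i, max (b i - 2 * V i * z i) 0 ≤ 2 * G.w r * P i := fun i => by
      rw [(hcases i).1]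
      have h1 := mul_nonneg hw.le (hQ0 i)
      have h2 := mul_nonneg hw.le (hP0 i)
      exact max_le (by linarith) (by linarith)
    refine (Finset.sum_le_sum fun i _ => this i).trans (le_of_eq ?_)
    rw [← Finset.mul_sum, hPsum, hspread]
    linear_combination (-2 * (γ - δ)) * hsw
  · have : ∀ i, (b i - 2 * V i * z i) * z i = 2 * G.w r * (P i * γ - Q i * δ) := fun i => by
      rw [(hcases i).1, ← (hcases i).2.1, ← (hcases i).2.2]; ring
    simp only [this]
    rw [← Finset.mul_sum, Finset.sum_sub_distrib, ← Finset.sum_mul, ← Finset.sum_mul, hPsum, hQsum,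
      hspread]
    linear_combination (-2 * (γ - δ) ^ 2) * hsw

end DirHypergraph

namespace Projection

open RAM

variable {N : ℕ}

theorem scatter_map (l : List (Fin N)) (f : Fin N → ℝ) :
    scatter (l.map fun i => (i, f i)) = fun i => if i ∈ l then f i else 0 := by
  have : ∀ y₀ : Fin N → ℝ, (l.map fun i => (i, f i)).foldl
      (fun y p => Function.update y p.1 p.2) y₀ = fun i => if i ∈ l then f i else y₀ i := by
    induction l with
    | nil => intro y₀; simp
    | cons a l ih =>
      intro y₀
      rw [List.map_cons, List.foldl_cons, ih]
      funext i
      by_cases h1 : i ∈ l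
      · simp [h1]
      · by_cases h2 : i = a
        · subst h2; simp [h1]
        · simp [h1, h2]
  exact this 0

theorem heads_val (l : List (Keyed N)) :
    (heads l).val = ((l.filter fun e => e.inH).map fun e => (e.b, e.u)).reverse := by
  have : ∀ acc, (l.foldl (fun acc e => if e.inH then (e.b, e.u) :: acc else acc) acc)
      = ((l.filter fun e => e.inH).map fun e => (e.b, e.u)).reverse ++ acc := by
    induction l with
    | nil => simp
    | cons a l ih =>
      intro acc
      by_cases h : a.inH <;> simp [h, ih]
  have h := this []
  rw [List.append_nil] at h
  rw [← h, heads, forEach_val]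
  rfl

theorem tails_val (l : List (Keyed N)) :
    (tails l).val = ((l.filter fun e => e.inT).map fun e => (e.b, e.u)).reverse := by
  have : ∀ acc, (l.foldl (fun acc e => if e.inT then (e.b, e.u) :: acc else acc) acc)
      = ((l.filter fun e => e.inT).map fun e => (e.b, e.u)).reverse ++ acc := by
    induction l with
    | nil => simp
    | cons a l ih =>
      intro acc
      by_cases h : a.inT <;> simp [h, ih]
  have h := this []
  rw [List.append_nil] at h
  rw [← h, tails, forEach_val]
  rfl

theorem keys_val (w : ℝ) (l : List (Item N)) :
    (keys w l).val = l.map fun e => ⟨e, e.a / (2 * e.V), e.V / w⟩ := by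
  rw [keys, mapL_val]
  rfl

theorem recover_val (γ δ : ℝ) (l : List (Keyed N)) :
    (recover γ δ l).val = l.map fun e => (e.vtx, e.a - 2 * e.V *
      (if e.inH && decide (γ ≤ e.b) then γ else if e.inT && decide (e.b ≤ δ) then δ else e.b)) := by
  rw [recover, mapL_val]
  rfl

/-- The pairs `(b_i, u_i)` of the heads of a keyed list, descending in `b_i`. -/
noncomputable def sortedHeads (l : List (Keyed N)) : List (ℝ × ℝ) :=
  (mergeSort false (heads l).val).val

/-- The pairs `(b_j, u_j)` of the tails of a keyed list, ascending in `b_j`. -/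
noncomputable def sortedTails (l : List (Keyed N)) : List (ℝ × ℝ) :=
  (mergeSort true (tails l).val).val

theorem sortedHeads_perm (l : List (Keyed N)) :
    (sortedHeads l).Perm ((l.filter fun e => e.inH).map fun e => (e.b, e.u)) := by
  refine (mergeSort_perm _ _).trans ?_
  rw [heads_val]
  exact List.reverse_perm _

theorem sortedTails_perm (l : List (Keyed N)) :
    (sortedTails l).Perm ((l.filter fun e => e.inT).map fun e => (e.b, e.u)) := by
  refine (mergeSort_perm _ _).trans ?_
  rw [tails_val]
  exact List.reverse_perm _

/-- The result of the projection in the main case, after the lists have been sorted. -/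
theorem project_val_of_lt (w : ℝ) (items : List (Item N)) {h t : ℝ × ℝ} {hs ts : List (ℝ × ℝ)}
    (hh : sortedHeads (keys w items).val = h :: hs)
    (ht : sortedTails (keys w items).val = t :: ts) (hlt : ¬ h.1 ≤ t.1) :
    (project w items).val
      = ((recover (search hs ts h.1 t.1 h.2 t.2 (h.1 - t.1)).val.1
          (search hs ts h.1 t.1 h.2 t.2 (h.1 - t.1)).val.2 (keys w items).val).val,
        2 * √w * ((search hs ts h.1 t.1 h.2 t.2 (h.1 - t.1)).val.1
          - (search hs ts h.1 t.1 h.2 t.2 (h.1 - t.1)).val.2)) := by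
  unfold sortedHeads at hh
  unfold sortedTails at ht
  unfold project
  simp only [Timed.val_bind]
  rw [hh, ht]
  simp [hlt]

/-- The result of the projection when the largest head does not exceed the smallest tail. -/
theorem project_val_of_le (w : ℝ) (items : List (Item N)) {h t : ℝ × ℝ} {hs ts : List (ℝ × ℝ)}
    (hh : sortedHeads (keys w items).val = h :: hs)
    (ht : sortedTails (keys w items).val = t :: ts) (hle : h.1 ≤ t.1) :
    (project w items).val = ((keys w items).val.map fun e => (e.vtx, 0), 0) := by
  unfold sortedHeads at hh
  unfold sortedTails at ht
  unfold project
  simp only [Timed.val_bind]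
  rw [hh, ht]
  simp [hle, mapL_val]

/-- The projection takes `O(n log n)` steps. -/
theorem project_time_le (w : ℝ) (items : List (Item N)) {n : ℕ} (hn : 2 ≤ n)
    (hl : items.length = n) :
    ((project w items).time : ℝ) ≤ 200 * (n * Real.log n) := by
  have hk : (keys w items).val.length = n := by rw [keys_val]; simpa using hl
  have e1 : (keys w items).time ≤ 4 * n + 1 := by
    have := mapL_time_le (fun e : Item N => do
      let v2 ← mul 2 e.V
      let b ← div e.a v2
      let u ← div e.V w
      pure (⟨e, b, u⟩ : Keyed N)) 3 items (fun _ => le_rfl)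
    rw [hl] at this
    calc _ ≤ _ := this
      _ = _ := by ring
  have e2 : (heads (keys w items).val).time ≤ 2 * n + 1 := by
    have := forEach_time_le_const (fun acc (e : Keyed N) => do
      tick
      pure (if e.inH then (e.b, e.u) :: acc else acc)) 1 (keys w items).val (fun _ _ _ => le_rfl) []
    rw [hk] at this
    calc _ ≤ _ := this
      _ = _ := by ring
  have e3 : (tails (keys w items).val).time ≤ 2 * n + 1 := by
    have := forEach_time_le_const (fun acc (e : Keyed N) => do
      tick
      pure (if e.inT then (e.b, e.u) :: acc else acc)) 1 (keys w items).val (fun _ _ _ => le_rfl) []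
    rw [hk] at this
    calc _ ≤ _ := this
      _ = _ := by ring
  have l2 : (heads (keys w items).val).val.length ≤ n := by
    rw [heads_val, List.length_reverse, List.length_map, ← hk]
    exact List.length_filter_le _ _
  have l3 : (tails (keys w items).val).val.length ≤ n := by
    rw [tails_val, List.length_reverse, List.length_map, ← hk]
    exact List.length_filter_le _ _
  have e4 := mergeSort_time_le false hn l2
  have e5 := mergeSort_time_le true hn l3
  have l4 : (sortedHeads (keys w items).val).length ≤ n :=
    (mergeSort_perm _ _).length_eq.trans_le l2
  have l5 : (sortedTails (keys w items).val).length ≤ n :=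
    (mergeSort_perm _ _).length_eq.trans_le l3
  have e6 : (mapL (fun e : Keyed N => do tick; pure (e.vtx, (0 : ℝ))) (keys w items).val).time
      ≤ 2 * n + 1 := by
    have := mapL_time_le (fun e : Keyed N => do tick; pure (e.vtx, (0 : ℝ))) 1 (keys w items).val
      (fun _ => le_rfl)
    rw [hk] at this
    calc _ ≤ _ := this
      _ = _ := by ring
  have e7 : ∀ γ δ, (recover γ δ (keys w items).val).time ≤ 7 * n + 1 := fun γ δ => by
    have := mapL_time_le (fun e : Keyed N => do
      let c₁ ← le γ e.b
      let c₂ ← le e.b δ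
      tick
      let z := if e.inH && c₁ then γ else if e.inT && c₂ then δ else e.b
      let v2 ← mul 2 e.V
      let m ← mul v2 z
      let y ← sub e.a m
      pure (e.vtx, y)) 6 (keys w items).val (fun _ => le_rfl)
    rw [hk] at this
    calc _ ≤ _ := this
      _ = _ := by ring
  have key : (project w items).time ≤ (keys w items).time + (heads (keys w items).val).time
      + (tails (keys w items).val).time + (mergeSort false (heads (keys w items).val).val).time
      + (mergeSort true (tails (keys w items).val).val).time + (67 * n + 20) := by
    unfold sortedHeads at l4
    unfold sortedTails at l5
    unfold project
    simp only [Timed.time_bind, tick_time]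
    generalize (mergeSort false (heads (keys w items).val).val).val = hs at l4 ⊢
    generalize (mergeSort true (tails (keys w items).val).val).val = ts at l5 ⊢
    match hs, ts with
    | [], ts =>
      simp only [Timed.time_bind, Timed.time_pure]
      omega
    | h :: hs, [] =>
      simp only [Timed.time_bind, Timed.time_pure]
      omega
    | h :: hs, t :: ts =>
      simp only [List.length_cons] at l4 l5
      simp only [Timed.time_bind, apply_ite Timed.time]
      simp only [le_time, sub_time, mul_time, sqrt_time, Timed.time_pure]
      split_ifs
      · omega
      · have h1 := search_time_le hs ts h.1 t.1 h.2 t.2 (sub h.1 t.1).val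
        have h2 := e7 (search hs ts h.1 t.1 h.2 t.2 (sub h.1 t.1).val).val.1
          (search hs ts h.1 t.1 h.2 t.2 (sub h.1 t.1).val).val.2
        omega
  have hn' : (2 : ℝ) ≤ n := by exact_mod_cast hn
  have hlog : (0.69 : ℝ) ≤ Real.log n := by
    have h1 : Real.log 2 ≤ Real.log n := Real.log_le_log two_pos hn'
    linarith [Real.log_two_gt_d9]
  have hkey : ((project w items).time : ℝ) ≤ (keys w items).time + (heads (keys w items).val).time
      + (tails (keys w items).val).time + (mergeSort false (heads (keys w items).val).val).time
      + (mergeSort true (tails (keys w items).val).val).time + (67 * n + 20) := by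
    exact_mod_cast key
  have f1 : ((keys w items).time : ℝ) ≤ 4 * n + 1 := by exact_mod_cast e1
  have f2 : ((heads (keys w items).val).time : ℝ) ≤ 2 * n + 1 := by exact_mod_cast e2
  have f3 : ((tails (keys w items).val).time : ℝ) ≤ 2 * n + 1 := by exact_mod_cast e3
  nlinarith

end Projection

namespace DirHypergraph

open Projection

variable {N R : ℕ} (G : DirHypergraph N R)

/-- The items of the hyperedge `r` for the point `b` and the weights `V`. -/
def items (r : Fin R) (b V : Fin N → ℝ) : List (Item N) :=
  (G.entries r).map fun e => ⟨e, b e.vtx, V e.vtx⟩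

theorem length_entries (r : Fin R) : (G.entries r).length = (G.S r).card := by
  simp [entries]

theorem keys_items (r : Fin R) (b V : Fin N → ℝ) : (keys (G.w r) (G.items r b V)).val
    = ((G.S r).sort (· ≤ ·)).map fun i => (⟨⟨⟨i, decide (i ∈ G.H r), decide (i ∈ G.T r)⟩, b i, V i⟩,
        b i / (2 * V i), V i / G.w r⟩ : Keyed N) := by
  rw [keys_val, items, entries, List.map_map, List.map_map]
  rfl

theorem sum_sort_filter (r : Fin R) (A : Finset (Fin N)) (hA : A ⊆ G.S r) (f : Fin N → ℝ) :
    ((((G.S r).sort (· ≤ ·)).filter fun i => decide (i ∈ A)).map f).sum = ∑ i ∈ A, f i := by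
  have hnd : (((G.S r).sort (· ≤ ·)).filter fun i => decide (i ∈ A)).Nodup :=
    (Finset.sort_nodup _ _).filter _
  rw [← List.sum_toFinset f hnd]
  congr 1
  ext i
  simp only [List.mem_toFinset, List.mem_filter, Finset.mem_sort, decide_eq_true_eq]
  exact ⟨fun h => h.2, fun h => ⟨hA h, h⟩⟩

theorem perm_sortedHeads (r : Fin R) (b V : Fin N → ℝ) :
    (sortedHeads (keys (G.w r) (G.items r b V)).val).Perm
      ((((G.S r).sort (· ≤ ·)).filter fun i => decide (i ∈ G.H r)).map
        fun i => (b i / (2 * V i), V i / G.w r)) := by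
  refine (sortedHeads_perm _).trans ?_
  rw [keys_items, List.filter_map, List.map_map]
  rfl

theorem perm_sortedTails (r : Fin R) (b V : Fin N → ℝ) :
    (sortedTails (keys (G.w r) (G.items r b V)).val).Perm
      ((((G.S r).sort (· ≤ ·)).filter fun i => decide (i ∈ G.T r)).map
        fun i => (b i / (2 * V i), V i / G.w r)) := by
  refine (sortedTails_perm _).trans ?_
  rw [keys_items, List.filter_map, List.map_map]
  rfl

/-- The projection routine returns the coordinates on `S_r` of the projection onto `C_r`. -/
theorem project_spec (r : Fin R) (b V : Fin N → ℝ) (hV : ∀ i, 0 < V i) :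
    ∃ y : Fin N → ℝ, ∃ φ : ℝ, (project (G.w r) (G.items r b V)).val
        = (((G.S r).sort (· ≤ ·)).map fun i => (i, y i), φ) ∧
      IsConeProj (G.wcut r) b V⁻¹ (y, φ) := by
  have hw := G.w_pos r
  set β : Fin N → ℝ := fun i => b i / (2 * V i) with hβ
  have hbβ : ∀ i, b i = 2 * V i * β i := fun i => by
    have := (hV i).ne'
    simp only [hβ]; field_simp
  have hpH := G.perm_sortedHeads r b V
  have hpT := G.perm_sortedTails r b V
  have hmemH : ∀ i ∈ G.H r, (β i, V i / G.w r) ∈ sortedHeads (keys (G.w r) (G.items r b V)).val :=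
    fun i hi => hpH.mem_iff.2 (List.mem_map.2 ⟨i, by simp [hi, G.H_sub r hi], rfl⟩)
  have hmemT : ∀ i ∈ G.T r, (β i, V i / G.w r) ∈ sortedTails (keys (G.w r) (G.items r b V)).val :=
    fun i hi => hpT.mem_iff.2 (List.mem_map.2 ⟨i, by simp [hi, G.T_sub r hi], rfl⟩)
  have hposH : ∀ p ∈ sortedHeads (keys (G.w r) (G.items r b V)).val, 0 < p.2 := fun p hp => by
    obtain ⟨i, -, rfl⟩ := List.mem_map.1 (hpH.mem_iff.1 hp)
    exact div_pos (hV i) hw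
  have hposT : ∀ p ∈ sortedTails (keys (G.w r) (G.items r b V)).val, 0 < p.2 := fun p hp => by
    obtain ⟨i, -, rfl⟩ := List.mem_map.1 (hpT.mem_iff.1 hp)
    exact div_pos (hV i) hw
  have hexc : ∀ γ, excess γ (sortedHeads (keys (G.w r) (G.items r b V)).val)
      = ∑ i ∈ G.H r, V i / G.w r * max (b i / (2 * V i) - γ) 0 := fun γ => by
    rw [← G.sum_sort_filter r (G.H r) (G.H_sub r), excess, (hpH.map _).sum_eq, List.map_map]
    rfl
  have hdef : ∀ δ, deficit δ (sortedTails (keys (G.w r) (G.items r b V)).val)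
      = ∑ i ∈ G.T r, V i / G.w r * max (δ - b i / (2 * V i)) 0 := fun δ => by
    rw [← G.sum_sort_filter r (G.T r) (G.T_sub r), deficit, (hpT.map _).sum_eq, List.map_map]
    rfl
  have hsH : (sortedHeads (keys (G.w r) (G.items r b V)).val).Pairwise (RAM.KeyLe false) :=
    RAM.mergeSort_sorted _ _
  have hsT : (sortedTails (keys (G.w r) (G.items r b V)).val).Pairwise (RAM.KeyLe true) :=
    RAM.mergeSort_sorted _ _
  cases hh : sortedHeads (keys (G.w r) (G.items r b V)).val with
  | nil =>
    obtain ⟨i, hi⟩ := G.H_nonempty r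
    have := hmemH i hi
    simp [hh] at this
  | cons h hs =>
  cases ht : sortedTails (keys (G.w r) (G.items r b V)).val with
  | nil =>
    obtain ⟨i, hi⟩ := G.T_nonempty r
    have := hmemT i hi
    simp [ht] at this
  | cons t ts =>
  rw [hh] at hmemH hposH hexc hsH
  rw [ht] at hmemT hposT hdef hsT
  rw [List.pairwise_cons] at hsH hsT
  by_cases hle : h.1 ≤ t.1
  · -- no head exceeds a tail, so `f'_r` vanishes at `β`, which is then the minimizer
    refine ⟨0, 0, ?_, ?_⟩
    · rw [project_val_of_le _ _ hh ht hle, keys_items, List.map_map]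
      rfl
    · have hmax : G.headMax r β ≤ h.1 := Finset.sup'_le _ _ fun i hi => by
        rcases List.mem_cons.1 (hmemH i hi) with h1 | h1
        · rw [← h1]
        · exact hsH.1 _ h1
      have hmin : t.1 ≤ G.tailMin r β := Finset.le_inf' _ _ fun i hi => by
        rcases List.mem_cons.1 (hmemT i hi) with h1 | h1
        · rw [← h1]
        · exact hsT.1 _ h1
      have hspread : G.spread r β = 0 := by
        rw [spread, max_eq_left (by linarith), mul_zero]
      have hy : (fun i => b i - 2 * V i * β i) = 0 := by
        funext i
        simp [hbβ i]
      have := isConeProj_of_isDualPair (G := G) (r := r) (b := b) (z := β) hV (by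
        rw [hy]
        exact ⟨G.inCone_zero r (by linarith), by simp [hspread]⟩)
      rwa [hy, hspread, mul_zero] at this
  · -- the search starts with no mass moved and both ends at the extreme breakpoints
    have hbal := search_balanced hs ts h.1 t.1 h.2 t.2 (h.1 - t.1) 0
      ⟨hposH h List.mem_cons_self, hposT t List.mem_cons_self, le_rfl,
        by linarith [not_le.1 hle], by ring,
        fun p hp => ⟨hsH.1 p hp, hposH p (List.mem_cons_of_mem _ hp)⟩,
        fun p hp => ⟨hsT.1 p hp, hposT p (List.mem_cons_of_mem _ hp)⟩, hsH.2, hsT.2⟩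
    have hval := project_val_of_lt _ _ hh ht hle
    generalize (search hs ts h.1 t.1 h.2 t.2 (h.1 - t.1)).val = p at hbal hval
    obtain ⟨γ, δ⟩ := p
    obtain ⟨h1, h2, h3, h4, h5⟩ := hbal
    simp only at h1 h2 h3 h4 h5 hval
    have hH : ∑ i ∈ G.H r, V i / G.w r * max (b i / (2 * V i) - γ) 0 = γ - δ := by
      rw [← hexc, ← h4]
      simp only [excess, List.map_cons, List.sum_cons]
      rw [max_eq_left (sub_nonneg.2 h1)]
      ring
    have hT : ∑ i ∈ G.T r, V i / G.w r * max (δ - b i / (2 * V i)) 0 = γ - δ := by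
      rw [← hdef, ← h5]
      simp only [deficit, List.map_cons, List.sum_cons]
      rw [max_eq_left (sub_nonneg.2 h2)]
      ring
    set z : Fin N → ℝ := fun i => if i ∈ G.H r ∧ γ ≤ b i / (2 * V i) then γ
      else if i ∈ G.T r ∧ b i / (2 * V i) ≤ δ then δ else b i / (2 * V i) with hz
    obtain ⟨hpair, hspread⟩ := isDualPair_of_clamp (G := G) (r := r) (b := b) (z := z) hV h3
      (fun i => rfl) hH hT
    have hproj := isConeProj_of_isDualPair hV hpair
    refine ⟨_, _, ?_, hproj⟩
    rw [hval, recover_val, keys_items, List.map_map, hspread]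
    refine Prod.ext_iff.2 ⟨List.map_congr_left fun i _ => ?_, by simp only; ring⟩
    simp [hz]

theorem project_isConeProj (r : Fin R) (b V : Fin N → ℝ) (hV : ∀ i, 0 < V i) :
    IsConeProj (G.wcut r) b V⁻¹ (scatter (project (G.w r) (G.items r b V)).val.1,
      (project (G.w r) (G.items r b V)).val.2) := by
  obtain ⟨y, φ, hval, hp⟩ := G.project_spec r b V hV
  have : scatter (((G.S r).sort (· ≤ ·)).map fun i => (i, y i)) = y := by
    rw [scatter_map]
    funext i
    by_cases hi : i ∈ G.S r
    · simp [hi]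
    · simpa [hi] using ((G.mem_polyCone_wcut.1 hp.1).eq_zero_of_notMem hi).symm
  rw [hval, this]
  exact hp

theorem project_items_time_le (r : Fin R) (b V : Fin N → ℝ) :
    ((project (G.w r) (G.items r b V)).time : ℝ)
      ≤ 200 * ((G.S r).card * Real.log (G.S r).card) :=
  project_time_le _ _ (G.two_le_card r) (by simp [items, length_entries])

end DirHypergraph

/-! ### The memory of the two methods -/

namespace DirHypergraph

open RAM Projection

variable {N R : ℕ} (G : DirHypergraph N R)

theorem entries_map_vtx (r : Fin R) :
    (G.entries r).map Entry.vtx = (G.S r).sort (· ≤ ·) := by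
  rw [entries, List.map_map]
  exact List.map_id _

theorem foldl_add_update (L : List (Entry N)) (hL : (L.map Entry.vtx).Nodup) (a b : ℝ)
    (q : (Fin N → ℝ) × (Fin N → ℝ)) :
    L.foldl (fun q e => (Function.update q.1 e.vtx (q.1 e.vtx + a),
        Function.update q.2 e.vtx (q.2 e.vtx + b))) q
      = (fun i => q.1 i + if i ∈ L.map Entry.vtx then a else 0,
        fun i => q.2 i + if i ∈ L.map Entry.vtx then b else 0) := by
  induction L generalizing q with
  | nil => simp
  | cons e L ih =>
    rw [List.map_cons, List.nodup_cons] at hL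
    rw [List.foldl_cons, ih hL.2]
    refine Prod.ext (funext fun i => ?_) (funext fun i => ?_) <;>
    · by_cases hi : i = e.vtx
      · subst hi
        simp only [Function.update_self, List.map_cons, List.mem_cons, true_or, if_true,
          if_neg hL.1, add_zero]
      · simp [hi]

theorem degrees_val : G.degrees.val = (G.deg, G.psi) := by
  have hfold : ∀ (l : List (Fin R)) (q : (Fin N → ℝ) × (Fin N → ℝ)),
      l.foldl (fun p r => (G.entries r).foldl (fun q e =>
        (Function.update q.1 e.vtx (q.1 e.vtx + G.w r),
          Function.update q.2 e.vtx (q.2 e.vtx + 1))) p) q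
      = (fun i => q.1 i + (l.map fun r => if i ∈ G.S r then G.w r else 0).sum,
        fun i => q.2 i + (l.map fun r => if i ∈ G.S r then (1 : ℝ) else 0).sum) := by
    intro l
    induction l with
    | nil => intro q; simp
    | cons r l ih =>
      intro q
      rw [List.foldl_cons, foldl_add_update _ (by
        rw [entries_map_vtx]; exact Finset.sort_nodup _ _), ih]
      simp only [entries_map_vtx, Finset.mem_sort, List.map_cons, List.sum_cons, add_assoc]
  have h : G.degrees.val = (List.finRange R).foldl (fun p r => (G.entries r).foldl (fun q e =>
        (Function.update q.1 e.vtx (q.1 e.vtx + G.w r),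
          Function.update q.2 e.vtx (q.2 e.vtx + 1))) p) (fun _ => 0, fun _ => 0) := by
    unfold degrees
    simp only [Timed.val_bind, forEach_val]
    rfl
  rw [h, hfold]
  refine Prod.ext (funext fun i => ?_) (funext fun i => ?_)
  · simp only [zero_add, deg]
    rw [← Fin.sum_univ_def]
  · simp only [zero_add, psi]
    rw [← Fin.sum_univ_def, Finset.sum_boole]

/-- The dual point stored in the memory. -/
def dualOf (M : Mem N R) : DualVar N R := (M.y, M.φ)

/-- The memory holds the data of the PageRank problem, the running sum is correct, and the dual
point is feasible. -/
structure MemInv (α : ℝ) (p₀ : Fin N → ℝ) (M : Mem N R) : Prop where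
  W_eq : M.W = G.W α
  a_eq : M.a = G.x0 p₀
  c_eq : M.c = 2 • (G.W α * G.x0 p₀)
  V_eq : M.V = fun i => G.W α i / G.psi i
  s_eq : M.s = ∑ r, M.y r
  mem : dualOf M ∈ prodCone G.wcut

theorem foldl_init (β : ℝ) (d k p : Fin N → ℝ) (l : List (Fin N)) (M : Mem N R) :
    l.foldl (fun (M : Mem N R) i => { M with
        W := Function.update M.W i (β * d i), a := Function.update M.a i (p i / d i),
        c := Function.update M.c i (2 * (β * d i) * (p i / d i)),
        V := Function.update M.V i (β * d i / k i) }) M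
      = { M with
        W := fun i => if i ∈ l then β * d i else M.W i
        a := fun i => if i ∈ l then p i / d i else M.a i
        c := fun i => if i ∈ l then 2 * (β * d i) * (p i / d i) else M.c i
        V := fun i => if i ∈ l then β * d i / k i else M.V i } := by
  induction l generalizing M with
  | nil => simp
  | cons j l ih =>
    rw [List.foldl_cons, ih]
    have key : ∀ (f g : Fin N → ℝ), (fun i => if i ∈ l then f i else Function.update g j (f j) i)
        = fun i => if i ∈ j :: l then f i else g i := fun f g => by
      funext i
      by_cases h1 : i ∈ l
      · simp [h1]
      · by_cases h2 : i = j
        · subst h2; simp [h1]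
        · simp [h1, h2]
    simp only [key (fun i => β * d i), key (fun i => p i / d i),
      key (fun i => 2 * (β * d i) * (p i / d i)), key (fun i => β * d i / k i)]

theorem initMem_val (α : ℝ) (p₀ : Fin N → ℝ) : (G.initMem α p₀).val
    = ⟨G.W α, G.x0 p₀, 2 • (G.W α * G.x0 p₀), fun i => G.W α i / G.psi i, 0, 0, 0⟩ := by
  have h : (G.initMem α p₀).val = (List.finRange N).foldl (fun (M : Mem N R) i => { M with
        W := Function.update M.W i (α / (1 - α) * G.degrees.val.1 i),
        a := Function.update M.a i (p₀ i / G.degrees.val.1 i),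
        c := Function.update M.c i (2 * (α / (1 - α) * G.degrees.val.1 i)
          * (p₀ i / G.degrees.val.1 i)),
        V := Function.update M.V i (α / (1 - α) * G.degrees.val.1 i / G.degrees.val.2 i) })
      ⟨0, 0, 0, 0, 0, 0, 0⟩ := by
    unfold initMem
    simp only [Timed.val_bind, forEach_val]
    rfl
  rw [h, degrees_val, foldl_init]
  simp only [List.mem_finRange, if_true]
  congr 1
  funext i
  simp only [Pi.smul_apply, Pi.mul_apply, nsmul_eq_mul, Nat.cast_ofNat, W, x0]
  ring

theorem memInv_init (α : ℝ) (p₀ : Fin N → ℝ) : G.MemInv α p₀ (G.initMem α p₀).val := by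
  rw [initMem_val]
  exact ⟨rfl, rfl, rfl, rfl, by simp, G.zero_mem_prodCone⟩

theorem foldl_store (r : Fin R) (y : Fin N → ℝ) (l : List (Fin N)) (M : Mem N R) :
    (l.map fun i => (i, y i)).foldl (fun (M : Mem N R) (p : Fin N × ℝ) => { M with
        s := Function.update M.s p.1 (M.s p.1 - M.y r p.1 + p.2),
        y := Function.update M.y r (Function.update (M.y r) p.1 p.2) }) M
      = { M with
        s := fun i => if i ∈ l then M.s i - M.y r i + y i else M.s i
        y := Function.update M.y r fun i => if i ∈ l then y i else M.y r i } := by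
  induction l generalizing M with
  | nil => simp
  | cons j l ih =>
    rw [List.map_cons, List.foldl_cons, ih]
    simp only [Function.update_self, Function.update_idem]
    congr 1
    · funext i
      by_cases h1 : i ∈ l
      · by_cases h2 : i = j
        · subst h2; simp [h1]
        · simp [h1, h2]
      · by_cases h2 : i = j
        · subst h2; simp [h1]
        · simp [h1, h2]
    · congr 1
      funext i
      by_cases h1 : i ∈ l
      · simp [h1]
      · by_cases h2 : i = j
        · subst h2; simp [h1]
        · simp [h1, h2]

theorem store_val (r : Fin R) (y : Fin N → ℝ) (φ : ℝ) (l : List (Fin N)) (M : Mem N R) :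
    (store r (l.map fun i => (i, y i), φ) M).val
      = { M with
        s := fun i => if i ∈ l then M.s i - M.y r i + y i else M.s i
        y := Function.update M.y r fun i => if i ∈ l then y i else M.y r i
        φ := Function.update M.φ r φ } := by
  have h : (store r (l.map fun i => (i, y i), φ) M).val
      = (l.map fun i => (i, y i)).foldl (fun (M : Mem N R) (p : Fin N × ℝ) => { M with
        s := Function.update M.s p.1 (M.s p.1 - M.y r p.1 + p.2),
        y := Function.update M.y r (Function.update (M.y r) p.1 p.2) })
        { M with φ := Function.update M.φ r φ } := by
    unfold store
    simp only [Timed.val_bind, forEach_val]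
    rfl
  rw [h, foldl_store]

variable {G}

theorem MemInv.y_eq_zero {α : ℝ} {p₀ : Fin N → ℝ} {M : Mem N R} (hM : G.MemInv α p₀ M) {r : Fin R}
    {i : Fin N} (hi : i ∉ G.S r) : M.y r i = 0 :=
  (G.mem_polyCone_wcut.1 (hM.mem r)).eq_zero_of_notMem hi

/-- Storing a feasible block supported on `S_r` keeps the invariant. -/
theorem MemInv.store {α : ℝ} {p₀ : Fin N → ℝ} {M : Mem N R} (hM : G.MemInv α p₀ M) {r : Fin R}
    {y : Fin N → ℝ} {φ : ℝ} (hy : (y, φ) ∈ polyCone (G.wcut r)) :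
    G.MemInv α p₀ (store r (((G.S r).sort (· ≤ ·)).map fun i => (i, y i), φ) M).val ∧
      dualOf (DirHypergraph.store r (((G.S r).sort (· ≤ ·)).map fun i => (i, y i), φ) M).val
        = setBlock (dualOf M) r (y, φ) := by
  have hyr : (fun i => if i ∈ (G.S r).sort (· ≤ ·) then y i else M.y r i) = y := by
    funext i
    by_cases hi : i ∈ G.S r
    · simp [hi]
    · simp [hi, hM.y_eq_zero hi, (G.mem_polyCone_wcut.1 hy).eq_zero_of_notMem hi]
  have hdual : dualOf
      (DirHypergraph.store r (((G.S r).sort (· ≤ ·)).map fun i => (i, y i), φ) M).val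
      = setBlock (dualOf M) r (y, φ) := by
    rw [store_val, hyr]
    rfl
  refine ⟨⟨?_, ?_, ?_, ?_, ?_, ?_⟩, hdual⟩
  · rw [store_val]; exact hM.W_eq
  · rw [store_val]; exact hM.a_eq
  · rw [store_val]; exact hM.c_eq
  · rw [store_val]; exact hM.V_eq
  · rw [store_val, hyr]
    have hs : ∑ s, Function.update M.y r y s = M.s - M.y r + y := by
      rw [hM.s_eq, ← Finset.add_sum_erase _ _ (Finset.mem_univ r),
        ← Finset.add_sum_erase _ M.y (Finset.mem_univ r), Function.update_self]
      have : ∑ s ∈ Finset.univ.erase r, Function.update M.y r y s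
          = ∑ s ∈ Finset.univ.erase r, M.y s := Finset.sum_congr rfl fun s hs => by
        rw [Function.update_of_ne (Finset.ne_of_mem_erase hs)]
      rw [this]
      abel
    change _ = ∑ s, Function.update M.y r y s
    rw [hs]
    funext i
    by_cases hi : i ∈ G.S r
    · simp [hi]
    · simp [hi, hM.y_eq_zero hi, (G.mem_polyCone_wcut.1 hy).eq_zero_of_notMem hi]
  · rw [hdual]
    intro s
    by_cases hs : s = r
    · subst hs; simpa [setBlock] using hy
    · simpa [setBlock, hs, dualOf] using hM.mem s

variable (G)

theorem store_time_le (r : Fin R) (res : List (Fin N × ℝ) × ℝ) (M : Mem N R) :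
    (store r res M).time ≤ 7 * res.1.length + 2 := by
  have h := forEach_time_le_const (fun (M : Mem N R) (p : Fin N × ℝ) => do
    let yi ← read (M.y r) p.1
    let si ← read M.s p.1
    let si₁ ← sub si yi
    let si₂ ← add si₁ p.2
    let s' ← write M.s p.1 si₂
    let yr' ← write (M.y r) p.1 p.2
    pure { M with s := s', y := Function.update M.y r yr' }) 6 res.1 (fun _ _ _ => le_rfl)
    { M with φ := Function.update M.φ r res.2 }
  have h2 : (store r res M).time = 1 + _ := rfl
  rw [h2]
  refine (Nat.add_le_add_left h 1).trans ?_
  omega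

/-! ### One iteration in memory -/

theorem rcdStep_val (r : Fin R) (M : Mem N R) : (G.rcdStep r M).val
    = (store r (project (G.w r)
        (G.items r (fun i => M.c i - (M.s i - M.y r i)) M.W)).val M).val := by
  unfold rcdStep
  simp only [Timed.val_bind, mapL_val]
  rfl

variable {G}

/-- An iteration of RCD replaces the block `r` by the projection of `rcdPoint`. -/
theorem MemInv.rcdStep {α : ℝ} (h0 : 0 < α) (h1 : α < 1) {p₀ : Fin N → ℝ} {M : Mem N R}
    (hM : G.MemInv α p₀ M) (r : Fin R) :
    G.MemInv α p₀ (G.rcdStep r M).val ∧ ∃ p : (Fin N → ℝ) × ℝ,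
      IsConeProj (G.wcut r) (rcdPoint (G.W α) (G.x0 p₀) (dualOf M) r) (G.W α)⁻¹ p ∧
      dualOf (G.rcdStep r M).val = setBlock (dualOf M) r p := by
  obtain ⟨y, φ, hval, hproj⟩ := G.project_spec r (fun i => M.c i - (M.s i - M.y r i)) M.W
    (hM.W_eq ▸ G.W_pos h0 h1)
  rw [rcdStep_val, hval]
  obtain ⟨h2, h3⟩ := hM.store hproj.1
  refine ⟨h2, (y, φ), ?_, h3⟩
  have hb : (fun i => M.c i - (M.s i - M.y r i))
      = rcdPoint (G.W α) (G.x0 p₀) (dualOf M) r := by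
    rw [hM.c_eq, hM.s_eq]
    rfl
  rw [hb, hM.W_eq] at hproj
  exact hproj

/-- Linear times are absorbed in `n log n`, since `log 2 ≥ 2 / 3`. -/
theorem card_le_mul_log {n : ℕ} (hn : 2 ≤ n) : (n : ℝ) ≤ 1.5 * (n * Real.log n) := by
  have hn' : (2 : ℝ) ≤ n := by exact_mod_cast hn
  have h1 : Real.log 2 ≤ Real.log n := Real.log_le_log two_pos hn'
  have h2 := Real.log_two_gt_d9
  nlinarith

theorem rcdStep_time_le {α : ℝ} (h0 : 0 < α) (h1 : α < 1) {p₀ : Fin N → ℝ} {M : Mem N R}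
    (hM : G.MemInv α p₀ M) (r : Fin R) :
    ((G.rcdStep r M).time : ℝ) + 2 ≤ 240 * ((G.S r).card * Real.log (G.S r).card) := by
  obtain ⟨y, φ, hval, -⟩ := G.project_spec r (fun i => M.c i - (M.s i - M.y r i)) M.W
    (hM.W_eq ▸ G.W_pos h0 h1)
  have hp := G.project_items_time_le r (fun i => M.c i - (M.s i - M.y r i)) M.W
  have hst := store_time_le r (project (G.w r)
        (G.items r (fun i => M.c i - (M.s i - M.y r i)) M.W)).val M
  have hlen : (project (G.w r) (G.items r (fun i => M.c i - (M.s i - M.y r i)) M.W)).val.1.length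
      = (G.S r).card := by rw [hval]; simp
  rw [hlen] at hst
  have hitems := mapL_time_le (fun e : Entry N => do
    let yi ← read (M.y r) e.vtx
    let si ← read M.s e.vtx
    let ci ← read M.c e.vtx
    let wi ← read M.W e.vtx
    let others ← sub si yi
    let ai ← sub ci others
    pure (⟨e, ai, wi⟩ : Item N)) 6 (G.entries r) (fun _ => le_rfl)
  rw [length_entries] at hitems
  have hval' : (mapL (fun e : Entry N => do
    let yi ← read (M.y r) e.vtx
    let si ← read M.s e.vtx
    let ci ← read M.c e.vtx
    let wi ← read M.W e.vtx
    let others ← sub si yi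
    let ai ← sub ci others
    pure (⟨e, ai, wi⟩ : Item N)) (G.entries r)).val
      = G.items r (fun i => M.c i - (M.s i - M.y r i)) M.W := by
    rw [mapL_val]; rfl
  have key : (G.rcdStep r M).time ≤ 7 * (G.S r).card + 1 + 1
      + (project (G.w r) (G.items r (fun i => M.c i - (M.s i - M.y r i)) M.W)).time
      + (7 * (G.S r).card + 2) := by
    unfold DirHypergraph.rcdStep
    simp only [Timed.time_bind]
    rw [hval']
    simp only [read_time, read_val]
    omega
  have hkey : ((G.rcdStep r M).time : ℝ) ≤ 7 * (G.S r).card + 1 + 1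
      + (project (G.w r) (G.items r (fun i => M.c i - (M.s i - M.y r i)) M.W)).time
      + (7 * (G.S r).card + 2) := by exact_mod_cast key
  have hc := card_le_mul_log (G.two_le_card r)
  have h2 : (2 : ℝ) ≤ (G.S r).card := by exact_mod_cast G.two_le_card r
  linarith

variable (G)

/-- The vector `q = 2 W⁻¹ s - 4 a` computed by AP. -/
noncomputable def apVec (M : Mem N R) (i : Fin N) : ℝ := 2 * M.s i / M.W i - 4 * M.a i

/-- The pass of AP over the hyperedge `r` with the vector `q`. -/
noncomputable def apBlock (q : Fin N → ℝ) (M : Mem N R) (r : Fin R) : Timed (Mem N R) := do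
  let items ← mapL (fun e : Entry N => do
    let yi ← read (M.y r) e.vtx
    let vi ← read M.V e.vtx
    let qi ← read q e.vtx
    let m ← mul vi qi
    let h ← div m 2
    let li ← sub yi h
    pure (⟨e, li, vi⟩ : Item N)) (G.entries r)
  let w ← read G.w r
  let res ← Projection.project w items
  store r res M

theorem foldl_update_eq (f : Fin N → ℝ) (l : List (Fin N)) (q : Fin N → ℝ) :
    l.foldl (fun q i => Function.update q i (f i)) q = fun i => if i ∈ l then f i else q i := by
  induction l generalizing q with
  | nil => simp
  | cons j l ih =>
    rw [List.foldl_cons, ih]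
    funext i
    by_cases h1 : i ∈ l
    · simp [h1]
    · by_cases h2 : i = j
      · subst h2; simp [h1]
      · simp [h1, h2]

theorem apVec_val (M : Mem N R) : (forEach (fun (q : Fin N → ℝ) i => do
    let si ← read M.s i
    let wi ← read M.W i
    let ai ← read M.a i
    let s2 ← mul 2 si
    let sw ← div s2 wi
    let a4 ← mul 4 ai
    let qi ← sub sw a4
    write q i qi) (List.finRange N) (alloc N).val).val = apVec M := by
  have h := foldl_update_eq (apVec M) (List.finRange N) (alloc N).val
  simp only [List.mem_finRange, if_true] at h
  rw [forEach_val]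
  exact h

theorem apStep_val (M : Mem N R) : (G.apStep M).val
    = (List.finRange R).foldl (fun M' r => (G.apBlock (apVec M) M' r).val) M := by
  unfold apStep
  simp only [Timed.val_bind]
  rw [apVec_val, forEach_val]
  rfl

theorem apBlock_val (q : Fin N → ℝ) (M : Mem N R) (r : Fin R) : (G.apBlock q M r).val
    = (store r (project (G.w r)
        (G.items r (fun i => M.y r i - M.V i * q i / 2) M.V)).val M).val := by
  unfold apBlock
  simp only [Timed.val_bind, mapL_val]
  rfl

theorem V_pos {α : ℝ} (h0 : 0 < α) (h1 : α < 1) (i : Fin N) : 0 < G.W α i / G.psi i :=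
  div_pos (G.W_pos h0 h1 i) (G.psi_pos i)

theorem apBlock_time_le {α : ℝ} (h0 : 0 < α) (h1 : α < 1) {M : Mem N R}
    (hM : M.V = fun i => G.W α i / G.psi i) (q : Fin N → ℝ) (r : Fin R) :
    (G.apBlock q M r).time ≤ 14 * (G.S r).card + 4
      + ⌊200 * ((G.S r).card * Real.log (G.S r).card)⌋₊ := by
  obtain ⟨y, φ, hval, -⟩ := G.project_spec r (fun i => M.y r i - M.V i * q i / 2) M.V
    (hM ▸ G.V_pos h0 h1)
  have hp := Nat.le_floor (G.project_items_time_le r (fun i => M.y r i - M.V i * q i / 2) M.V)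
  have hst := store_time_le r (project (G.w r)
        (G.items r (fun i => M.y r i - M.V i * q i / 2) M.V)).val M
  have hlen : (project (G.w r) (G.items r (fun i => M.y r i - M.V i * q i / 2) M.V)).val.1.length
      = (G.S r).card := by rw [hval]; simp
  rw [hlen] at hst
  have hitems := mapL_time_le (fun e : Entry N => do
    let yi ← read (M.y r) e.vtx
    let vi ← read M.V e.vtx
    let qi ← read q e.vtx
    let m ← mul vi qi
    let h ← div m 2
    let li ← sub yi h
    pure (⟨e, li, vi⟩ : Item N)) 6 (G.entries r) (fun _ => le_rfl)
  rw [length_entries] at hitems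
  have hval' : (mapL (fun e : Entry N => do
    let yi ← read (M.y r) e.vtx
    let vi ← read M.V e.vtx
    let qi ← read q e.vtx
    let m ← mul vi qi
    let h ← div m 2
    let li ← sub yi h
    pure (⟨e, li, vi⟩ : Item N)) (G.entries r)).val
      = G.items r (fun i => M.y r i - M.V i * q i / 2) M.V := by
    rw [mapL_val]; rfl
  unfold apBlock
  simp only [Timed.time_bind]
  rw [hval']
  simp only [read_time, read_val]
  omega

variable {G}

/-- A block of AP projects the point `apPoint` of the dual point at the start of the iteration. -/
theorem MemInv.apBlock {α : ℝ} (h0 : 0 < α) (h1 : α < 1) {p₀ : Fin N → ℝ} {M₀ M : Mem N R}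
    (hM₀ : G.MemInv α p₀ M₀) (hM : G.MemInv α p₀ M) {r : Fin R} (hr : M.y r = M₀.y r) :
    G.MemInv α p₀ (G.apBlock (apVec M₀) M r).val ∧ ∃ p : (Fin N → ℝ) × ℝ,
      IsConeProj (G.wcut r) (G.apPoint (G.W α) (G.x0 p₀) (dualOf M₀) r)
        (fun i => G.psi i / G.W α i) p ∧
      dualOf (G.apBlock (apVec M₀) M r).val = setBlock (dualOf M) r p := by
  obtain ⟨y, φ, hval, hproj⟩ := G.project_spec r (fun i => M.y r i - M.V i * apVec M₀ i / 2) M.V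
    (hM.V_eq ▸ G.V_pos h0 h1)
  rw [apBlock_val, hval]
  obtain ⟨h2, h3⟩ := hM.store hproj.1
  refine ⟨h2, (y, φ), ?_, h3⟩
  have hb : (fun i => M.y r i - M.V i * apVec M₀ i / 2)
      = G.apPoint (G.W α) (G.x0 p₀) (dualOf M₀) r := by
    funext i
    have hw := (G.W_pos h0 h1 i).ne'
    have hp := (G.psi_pos i).ne'
    simp only [apVec, apPoint, primalOf, dualOf, hr, hM.V_eq, hM₀.W_eq, hM₀.a_eq, hM₀.s_eq,
      Finset.sum_apply]
    field_simp
    ring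
  have hV : M.V⁻¹ = fun i => G.psi i / G.W α i := by
    rw [hM.V_eq]
    funext i
    exact inv_div _ _
  rw [hb, hV] at hproj
  exact hproj

/-- The passes over the hyperedges of `l` project points determined by `M₀`: the pass over `r` reads
no block but its own, so that the successive updates are the simultaneous ones. -/
theorem MemInv.apFold {α : ℝ} (h0 : 0 < α) (h1 : α < 1) {p₀ : Fin N → ℝ} {M₀ : Mem N R}
    (hM₀ : G.MemInv α p₀ M₀) (l : List (Fin R)) (hl : l.Nodup) (M : Mem N R)
    (hM : G.MemInv α p₀ M) (hy : ∀ r ∈ l, M.y r = M₀.y r) :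
    G.MemInv α p₀ (l.foldl (fun M' r => (G.apBlock (apVec M₀) M' r).val) M) ∧
    (∀ r ∉ l, (l.foldl (fun M' r => (G.apBlock (apVec M₀) M' r).val) M).y r = M.y r ∧
      (l.foldl (fun M' r => (G.apBlock (apVec M₀) M' r).val) M).φ r = M.φ r) ∧
    ∀ r ∈ l, IsConeProj (G.wcut r) (G.apPoint (G.W α) (G.x0 p₀) (dualOf M₀) r)
      (fun i => G.psi i / G.W α i)
      ((l.foldl (fun M' r => (G.apBlock (apVec M₀) M' r).val) M).y r,
        (l.foldl (fun M' r => (G.apBlock (apVec M₀) M' r).val) M).φ r) := by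
  induction l generalizing M with
  | nil => simpa using hM
  | cons r l ih =>
    rw [List.nodup_cons] at hl
    obtain ⟨h2, p, h3, h4⟩ := MemInv.apBlock h0 h1 hM₀ hM (hy r List.mem_cons_self)
    have h5 : (G.apBlock (apVec M₀) M r).val.y = Function.update M.y r p.1 := congrArg Prod.fst h4
    have h6 : (G.apBlock (apVec M₀) M r).val.φ = Function.update M.φ r p.2 := congrArg Prod.snd h4
    obtain ⟨e1, e2, e3⟩ := ih hl.2 (G.apBlock (apVec M₀) M r).val h2 fun s hs => by
      have hne : s ≠ r := fun h => hl.1 (h ▸ hs)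
      rw [h5, Function.update_of_ne hne]
      exact hy s (List.mem_cons_of_mem _ hs)
    simp only [List.foldl_cons]
    refine ⟨e1, fun s hs => ?_, fun s hs => ?_⟩
    · simp only [List.mem_cons, not_or] at hs
      obtain ⟨f1, f2⟩ := e2 s hs.2
      rw [f1, f2, h5, h6, Function.update_of_ne hs.1, Function.update_of_ne hs.1]
      exact ⟨rfl, rfl⟩
    · rcases List.mem_cons.1 hs with rfl | hs
      · obtain ⟨f1, f2⟩ := e2 s hl.1
        rw [f1, f2, h5, h6, Function.update_self, Function.update_self]
        exact h3
      · exact e3 s hs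

theorem MemInv.apStep {α : ℝ} (h0 : 0 < α) (h1 : α < 1) {p₀ : Fin N → ℝ} {M : Mem N R}
    (hM : G.MemInv α p₀ M) :
    G.MemInv α p₀ (G.apStep M).val ∧
    ∀ r, IsConeProj (G.wcut r) (G.apPoint (G.W α) (G.x0 p₀) (dualOf M) r)
      (fun i => G.psi i / G.W α i)
      ((dualOf (G.apStep M).val).1 r, (dualOf (G.apStep M).val).2 r) := by
  rw [apStep_val]
  obtain ⟨e1, -, e3⟩ := MemInv.apFold h0 h1 hM (List.finRange R) (List.nodup_finRange R) M hM
    fun _ _ => rfl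
  exact ⟨e1, fun r => e3 r (List.mem_finRange r)⟩

variable (G)

theorem output_val (M : Mem N R) : (output M).val
    = ⟨dualOf M, fun i => M.a i - M.s i / (2 * M.W i)⟩ := by
  have h := foldl_update_eq (fun i => M.a i - M.s i / (2 * M.W i)) (List.finRange N) (alloc N).val
  simp only [List.mem_finRange, if_true] at h
  unfold output
  simp only [Timed.val_bind, forEach_val, Timed.val_pure]
  rw [← h]
  rfl

variable {G} in
theorem MemInv.output_val {α : ℝ} {p₀ : Fin N → ℝ} {M : Mem N R} (hM : G.MemInv α p₀ M) :
    (output M).val = ⟨dualOf M, primalOf (G.W α) (G.x0 p₀) (dualOf M)⟩ := by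
  rw [DirHypergraph.output_val, hM.a_eq, hM.s_eq, hM.W_eq]
  congr 1
  funext i
  simp [primalOf, dualOf]

/-! ### Times of initialization, output and an iteration of AP -/

theorem card_vertices_le : N ≤ ∑ r, (G.S r).card := by
  have h : (Finset.univ : Finset (Fin N)) ⊆ Finset.univ.biUnion G.S := fun i _ => by
    obtain ⟨r, hr⟩ := G.covered i
    exact Finset.mem_biUnion.2 ⟨r, Finset.mem_univ r, hr⟩
  have h2 := (Finset.card_le_card h).trans Finset.card_biUnion_le
  simpa using h2

theorem card_hyperedges_le : 2 * R ≤ ∑ r, (G.S r).card := by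
  have := Finset.card_nsmul_le_sum Finset.univ (fun r => (G.S r).card) 2
    fun r _ => G.two_le_card r
  rw [Finset.card_univ, Fintype.card_fin, smul_eq_mul] at this
  omega

theorem sum_card_le : ((∑ r, (G.S r).card : ℕ) : ℝ) ≤ 1.5 * G.sortCost := by
  rw [Nat.cast_sum, sortCost, Finset.mul_sum]
  exact Finset.sum_le_sum fun r _ => card_le_mul_log (G.two_le_card r)

theorem initMem_time_le (α : ℝ) (p₀ : Fin N → ℝ) :
    (G.initMem α p₀).time ≤ 20 * N + 8 * (∑ r, (G.S r).card) + 4 * R + 4 := by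
  have hdeg : G.degrees.time ≤ 2 * N + (7 * (∑ r, (G.S r).card) + 3 * R + 1) := by
    have h := forEach_time_le (fun (p : (Fin N → ℝ) × (Fin N → ℝ)) r => do
      let w ← read G.w r
      forEach (fun q (e : Entry N) => do
        let di ← read q.1 e.vtx
        let di' ← add di w
        let d' ← write q.1 e.vtx di'
        let ki ← read q.2 e.vtx
        let ki' ← add ki 1
        let k' ← write q.2 e.vtx ki'
        pure (d', k')) (G.entries r) p) (fun r => 7 * (G.S r).card + 2) (List.finRange R)
      (fun p r _ => by
        have h2 := forEach_time_le_const (fun (q : (Fin N → ℝ) × (Fin N → ℝ)) (e : Entry N) => do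
          let di ← read q.1 e.vtx
          let di' ← add di (G.w r)
          let d' ← write q.1 e.vtx di'
          let ki ← read q.2 e.vtx
          let ki' ← add ki 1
          let k' ← write q.2 e.vtx ki'
          pure (d', k')) 6 (G.entries r) (fun _ _ _ => le_rfl) p
        rw [length_entries] at h2
        simp only [Timed.time_bind, read_time, read_val] at h2 ⊢
        omega) (fun _ => 0, fun _ => 0)
    rw [← Fin.sum_univ_def, Finset.sum_add_distrib, Finset.sum_add_distrib, ← Finset.mul_sum,
      Finset.sum_const, Finset.sum_const, Finset.card_univ, Fintype.card_fin, smul_eq_mul,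
      smul_eq_mul] at h
    have h3 : G.degrees.time = N + (N + _) := rfl
    rw [h3]
    refine (Nat.add_le_add_left (Nat.add_le_add_left h _) _).trans ?_
    omega
  have h := forEach_time_le_const (fun (M : Mem N R) i => do
    let di ← read G.degrees.val.1 i
    let ki ← read G.degrees.val.2 i
    let pi ← read p₀ i
    let wi ← mul (div α (sub 1 α).val).val di
    let ai ← div pi di
    let wi2 ← mul 2 wi
    let ci ← mul wi2 ai
    let vi ← div wi ki
    let W' ← write M.W i wi
    let a' ← write M.a i ai
    let c' ← write M.c i ci
    let V' ← write M.V i vi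
    pure { M with W := W', a := a', c := c', V := V' }) 12 (List.finRange N)
    (fun _ _ _ => le_rfl) ⟨fun _ => 0, fun _ => 0, fun _ => 0, fun _ => 0, fun _ => 0,
      fun _ _ => 0, fun _ => 0⟩
  rw [List.length_finRange] at h
  refine le_trans (b := G.degrees.time + (N + (N + (N + (N + (N
      + ((∑ r, (G.S r).card) + (R + (1 + (1 + (N * (12 + 1) + 1))))))))))) ?_ ?_
  · have h4 := Nat.add_le_add_left h 1
    have h5 := Nat.add_le_add_left (Nat.add_le_add_left (Nat.add_le_add_left
      (Nat.add_le_add_left h4 1) R) (∑ r, (G.S r).card)) N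
    exact Nat.add_le_add_left (Nat.add_le_add_left (Nat.add_le_add_left (Nat.add_le_add_left
      (Nat.add_le_add_left h5 N) N) N) N) G.degrees.time
  · omega

theorem output_time_le (M : Mem N R) : (output M).time ≤ 9 * N + 1 := by
  have h := forEach_time_le_const (fun (x : Fin N → ℝ) i => do
    let si ← read M.s i
    let wi ← read M.W i
    let ai ← read M.a i
    let w2 ← mul 2 wi
    let q ← div si w2
    let xi ← sub ai q
    write x i xi) 7 (List.finRange N) (fun _ _ _ => le_rfl) (fun _ => 0)
  rw [List.length_finRange] at h
  have h3 : (output M).time = N + (_ + 0) := rfl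
  rw [h3]
  refine (Nat.add_le_add_left (Nat.add_le_add_right h 0) N).trans ?_
  omega

theorem init_output_time_le [NeZero R] (α : ℝ) (p₀ : Fin N → ℝ) (M : Mem N R) :
    ((G.initMem α p₀).time : ℝ) + (output M).time ≤ 70 * G.sortCost := by
  have h1 := G.initMem_time_le α p₀
  have h2 := output_time_le M
  have h3 := G.card_vertices_le
  have h4 := G.card_hyperedges_le
  have h5 := G.sum_card_le
  have h6 : 0 < R := Nat.pos_of_ne_zero (NeZero.ne R)
  have h7 : (G.initMem α p₀).time + (output M).time ≤ 43 * ∑ r, (G.S r).card := by omega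
  have h8 : ((G.initMem α p₀).time : ℝ) + (output M).time
      ≤ 43 * ((∑ r, (G.S r).card : ℕ) : ℝ) := by exact_mod_cast h7
  linarith

variable {G}

theorem apStep_time_le [NeZero R] {α : ℝ} (h0 : 0 < α) (h1 : α < 1) {p₀ : Fin N → ℝ}
    {M : Mem N R} (hM : G.MemInv α p₀ M) :
    ((G.apStep M).time : ℝ) + 1 ≤ 250 * G.sortCost := by
  -- the memory cells `V` are not written, so the bound holds along the whole pass
  have hfold : ∀ (l : List (Fin R)) (M' : Mem N R), M'.V = (fun i => G.W α i / G.psi i) →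
      (forEach (G.apBlock (apVec M)) l M').time ≤ (l.map fun r => 14 * (G.S r).card + 4
        + ⌊200 * ((G.S r).card * Real.log (G.S r).card)⌋₊ + 1).sum + 1 := by
    intro l
    induction l with
    | nil => intro M' _; simp [forEach]
    | cons r l ih =>
      intro M' hM'
      have e1 := G.apBlock_time_le h0 h1 hM' (apVec M) r
      have e2 : (G.apBlock (apVec M) M' r).val.V = fun i => G.W α i / G.psi i := by
        obtain ⟨y, φ, hval, -⟩ := G.project_spec r (fun i => M'.y r i - M'.V i * apVec M i / 2) M'.V
          (hM' ▸ G.V_pos h0 h1)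
        rw [apBlock_val, hval, store_val]
        exact hM'
      have e3 := ih _ e2
      simp only [forEach, Timed.time_bind, tick_time, List.map_cons, List.sum_cons]
      omega
  have h2 := hfold (List.finRange R) M hM.V_eq
  have h3 := forEach_time_le_const (fun (q : Fin N → ℝ) i => do
    let si ← read M.s i
    let wi ← read M.W i
    let ai ← read M.a i
    let s2 ← mul 2 si
    let sw ← div s2 wi
    let a4 ← mul 4 ai
    let qi ← sub sw a4
    write q i qi) 8 (List.finRange N) (fun _ _ _ => le_rfl) (alloc N).val
  rw [List.length_finRange] at h3
  have h4 : (G.apStep M).time ≤ N + (9 * N + 1) + ((List.map (fun r => 14 * (G.S r).card + 4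
        + ⌊200 * ((G.S r).card * Real.log (G.S r).card)⌋₊ + 1) (List.finRange R)).sum + 1) := by
    unfold DirHypergraph.apStep
    simp only [Timed.time_bind]
    rw [apVec_val]
    have h5 : (forEach (G.apBlock (apVec M)) (List.finRange R) M).time = _ := rfl
    rw [h5] at h2
    change _ + (_ + (forEach (G.apBlock (apVec M)) (List.finRange R) M).time) ≤ _
    rw [alloc_time]
    omega
  rw [← Fin.sum_univ_def] at h4
  have h5 : ((∑ r, (14 * (G.S r).card + 4
      + ⌊200 * ((G.S r).card * Real.log (G.S r).card)⌋₊ + 1) : ℕ) : ℝ)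
      ≤ 14 * ((∑ r, (G.S r).card : ℕ) : ℝ) + 5 * R + 200 * G.sortCost := by
    have h6 : ∀ r, (⌊200 * ((G.S r).card * Real.log (G.S r).card)⌋₊ : ℝ)
        ≤ 200 * ((G.S r).card * Real.log (G.S r).card) := fun r => by
      refine Nat.floor_le ?_
      have : (1 : ℝ) ≤ (G.S r).card := by exact_mod_cast (G.two_le_card r).trans' one_le_two
      have := Real.log_nonneg this
      positivity
    push_cast
    calc ∑ r, (14 * ((G.S r).card : ℝ) + 4
          + (⌊200 * (((G.S r).card : ℝ) * Real.log (G.S r).card)⌋₊ : ℝ) + 1)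
        ≤ ∑ r, (14 * ((G.S r).card : ℝ) + 5
          + 200 * (((G.S r).card : ℝ) * Real.log (G.S r).card)) :=
          Finset.sum_le_sum fun r _ => by linarith [h6 r]
      _ = _ := by
          rw [Finset.sum_add_distrib, Finset.sum_add_distrib, ← Finset.mul_sum, ← Finset.mul_sum,
            sortCost, Finset.sum_const, Finset.card_univ, Fintype.card_fin, nsmul_eq_mul]
          ring
  have h6 : ((G.apStep M).time : ℝ) ≤ N + (9 * N + 1) + (((∑ r, (14 * (G.S r).card + 4
      + ⌊200 * ((G.S r).card * Real.log (G.S r).card)⌋₊ + 1) : ℕ) : ℝ) + 1) := by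
    exact_mod_cast h4
  have h7 : (N : ℝ) ≤ ((∑ r, (G.S r).card : ℕ) : ℝ) := by exact_mod_cast G.card_vertices_le
  have h8 : (2 * R : ℝ) ≤ ((∑ r, (G.S r).card : ℕ) : ℝ) := by exact_mod_cast G.card_hyperedges_le
  have h9 : (1 : ℝ) ≤ R := by exact_mod_cast Nat.pos_of_ne_zero (NeZero.ne R)
  have h10 := G.sum_card_le
  linarith

end DirHypergraph

/-! ### Linear convergence with explicit constants -/

namespace DirHypergraph

variable {N R : ℕ} {G : DirHypergraph N R}

/-- The condition number `N² max{1, 9 (1-α)/α} max_{i,j} D_ii/D_jj` of RCD. -/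
noncomputable def rcdCond (G : DirHypergraph N R) (α : ℝ) : ℝ :=
  (N : ℝ) ^ 2 * max 1 (9 * ((1 - α) / α)) * (⨆ ij : Fin N × Fin N, G.deg ij.1 / G.deg ij.2)

/-- The condition number `N² max{1, 9 (1-α)/α} max_{i,j} Ψ_jj D_ii/D_jj` of AP. -/
noncomputable def apCond (G : DirHypergraph N R) (α : ℝ) : ℝ :=
  (N : ℝ) ^ 2 * max 1 (9 * ((1 - α) / α)) *
    (⨆ ij : Fin N × Fin N, G.psi ij.2 * G.deg ij.1 / G.deg ij.2)

theorem vertices_pos [NeZero R] (G : DirHypergraph N R) : 0 < N := by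
  have h := (G.S 0).card_le_univ
  have h2 := G.two_le_card 0
  rw [Fintype.card_fin] at h
  omega

theorem one_le_psi (G : DirHypergraph N R) (i : Fin N) : 1 ≤ G.psi i := by
  have h := G.psi_pos i
  rw [psi, Nat.cast_pos] at h
  rw [psi]
  exact_mod_cast h

theorem sum_w_le_sum_deg (G : DirHypergraph N R) : ∑ r, G.w r ≤ ∑ i, G.deg i := by
  simp only [deg]
  rw [Finset.sum_comm]
  refine Finset.sum_le_sum fun r _ => ?_
  obtain ⟨i, hi⟩ := G.H_nonempty r
  have h := Finset.single_le_sum (f := fun i => if i ∈ G.S r then G.w r else 0)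
    (fun j _ => by
      split_ifs
      exacts [(G.w_pos r).le, le_rfl]) (Finset.mem_univ i)
  simpa [G.H_sub r hi] using h

/-- The constant of the error bound is at most `99` times a condition number; `c = 1` is the case
of RCD and `c = Ψ` the case of AP. -/
theorem error_const_le [NeZero R] {α : ℝ} (h0 : 0 < α) (h1 : α < 1) {c : Fin N → ℝ} {X : ℝ}
    (hc : ∀ i, 1 ≤ c i) (hX : ∀ i j, c j * G.deg i / G.deg j ≤ X) :
    1 ≤ (N : ℝ) ^ 2 * max 1 (9 * ((1 - α) / α)) * X ∧
    98 * (∑ i, c i / G.W α i) * max (∑ i, G.W α i) (∑ r, G.w r) + 1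
      ≤ 99 * ((N : ℝ) ^ 2 * max 1 (9 * ((1 - α) / α)) * X) := by
  have hN : (1 : ℝ) ≤ N := by exact_mod_cast G.vertices_pos
  have hd := G.deg_pos
  set m := max 1 (9 * ((1 - α) / α)) with hm
  have hm1 : 1 ≤ m := le_max_left _ _
  have hX1 : 1 ≤ X := by
    have h := hX ⟨0, G.vertices_pos⟩ ⟨0, G.vertices_pos⟩
    rw [mul_div_assoc, div_self (hd _).ne', mul_one] at h
    exact (hc _).trans h
  have hone : 1 ≤ (N : ℝ) ^ 2 * m * X :=
    one_le_mul_of_one_le_of_one_le (one_le_mul_of_one_le_of_one_le (one_le_pow₀ hN) hm1) hX1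
  refine ⟨hone, ?_⟩
  have hβ : 0 < (1 - α) / α := div_pos (by linarith) h0
  have hsum : ∑ i, c i / G.W α i = (1 - α) / α * ∑ i, c i / G.deg i := by
    rw [Finset.mul_sum]
    refine Finset.sum_congr rfl fun i _ => ?_
    have := (hd i).ne'
    have : 1 - α ≠ 0 := by linarith
    rw [W]
    field_simp
  have hW : ∑ i, G.W α i = α / (1 - α) * ∑ i, G.deg i := by
    rw [Finset.mul_sum]
    rfl
  have hdd : (∑ i, c i / G.deg i) * ∑ i, G.deg i ≤ (N : ℝ) ^ 2 * X := by
    rw [Finset.sum_mul_sum]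
    calc ∑ i, ∑ j, c i / G.deg i * G.deg j ≤ ∑ _i : Fin N, ∑ _j : Fin N, X :=
          Finset.sum_le_sum fun i _ => Finset.sum_le_sum fun j _ => by
            rw [div_mul_eq_mul_div]
            exact hX j i
      _ = (N : ℝ) ^ 2 * X := by simp; ring
  have hq : 0 ≤ ∑ i, c i / G.deg i :=
    Finset.sum_nonneg fun i _ => div_nonneg (zero_le_one.trans (hc i)) (hd i).le
  have hD : 0 ≤ ∑ i, G.deg i := Finset.sum_nonneg fun i _ => (hd i).le
  have hNX : 0 ≤ (N : ℝ) ^ 2 * X := by positivity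
  have key : (∑ i, c i / G.W α i) * max (∑ i, G.W α i) (∑ r, G.w r) ≤ (N : ℝ) ^ 2 * m * X := by
    rw [hsum, hW, mul_max_of_nonneg _ _ (mul_nonneg hβ.le hq)]
    refine max_le ?_ ?_
    · have e : (1 - α) / α * (∑ i, c i / G.deg i) * (α / (1 - α) * ∑ i, G.deg i)
          = (∑ i, c i / G.deg i) * ∑ i, G.deg i := by
        have : 1 - α ≠ 0 := by linarith
        field_simp
      rw [e]
      nlinarith
    · calc (1 - α) / α * (∑ i, c i / G.deg i) * ∑ r, G.w r
          ≤ (1 - α) / α * (∑ i, c i / G.deg i) * ∑ i, G.deg i :=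
            mul_le_mul_of_nonneg_left G.sum_w_le_sum_deg (mul_nonneg hβ.le hq)
        _ = (1 - α) / α * ((∑ i, c i / G.deg i) * ∑ i, G.deg i) := by ring
        _ ≤ (1 - α) / α * ((N : ℝ) ^ 2 * X) := mul_le_mul_of_nonneg_left hdd hβ.le
        _ ≤ m * ((N : ℝ) ^ 2 * X) := mul_le_mul_of_nonneg_right
            (le_trans (by linarith) (le_max_right _ _)) hNX
        _ = (N : ℝ) ^ 2 * m * X := by ring
  nlinarith

theorem rcdCond_spec [NeZero R] {α : ℝ} (h0 : 0 < α) (h1 : α < 1) :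
    1 ≤ G.rcdCond α ∧
    98 * (∑ i, (G.W α)⁻¹ i) * max (∑ i, G.W α i) (∑ r, G.w r) + 1 ≤ 99 * G.rcdCond α := by
  have h := G.error_const_le h0 h1 (c := fun _ => 1)
    (X := ⨆ ij : Fin N × Fin N, G.deg ij.1 / G.deg ij.2) (fun _ => le_rfl) (fun i j => by
      rw [one_mul]
      exact le_ciSup (f := fun ij : Fin N × Fin N => G.deg ij.1 / G.deg ij.2)
        (Set.finite_range _).bddAbove (i, j))
  simpa only [one_div, Pi.inv_apply, rcdCond] using h

theorem apCond_spec [NeZero R] {α : ℝ} (h0 : 0 < α) (h1 : α < 1) :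
    1 ≤ G.apCond α ∧
    98 * (∑ i, G.psi i / G.W α i) * max (∑ i, G.W α i) (∑ r, G.w r) + 1 ≤ 99 * G.apCond α :=
  G.error_const_le h0 h1 G.one_le_psi fun i j =>
    le_ciSup (f := fun ij : Fin N × Fin N => G.psi ij.2 * G.deg ij.1 / G.deg ij.2)
      (Set.finite_range _).bddAbove (i, j)

theorem dualGap_eq {α : ℝ} {p₀ : Fin N → ℝ} {z' : DualVar N R} (hz' : z' ∈ G.prSol α p₀)
    (z : DualVar N R) :
    G.dualGap α p₀ z = dualObj (G.W α) (G.x0 p₀) z - dualObj (G.W α) (G.x0 p₀) z' := by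
  have h : IsLeast (dualObj (G.W α) (G.x0 p₀) '' prodCone G.wcut)
      (dualObj (G.W α) (G.x0 p₀) z') :=
    ⟨Set.mem_image_of_mem _ hz'.1, by
      rintro _ ⟨v, hv, rfl⟩
      exact hz'.2 hv⟩
  rw [dualGap, dualOpt, h.csInf_eq]

theorem prSol_nonempty {α : ℝ} (h0 : 0 < α) (h1 : α < 1) (p₀ : Fin N → ℝ) :
    (G.prSol α p₀).Nonempty := G.dualSol_nonempty _ (G.W_pos h0 h1)

theorem dualGap_nonneg {α : ℝ} (h0 : 0 < α) (h1 : α < 1) {p₀ : Fin N → ℝ} {z : DualVar N R}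
    (hz : z ∈ prodCone G.wcut) : 0 ≤ G.dualGap α p₀ z := by
  obtain ⟨z', hz'⟩ := G.prSol_nonempty h0 h1 p₀
  rw [dualGap_eq hz']
  exact sub_nonneg.2 (hz'.2 hz)

theorem psi_div_W_pos {α : ℝ} (h0 : 0 < α) (h1 : α < 1) (i : Fin N) :
    0 < G.psi i / G.W α i := div_pos (G.psi_pos i) (G.W_pos h0 h1 i)

/-- The error bound of RCD. -/
theorem rcdDist_sq_le [NeZero R] {α : ℝ} (h0 : 0 < α) (h1 : α < 1) {p₀ : Fin N → ℝ}
    {z : DualVar N R} (hz : z ∈ prodCone G.wcut) :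
    G.rcdDist α p₀ z ^ 2 ≤ 99 * G.rcdCond α * G.dualGap α p₀ z := by
  obtain ⟨z', hz'⟩ := G.prSol_nonempty h0 h1 p₀
  have hW := pi_inv_pos (G.W_pos h0 h1)
  obtain ⟨v, hv, hle⟩ := exists_dualSol_near (G.W_pos h0 h1) (fun i => (hW i).le) (G.x0 p₀) hz hz'
  refine (dualDist_sq_le hW hv).trans (hle.trans ?_)
  rw [← dualGap_eq hz']
  exact mul_le_mul_of_nonneg_right (G.rcdCond_spec h0 h1).2 (dualGap_nonneg h0 h1 hz)

/-- The error bound of AP. -/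
theorem apDist_sq_le [NeZero R] {α : ℝ} (h0 : 0 < α) (h1 : α < 1) {p₀ : Fin N → ℝ}
    {z : DualVar N R} (hz : z ∈ prodCone G.wcut) :
    G.apDist α p₀ z ^ 2 ≤ 99 * G.apCond α * G.dualGap α p₀ z := by
  obtain ⟨z', hz'⟩ := G.prSol_nonempty h0 h1 p₀
  have hW := G.psi_div_W_pos h0 h1
  obtain ⟨v, hv, hle⟩ := exists_dualSol_near (G.W_pos h0 h1) (fun i => (hW i).le) (G.x0 p₀) hz hz'
  refine (dualDist_sq_le hW hv).trans (hle.trans ?_)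
  rw [← dualGap_eq hz']
  exact mul_le_mul_of_nonneg_right (G.apCond_spec h0 h1).2 (dualGap_nonneg h0 h1 hz)

/-- The potential `g - g* + d²` of RCD. -/
noncomputable def rcdPotential (G : DirHypergraph N R) (α : ℝ) (p₀ : Fin N → ℝ)
    (z : DualVar N R) : ℝ :=
  G.dualGap α p₀ z + G.rcdDist α p₀ z ^ 2

theorem rcdPotential_nonneg {α : ℝ} (h0 : 0 < α) (h1 : α < 1) {p₀ : Fin N → ℝ} {z : DualVar N R}
    (hz : z ∈ prodCone G.wcut) : 0 ≤ G.rcdPotential α p₀ z :=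
  add_nonneg (dualGap_nonneg h0 h1 hz) (sq_nonneg _)

/-- In an RCD iteration the potential decreases in the mean by the factor `1 - 1/(100 κ R)`. -/
theorem sum_rcdPotential_le [NeZero R] {α : ℝ} (h0 : 0 < α) (h1 : α < 1) {p₀ : Fin N → ℝ}
    {z : DualVar N R} (hz : z ∈ prodCone G.wcut) (p : Fin R → (Fin N → ℝ) × ℝ)
    (hp : ∀ r, IsConeProj (G.wcut r) (rcdPoint (G.W α) (G.x0 p₀) z r) (G.W α)⁻¹ (p r)) :
    ∑ r, G.rcdPotential α p₀ (setBlock z r (p r))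
      ≤ (R - 1 / (100 * G.rcdCond α)) * G.rcdPotential α p₀ z := by
  have hW := pi_inv_pos (G.W_pos h0 h1)
  obtain ⟨z', hz'⟩ := G.prSol_nonempty h0 h1 p₀
  have hκ := (G.rcdCond_spec h0 h1).1
  have hgap := dualGap_nonneg h0 h1 (p₀ := p₀) hz
  have hR : (0 : ℝ) < R := by exact_mod_cast Nat.pos_of_ne_zero (NeZero.ne R)
  have hstep : ∑ r, G.rcdPotential α p₀ (setBlock z r (p r))
      ≤ R * G.rcdPotential α p₀ z - G.dualGap α p₀ z := by
    have h : (∑ r, G.rcdPotential α p₀ (setBlock z r (p r)) - R * G.dualGap α p₀ z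
        + G.dualGap α p₀ z) / R ≤ G.rcdDist α p₀ z ^ 2 := by
      refine le_dualDist_sq ⟨z', hz'⟩ fun v hv => ?_
      rw [div_le_iff₀ hR]
      have h2 := rcd_descent (G.W_pos h0 h1) (G.x0 p₀) hv.1 p hp
      have h3 : ∑ r, G.rcdPotential α p₀ (setBlock z r (p r))
          ≤ ∑ r, (dualObj (G.W α) (G.x0 p₀) (setBlock z r (p r))
            + dualNormSq (G.W α)⁻¹ (setBlock z r (p r) - v))
            - R * dualObj (G.W α) (G.x0 p₀) v := by
        have e : (R : ℝ) * dualObj (G.W α) (G.x0 p₀) v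
            = ∑ _r : Fin R, dualObj (G.W α) (G.x0 p₀) v := by simp
        rw [e, ← Finset.sum_sub_distrib]
        refine Finset.sum_le_sum fun r _ => ?_
        have h4 : G.rcdDist α p₀ (setBlock z r (p r)) ^ 2
            ≤ dualNormSq (G.W α)⁻¹ (setBlock z r (p r) - v) := dualDist_sq_le hW hv
        rw [rcdPotential, dualGap_eq hv]
        linarith
      rw [dualGap_eq hv]
      linarith
    rw [div_le_iff₀ hR] at h
    rw [rcdPotential, mul_add]
    linarith
  have hbd : G.rcdPotential α p₀ z ≤ 100 * G.rcdCond α * G.dualGap α p₀ z := by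
    have h := rcdDist_sq_le h0 h1 (p₀ := p₀) hz
    rw [rcdPotential]
    nlinarith
  have h5 : 1 / (100 * G.rcdCond α) * G.rcdPotential α p₀ z ≤ G.dualGap α p₀ z := by
    rw [one_div_mul_eq_div, div_le_iff₀ (by linarith)]
    linarith
  linarith

/-- In an AP iteration the squared distance decreases by the factor `1 - 1/(100 κ)`. -/
theorem apDist_step_sq_le [NeZero R] {α : ℝ} (h0 : 0 < α) (h1 : α < 1) {p₀ : Fin N → ℝ}
    {z z₁ : DualVar N R} (hz : z ∈ prodCone G.wcut)
    (hp : ∀ r, IsConeProj (G.wcut r) (G.apPoint (G.W α) (G.x0 p₀) z r)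
      (fun i => G.psi i / G.W α i) (z₁.1 r, z₁.2 r)) :
    G.apDist α p₀ z₁ ^ 2 ≤ (1 - 1 / (100 * G.apCond α)) * G.apDist α p₀ z ^ 2 := by
  have hW := G.psi_div_W_pos h0 h1
  have hz₁ : z₁ ∈ prodCone G.wcut := fun r => (hp r).1
  have hκ := (G.apCond_spec h0 h1).1
  have hstep : G.dualGap α p₀ z₁ + G.apDist α p₀ z₁ ^ 2 ≤ G.apDist α p₀ z ^ 2 := by
    refine le_dualDist_sq (G.prSol_nonempty h0 h1 p₀) fun v hv => ?_
    have h2 := ap_descent (G.W_pos h0 h1) (G.x0 p₀) hz hv.1 hp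
    have h3 : G.apDist α p₀ z₁ ^ 2 ≤ dualNormSq (fun i => G.psi i / G.W α i) (z₁ - v) :=
      dualDist_sq_le hW hv
    rw [dualGap_eq hv]
    linarith
  have h := apDist_sq_le h0 h1 (p₀ := p₀) hz₁
  have hgap := dualGap_nonneg h0 h1 (p₀ := p₀) hz₁
  have e : (1 - 1 / (100 * G.apCond α)) * G.apDist α p₀ z ^ 2
      = (100 * G.apCond α - 1) * G.apDist α p₀ z ^ 2 / (100 * G.apCond α) := by
    field_simp
  rw [e, le_div_iff₀ (by linarith)]
  nlinarith

/-- The primal error of RCD is bounded by the dual gap. -/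
theorem primal_error_le_dualGap {α : ℝ} (h0 : 0 < α) (h1 : α < 1) {p₀ p : Fin N → ℝ}
    (hp : G.IsPageRank α p₀ p) {z : DualVar N R} (hz : z ∈ prodCone G.wcut) :
    wNormSq (G.W α) (primalOf (G.W α) (G.x0 p₀) z - G.x0 p) ≤ G.dualGap α p₀ z := by
  obtain ⟨z', hz'⟩ := G.prSol_nonempty h0 h1 p₀
  rw [(G.isPageRank_iff h0 h1 hz').1 hp, dualGap_eq hz']
  exact (primal_error_le (G.W_pos h0 h1) _ z z').trans
    (G.dualQuad_le_of_mem_dualSol _ (G.W_pos h0 h1) hz' hz)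

/-- The primal error of AP is bounded by the dual distance. -/
theorem primal_error_le_apDist {α : ℝ} (h0 : 0 < α) (h1 : α < 1) {p₀ p : Fin N → ℝ}
    (hp : G.IsPageRank α p₀ p) {z : DualVar N R} (hz : z ∈ prodCone G.wcut) :
    √(wNormSq (G.W α) (primalOf (G.W α) (G.x0 p₀) z - G.x0 p)) ≤ G.apDist α p₀ z := by
  refine Real.sqrt_le_iff.2 ⟨dualDist_nonneg _ _ _, ?_⟩
  refine le_dualDist_sq (G.prSol_nonempty h0 h1 p₀) fun v hv => ?_
  rw [(G.isPageRank_iff h0 h1 hv).1 hp]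
  refine (primal_error_le (G.W_pos h0 h1) _ z v).trans
    (dualQuad_le_dualNormSq (G.W_pos h0 h1) fun r i hi => ?_)
  have e1 := (G.mem_prodCone_wcut.1 hz r).eq_zero_of_notMem hi
  have e2 := (G.mem_prodCone_wcut.1 hv.1 r).eq_zero_of_notMem hi
  simp [e1, e2]

end DirHypergraph

/-! ### Averaging over uniform draws -/

section Draws

variable {R : ℕ}

/-- A quantity that depends only on the first `k` draws is measurable. -/
theorem measurable_of_prefix [NeZero R] {k : ℕ} {F : (ℕ → Fin R) → ℝ≥0∞}
    (hF : ∀ ω ω' : ℕ → Fin R, (∀ j < k, ω j = ω' j) → F ω = F ω') : Measurable F := by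
  let g : (Fin k → Fin R) → ℝ≥0∞ := fun s => F fun j => if h : j < k then s ⟨j, h⟩ else 0
  have hg : F = g ∘ fun ω (j : Fin k) => ω j := by
    funext ω
    refine hF _ _ fun j hj => ?_
    simp [hj]
  rw [hg]
  exact (measurable_of_finite g).comp (measurable_pi_lambda _ fun j => measurable_pi_apply _)

theorem measurable_redraw (k : ℕ) (r : Fin R) :
    Measurable fun ω : ℕ → Fin R => Function.update ω k r :=
  measurable_pi_lambda _ fun j => by
    by_cases h : j = k
    · subst h
      simp
    · simpa [Function.update_of_ne h] using measurable_pi_apply j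

variable [NeZero R]

instance : IsProbabilityMeasure (uniformDraws R) := by
  unfold uniformDraws
  infer_instance

theorem uniform_apply (A : Set (Fin R)) :
    (PMF.uniformOfFintype (Fin R)).toMeasure A
      = (R : ℝ≥0∞)⁻¹ * ∑ r, A.indicator (fun _ => (1 : ℝ≥0∞)) r := by
  classical
  rw [PMF.toMeasure_apply_fintype, Finset.mul_sum]
  refine Finset.sum_congr rfl fun r _ => ?_
  by_cases h : r ∈ A <;> simp [h]

/-- Redrawing the `k`-th hyperedge uniformly does not change the law of the draws. -/
theorem uniformDraws_eq_redraw (k : ℕ) :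
    uniformDraws R = (R : ℝ≥0∞)⁻¹ • ∑ r : Fin R,
      (uniformDraws R).map fun ω => Function.update ω k r := by
  classical
  symm
  unfold uniformDraws
  refine Measure.eq_infinitePi _ fun s t ht => ?_
  have hS : MeasurableSet ((s : Set ℕ).pi t) :=
    MeasurableSet.pi s.countable_toSet fun i _ => ht i
  rw [Measure.smul_apply, Measure.finsetSum_apply, smul_eq_mul]
  simp_rw [Measure.map_apply (measurable_redraw k _) hS]
  by_cases hk : k ∈ s
  · have e : ∀ r : Fin R, (fun ω : ℕ → Fin R => Function.update ω k r) ⁻¹' ((s : Set ℕ).pi t)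
        = if r ∈ t k then ((s.erase k : Finset ℕ) : Set ℕ).pi t else ∅ := by
      intro r
      ext ω
      split_ifs with hr
      · simp only [Set.mem_preimage, Set.mem_pi, Finset.mem_coe, Finset.mem_erase]
        constructor
        · rintro h j ⟨hjk, hj⟩
          simpa [Function.update_of_ne hjk] using h j hj
        · intro h j hj
          by_cases hjk : j = k
          · subst hjk; simpa using hr
          · simpa [Function.update_of_ne hjk] using h j ⟨hjk, hj⟩
      · simp only [Set.mem_preimage, Set.mem_pi, Finset.mem_coe, Set.mem_empty_iff_false, iff_false]
        intro h
        exact hr (by simpa using h k hk)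
    have e2 : ∀ r : Fin R,
        Measure.infinitePi (fun _ : ℕ => (PMF.uniformOfFintype (Fin R)).toMeasure)
        ((fun ω : ℕ → Fin R => Function.update ω k r) ⁻¹' ((s : Set ℕ).pi t))
        = (t k).indicator (fun _ => (1 : ℝ≥0∞)) r
          * ∏ i ∈ s.erase k, (PMF.uniformOfFintype (Fin R)).toMeasure (t i) := by
      intro r
      rw [e r]
      by_cases hr : r ∈ t k
      · rw [if_pos hr, Measure.infinitePi_pi _ fun i _ => ht i]
        simp [hr]
      · simp [hr]
    simp_rw [e2]
    rw [← Finset.sum_mul, ← mul_assoc, ← uniform_apply,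
      Finset.mul_prod_erase s (fun i => (PMF.uniformOfFintype (Fin R)).toMeasure (t i)) hk]
  · have e : ∀ r : Fin R, (fun ω : ℕ → Fin R => Function.update ω k r) ⁻¹' ((s : Set ℕ).pi t)
        = (s : Set ℕ).pi t := by
      intro r
      ext ω
      simp only [Set.mem_preimage, Set.mem_pi, Finset.mem_coe]
      refine forall₂_congr fun j hj => ?_
      rw [Function.update_of_ne (by rintro rfl; exact hk hj)]
    simp_rw [e, Measure.infinitePi_pi _ fun i _ => ht i]
    rw [Finset.sum_const, Finset.card_univ, Fintype.card_fin, nsmul_eq_mul, ← mul_assoc,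
      ENNReal.inv_mul_cancel (by simpa using NeZero.ne R) (by simp), one_mul]

/-- The mean of `F` is the mean over the draws of the average of `F` over the `k`-th draw. -/
theorem lintegral_redraw (k : ℕ) {F : (ℕ → Fin R) → ℝ≥0∞} (hF : Measurable F) :
    ∫⁻ ω, F ω ∂(uniformDraws R)
      = ∫⁻ ω, (R : ℝ≥0∞)⁻¹ * ∑ r, F (Function.update ω k r) ∂(uniformDraws R) := by
  conv_lhs => rw [uniformDraws_eq_redraw k]
  rw [lintegral_smul_measure, lintegral_finsetSum_measure, smul_eq_mul,
    lintegral_const_mul _ (Finset.measurable_fun_sum _ fun r _ => by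
      exact hF.comp (measurable_redraw k r)),
    lintegral_finsetSum _ fun r _ => by exact hF.comp (measurable_redraw k r)]
  simp_rw [lintegral_map hF (measurable_redraw k _)]

end Draws

/-! ### Runs of the two methods -/

namespace DirHypergraph

open RAM

variable {N R : ℕ} {G : DirHypergraph N R} {α : ℝ} {p₀ : Fin N → ℝ}

/-- The memory of RCD after `k` iterations with the draws `ω`. -/
noncomputable def rcdMem (G : DirHypergraph N R) (α : ℝ) (p₀ : Fin N → ℝ) (ω : ℕ → Fin R) (k : ℕ) :
    Mem N R := (G.rcdLoop ω k (G.initMem α p₀).val).val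

/-- The memory of AP after `k` iterations. -/
noncomputable def apMem (G : DirHypergraph N R) (α : ℝ) (p₀ : Fin N → ℝ) (k : ℕ) :
    Mem N R := (G.apLoop k (G.initMem α p₀).val).val

theorem rcdMem_succ (ω : ℕ → Fin R) (k : ℕ) :
    G.rcdMem α p₀ ω (k + 1) = (G.rcdStep (ω k) (G.rcdMem α p₀ ω k)).val := rfl

theorem memInv_rcdMem (h0 : 0 < α) (h1 : α < 1) (ω : ℕ → Fin R) (k : ℕ) :
    G.MemInv α p₀ (G.rcdMem α p₀ ω k) := by
  induction k with
  | zero => exact G.memInv_init α p₀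
  | succ k ih => exact (MemInv.rcdStep h0 h1 ih (ω k)).1

theorem memInv_apMem (h0 : 0 < α) (h1 : α < 1) (k : ℕ) : G.MemInv α p₀ (G.apMem α p₀ k) := by
  induction k with
  | zero => exact G.memInv_init α p₀
  | succ k ih => exact (MemInv.apStep h0 h1 ih).1

theorem rcdMem_congr {ω ω' : ℕ → Fin R} {k : ℕ} (h : ∀ j < k, ω j = ω' j) :
    G.rcdMem α p₀ ω k = G.rcdMem α p₀ ω' k := by
  induction k with
  | zero => rfl
  | succ k ih => rw [rcdMem_succ, rcdMem_succ, ih fun j hj => h j (by omega), h k (by omega)]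

theorem rcdMem_update (ω : ℕ → Fin R) (k : ℕ) (r : Fin R) :
    G.rcdMem α p₀ (Function.update ω k r) k = G.rcdMem α p₀ ω k :=
  rcdMem_congr fun _ hj => Function.update_of_ne hj.ne _ _

theorem rcd_val (h0 : 0 < α) (h1 : α < 1) (ω : ℕ → Fin R) (k : ℕ) :
    (G.rcd α p₀ ω k).val = ⟨dualOf (G.rcdMem α p₀ ω k),
      primalOf (G.W α) (G.x0 p₀) (dualOf (G.rcdMem α p₀ ω k))⟩ :=
  (memInv_rcdMem h0 h1 ω k).output_val

theorem ap_val (h0 : 0 < α) (h1 : α < 1) (k : ℕ) :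
    (G.ap α p₀ k).val = ⟨dualOf (G.apMem α p₀ k),
      primalOf (G.W α) (G.x0 p₀) (dualOf (G.apMem α p₀ k))⟩ :=
  (memInv_apMem h0 h1 k).output_val

theorem dualOf_initMem : dualOf (G.initMem α p₀).val = 0 := by
  rw [initMem_val]
  rfl

/-! ### Time of the two methods -/

/-- The bound for the time of an RCD iteration with the hyperedge `r`. -/
noncomputable def stepCost (G : DirHypergraph N R) (r : Fin R) : ℝ :=
  240 * ((G.S r).card * Real.log (G.S r).card)

theorem two_le_stepCost (h0 : 0 < α) (h1 : α < 1) (r : Fin R) : 2 ≤ G.stepCost r := by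
  have h := rcdStep_time_le h0 h1 (G.memInv_init α 0) r
  have h2 : (0 : ℝ) ≤ (G.rcdStep r (G.initMem α 0).val).time := Nat.cast_nonneg _
  rw [stepCost]
  linarith

theorem sum_stepCost : ∑ r, G.stepCost r = 240 * G.sortCost := by
  rw [sortCost, Finset.mul_sum]
  rfl

theorem one_le_sortCost [NeZero R] : 1 ≤ G.sortCost := by
  have h := G.sum_card_le
  have h2 := (G.two_le_card 0).trans (Finset.single_le_sum (f := fun r => (G.S r).card)
    (fun _ _ => Nat.zero_le _) (Finset.mem_univ (0 : Fin R)))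
  have h3 : (2 : ℝ) ≤ ((∑ r, (G.S r).card : ℕ) : ℝ) := by exact_mod_cast h2
  linarith

theorem rcd_time_le [NeZero R] (h0 : 0 < α) (h1 : α < 1) (ω : ℕ → Fin R) (k : ℕ) :
    ((G.rcd α p₀ ω k).time : ℝ) ≤ 70 * G.sortCost + ∑ j ∈ Finset.range k, G.stepCost (ω j) := by
  have hloop : ((G.rcdLoop ω k (G.initMem α p₀).val).time : ℝ)
      ≤ ∑ j ∈ Finset.range k, G.stepCost (ω j) := by
    induction k with
    | zero => simp [rcdLoop]
    | succ k ih =>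
      have h := rcdStep_time_le h0 h1 (memInv_rcdMem (G := G) (p₀ := p₀) h0 h1 ω k) (ω k)
      have e : (G.rcdLoop ω (k + 1) (G.initMem α p₀).val).time
          = (G.rcdLoop ω k (G.initMem α p₀).val).time
            + (1 + (1 + (G.rcdStep (ω k) (G.rcdMem α p₀ ω k)).time)) := rfl
      rw [e, Finset.sum_range_succ]
      push_cast
      rw [stepCost]
      linarith
  have h := G.init_output_time_le α p₀ (G.rcdMem α p₀ ω k)
  have e : (G.rcd α p₀ ω k).time = (G.initMem α p₀).time
      + ((G.rcdLoop ω k (G.initMem α p₀).val).time + (output (G.rcdMem α p₀ ω k)).time) := rfl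
  rw [e]
  push_cast
  linarith

theorem ap_time_le [NeZero R] (h0 : 0 < α) (h1 : α < 1) (k : ℕ) :
    ((G.ap α p₀ k).time : ℝ) ≤ 70 * G.sortCost + k * (250 * G.sortCost) := by
  have hloop : ((G.apLoop k (G.initMem α p₀).val).time : ℝ) ≤ k * (250 * G.sortCost) := by
    induction k with
    | zero => simp [apLoop]
    | succ k ih =>
      have h := apStep_time_le h0 h1 (memInv_apMem (G := G) (p₀ := p₀) h0 h1 k)
      have e : (G.apLoop (k + 1) (G.initMem α p₀).val).time
          = (G.apLoop k (G.initMem α p₀).val).time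
            + (1 + (G.apStep (G.apMem α p₀ k)).time) := rfl
      rw [e]
      push_cast
      linarith
  have h := G.init_output_time_le α p₀ (G.apMem α p₀ k)
  have e : (G.ap α p₀ k).time = (G.initMem α p₀).time
      + ((G.apLoop k (G.initMem α p₀).val).time + (output (G.apMem α p₀ k)).time) := rfl
  rw [e]
  push_cast
  linarith

/-! ### Means over the draws of RCD -/

/-- The hyperedge of the iteration `k` is independent of the memory before it. -/
theorem lintegral_draw_mem [NeZero R] (k : ℕ) (F : Fin R → Mem N R → ℝ≥0∞) :
    ∫⁻ ω, F (ω k) (G.rcdMem α p₀ ω k) ∂(uniformDraws R)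
      = ∫⁻ ω, (R : ℝ≥0∞)⁻¹ * ∑ r, F r (G.rcdMem α p₀ ω k) ∂(uniformDraws R) := by
  have hm : Measurable fun ω : ℕ → Fin R => F (ω k) (G.rcdMem α p₀ ω k) :=
    measurable_of_prefix (k := k + 1) fun ω ω' h => by
      rw [h k (by omega), rcdMem_congr fun j hj => h j (by omega)]
  rw [lintegral_redraw k hm]
  simp only [Function.update_self, rcdMem_update]

theorem measurable_rcdMem [NeZero R] (k : ℕ) (F : Mem N R → ℝ≥0∞) :
    Measurable fun ω => F (G.rcdMem α p₀ ω k) :=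
  measurable_of_prefix fun _ _ h => by rw [rcdMem_congr h]

/-- The mean potential after `k` iterations of RCD. -/
theorem lintegral_rcdPotential_le [NeZero R] (h0 : 0 < α) (h1 : α < 1) (k : ℕ) :
    ∫⁻ ω, ENNReal.ofReal (G.rcdPotential α p₀ (dualOf (G.rcdMem α p₀ ω k))) ∂(uniformDraws R)
      ≤ ENNReal.ofReal ((1 - 1 / (R * (100 * G.rcdCond α))) ^ k * G.rcdPotential α p₀ 0) := by
  have hR : (1 : ℝ) ≤ R := by exact_mod_cast Nat.one_le_iff_ne_zero.2 (NeZero.ne R)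
  have hκ := (G.rcdCond_spec h0 h1).1
  set ρ := 1 - 1 / (R * (100 * G.rcdCond α)) with hρ
  have hρ0 : 0 ≤ ρ := by
    rw [hρ, sub_nonneg, div_le_one (by positivity)]
    nlinarith
  induction k with
  | zero =>
    have e : ∀ ω : ℕ → Fin R, dualOf (G.rcdMem α p₀ ω 0) = 0 := fun _ => dualOf_initMem
    simp [e]
  | succ k ih =>
    simp_rw [rcdMem_succ]
    rw [lintegral_draw_mem k fun r M =>
      ENNReal.ofReal (G.rcdPotential α p₀ (dualOf (G.rcdStep r M).val))]
    calc ∫⁻ ω, (R : ℝ≥0∞)⁻¹ * ∑ r, ENNReal.ofReal (G.rcdPotential α p₀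
            (dualOf (G.rcdStep r (G.rcdMem α p₀ ω k)).val)) ∂(uniformDraws R)
        ≤ ∫⁻ ω, ENNReal.ofReal ρ * ENNReal.ofReal (G.rcdPotential α p₀
            (dualOf (G.rcdMem α p₀ ω k))) ∂(uniformDraws R) := by
          refine lintegral_mono fun ω => ?_
          have hM := memInv_rcdMem (G := G) (p₀ := p₀) h0 h1 ω k
          choose hinv p hp hset using fun r => MemInv.rcdStep h0 h1 hM r
          have h := sum_rcdPotential_le h0 h1 hM.mem p hp
          simp_rw [← hset] at h
          rw [← ENNReal.ofReal_sum_of_nonneg fun r _ => rcdPotential_nonneg h0 h1 (hinv r).mem,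
            ← ENNReal.ofReal_natCast, ← ENNReal.ofReal_inv_of_pos (by linarith),
            ← ENNReal.ofReal_mul (by positivity), ← ENNReal.ofReal_mul hρ0]
          refine ENNReal.ofReal_le_ofReal ?_
          rw [inv_mul_le_iff₀ (by linarith)]
          refine h.trans (le_of_eq ?_)
          rw [hρ]
          field_simp
      _ = ENNReal.ofReal ρ * ∫⁻ ω, ENNReal.ofReal (G.rcdPotential α p₀
            (dualOf (G.rcdMem α p₀ ω k))) ∂(uniformDraws R) :=
          lintegral_const_mul _ (measurable_rcdMem k fun M =>
            ENNReal.ofReal (G.rcdPotential α p₀ (dualOf M)))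
      _ ≤ ENNReal.ofReal ρ * ENNReal.ofReal (ρ ^ k * G.rcdPotential α p₀ 0) := by gcongr
      _ = ENNReal.ofReal (ρ ^ (k + 1) * G.rcdPotential α p₀ 0) := by
          rw [← ENNReal.ofReal_mul hρ0]
          ring_nf

/-- The mean cost of an iteration, restricted to an event of the past. -/
theorem lintegral_stepCost [NeZero R] (h0 : 0 < α) (h1 : α < 1) (k : ℕ) (F : Mem N R → ℝ≥0∞) :
    ∫⁻ ω, F (G.rcdMem α p₀ ω k) * ENNReal.ofReal (G.stepCost (ω k)) ∂(uniformDraws R)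
      = ENNReal.ofReal (240 * G.sortCost / R)
        * ∫⁻ ω, F (G.rcdMem α p₀ ω k) ∂(uniformDraws R) := by
  have hR : (0 : ℝ) < R := by exact_mod_cast Nat.pos_of_ne_zero (NeZero.ne R)
  rw [lintegral_draw_mem k fun r M => F M * ENNReal.ofReal (G.stepCost r),
    ← lintegral_const_mul _ (measurable_rcdMem k F)]
  refine lintegral_congr fun ω => ?_
  rw [← Finset.mul_sum, ← ENNReal.ofReal_sum_of_nonneg fun r _ =>
    (zero_le_two.trans (two_le_stepCost h0 h1 r)), sum_stepCost, mul_left_comm, mul_comm,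
    div_eq_inv_mul, ENNReal.ofReal_mul (inv_nonneg.2 hR.le), ENNReal.ofReal_inv_of_pos hR,
    ENNReal.ofReal_natCast]

/-- The expected time of `k` iterations of RCD. -/
theorem lintegral_rcd_time_le [NeZero R] (h0 : 0 < α) (h1 : α < 1) (k : ℕ) :
    ∫⁻ ω, ((G.rcd α p₀ ω k).time : ℝ≥0∞) ∂(uniformDraws R)
      ≤ ENNReal.ofReal (70 * G.sortCost + k * (240 * G.sortCost / R)) := by
  have hs := G.one_le_sortCost
  have hc : ∀ r, 0 ≤ G.stepCost r := fun r => zero_le_two.trans (two_le_stepCost h0 h1 r)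
  have hm : ∀ j, Measurable fun ω : ℕ → Fin R => ENNReal.ofReal (G.stepCost (ω j)) := fun j =>
    measurable_of_prefix (k := j + 1) fun ω ω' h => by rw [h j (by omega)]
  calc ∫⁻ ω, ((G.rcd α p₀ ω k).time : ℝ≥0∞) ∂(uniformDraws R)
      ≤ ∫⁻ ω, (ENNReal.ofReal (70 * G.sortCost)
          + ∑ j ∈ Finset.range k, ENNReal.ofReal (G.stepCost (ω j))) ∂(uniformDraws R) := by
        refine lintegral_mono fun ω => ?_
        rw [← ENNReal.ofReal_sum_of_nonneg fun j _ => hc _,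
          ← ENNReal.ofReal_add (by linarith) (Finset.sum_nonneg fun j _ => hc _),
          ← ENNReal.ofReal_natCast]
        exact ENNReal.ofReal_le_ofReal (rcd_time_le h0 h1 ω k)
    _ = ENNReal.ofReal (70 * G.sortCost) + ∑ _j ∈ Finset.range k,
          ENNReal.ofReal (240 * G.sortCost / R) := by
        rw [lintegral_add_left measurable_const, lintegral_finsetSum _ fun j _ => hm j]
        have h := fun j => lintegral_stepCost (G := G) (p₀ := p₀) h0 h1 j fun _ => 1
        simp only [one_mul, lintegral_const, measure_univ, mul_one] at h
        simp [h]
    _ = ENNReal.ofReal (70 * G.sortCost + k * (240 * G.sortCost / R)) := by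
        rw [Finset.sum_const, Finset.card_range, ENNReal.ofReal_add (by linarith) (by positivity),
          ENNReal.ofReal_mul (Nat.cast_nonneg k), ENNReal.ofReal_natCast, nsmul_eq_mul]

/-- The time until the distance to the solution set is at most `ε` for the first time is bounded by
the costs of the iterations that start at a larger distance. -/
theorem hitting_time_le [NeZero R] (h0 : 0 < α) (h1 : α < 1) (ε : ℝ) (ω : ℕ → Fin R) :
    (⨅ (k : ℕ) (_ : G.rcdDist α p₀ (dualOf (G.rcdMem α p₀ ω k)) ≤ ε),
        ((G.rcd α p₀ ω k).time : ℝ≥0∞))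
      ≤ ENNReal.ofReal (70 * G.sortCost)
        + ∑' j, {M | ε < G.rcdDist α p₀ (dualOf M)}.indicator (fun _ => (1 : ℝ≥0∞))
            (G.rcdMem α p₀ ω j) * ENNReal.ofReal (G.stepCost (ω j)) := by
  classical
  have hs := G.one_le_sortCost
  have hc : ∀ r, 2 ≤ G.stepCost r := two_le_stepCost h0 h1
  by_cases hex : ∃ k, G.rcdDist α p₀ (dualOf (G.rcdMem α p₀ ω k)) ≤ ε
  · set k := Nat.find hex with hk
    refine (iInf₂_le k (Nat.find_spec hex)).trans ?_
    have h := ENNReal.ofReal_le_ofReal (rcd_time_le (G := G) (p₀ := p₀) h0 h1 ω k)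
    rw [ENNReal.ofReal_natCast, ENNReal.ofReal_add (by linarith)
      (Finset.sum_nonneg fun j _ => zero_le_two.trans (hc _)),
      ENNReal.ofReal_sum_of_nonneg fun j _ => zero_le_two.trans (hc _)] at h
    refine h.trans (add_le_add le_rfl (le_trans ?_ (ENNReal.sum_le_tsum (Finset.range k))))
    refine Finset.sum_le_sum fun j hj => ?_
    have hj' := Nat.find_min hex (Finset.mem_range.1 hj)
    rw [Set.indicator_of_mem (by simpa using hj'), one_mul]
  · -- if the distance is never small, infinitely many terms are at least `1`
    have htop : ∑' j, {M | ε < G.rcdDist α p₀ (dualOf M)}.indicator (fun _ => (1 : ℝ≥0∞))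
        (G.rcdMem α p₀ ω j) * ENNReal.ofReal (G.stepCost (ω j)) = ⊤ := by
      rw [eq_top_iff, ← ENNReal.tsum_const_eq_top_of_ne_zero (α := ℕ) one_ne_zero]
      refine ENNReal.tsum_le_tsum fun j => ?_
      rw [Set.indicator_of_mem (by simpa using fun h => hex ⟨j, h⟩), one_mul,
        ← ENNReal.ofReal_one]
      exact ENNReal.ofReal_le_ofReal (by linarith [hc (ω j)])
    rw [htop]
    simp

end DirHypergraph

/-! ### The complexity bounds -/

theorem pow_le_of_log_le {m M ε : ℝ} (hm : 1 ≤ m) (hM : 0 < M) (hε : 0 < ε) {k : ℕ}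
    (hk : 2 * m * Real.log (M / ε) ≤ k) : (1 - 1 / m) ^ k ≤ (ε / M) ^ 2 := by
  have hm0 : 0 < m := by linarith
  have h1 : 0 ≤ 1 - 1 / m := by
    rw [sub_nonneg, div_le_one hm0]
    exact hm
  calc (1 - 1 / m) ^ k ≤ Real.exp (-(1 / m)) ^ k :=
        pow_le_pow_left₀ h1 (Real.one_sub_le_exp_neg _) k
    _ = Real.exp (-(k / m)) := by
        rw [← Real.exp_nat_mul]
        ring_nf
    _ ≤ Real.exp (-(2 * Real.log (M / ε))) := by
        refine Real.exp_le_exp.2 (neg_le_neg ?_)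
        rw [le_div_iff₀ hm0]
        linarith
    _ = (ε / M) ^ 2 := by
        rw [← inv_div M ε, Real.exp_neg, inv_pow, two_mul, Real.exp_add,
          Real.exp_log (by positivity), sq]

/-- The logarithm in the complexity bounds is at least `1 / 2`, since `ε ≤ 1 / 2`. -/
theorem half_le_log {M ε : ℝ} (hM : 1 ≤ M) (hε : 0 < ε) (hε2 : ε ≤ 1 / 2) :
    1 / 2 ≤ Real.log (M / ε) := by
  have h : (2 : ℝ) ≤ M / ε := by
    rw [le_div_iff₀ hε]
    linarith
  have h2 := Real.log_le_log two_pos h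
  linarith [Real.log_two_gt_d9]

namespace DirHypergraph

variable {N R : ℕ} [NeZero R] {G : DirHypergraph N R} {α : ℝ} {p₀ : Fin N → ℝ}

theorem one_le_R : (1 : ℝ) ≤ R := by exact_mod_cast Nat.one_le_iff_ne_zero.2 (NeZero.ne R)

/-- With `m = 100 κ R`, at least `2 m log(max{1, Φ₀}/ε)` iterations of RCD make the mean potential
at most `ε²`. -/
theorem rcdPotential_decay_le_sq (h0 : 0 < α) (h1 : α < 1) {ε : ℝ} (hε : 0 < ε) {k : ℕ}
    (hk : 2 * (R * (100 * G.rcdCond α)) * Real.log (max 1 (G.rcdPotential α p₀ 0) / ε) ≤ k) :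
    (1 - 1 / (R * (100 * G.rcdCond α))) ^ k * G.rcdPotential α p₀ 0 ≤ ε ^ 2 := by
  have hκ := (G.rcdCond_spec h0 h1).1
  have hR := one_le_R (R := R)
  set M := max 1 (G.rcdPotential α p₀ 0) with hM
  have hM1 : 1 ≤ M := le_max_left _ _
  have h := pow_le_of_log_le (m := R * (100 * G.rcdCond α)) (by nlinarith) (by linarith) hε hk
  calc (1 - 1 / (R * (100 * G.rcdCond α))) ^ k * G.rcdPotential α p₀ 0
      ≤ (ε / M) ^ 2 * M :=
        mul_le_mul h (le_max_right _ _) (rcdPotential_nonneg h0 h1 G.zero_mem_prodCone)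
          (sq_nonneg _)
    _ = ε ^ 2 / M := by field_simp
    _ ≤ ε ^ 2 := div_le_self (sq_nonneg _) hM1

/-- The expected time of RCD until the distance to the solution set is at most `ε`. Up to iteration
`K` every iteration is charged; afterwards iteration `j` is charged with the probability that the
distance still exceeds `ε`, which decays geometrically. -/
theorem lintegral_hitting_time_le (h0 : 0 < α) (h1 : α < 1) {ε : ℝ} (hε : 0 < ε) {K : ℕ}
    (hK : 2 * (R * (100 * G.rcdCond α)) * Real.log (max 1 (G.rcdPotential α p₀ 0) / ε) ≤ K) :
    ∫⁻ ω, (⨅ (k : ℕ) (_ : G.rcdDist α p₀ (dualOf (G.rcdMem α p₀ ω k)) ≤ ε),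
        ((G.rcd α p₀ ω k).time : ℝ≥0∞)) ∂(uniformDraws R)
      ≤ ENNReal.ofReal (70 * G.sortCost
        + (K + R * (100 * G.rcdCond α)) * (240 * G.sortCost / R)) := by
  have hκ := (G.rcdCond_spec h0 h1).1
  have hR := one_le_R (R := R)
  have hs := G.one_le_sortCost
  set m := R * (100 * G.rcdCond α) with hm
  have hm1 : 1 ≤ m := by nlinarith
  set ρ := 1 - 1 / m with hρ
  have hρ0 : 0 ≤ ρ := by
    rw [hρ, sub_nonneg, div_le_one (by linarith)]
    exact hm1
  have hρ1 : ρ < 1 := by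
    rw [hρ, sub_lt_self_iff]
    positivity
  set I : Mem N R → ℝ≥0∞ :=
    {M | ε < G.rcdDist α p₀ (dualOf M)}.indicator (fun _ => (1 : ℝ≥0∞)) with hI
  have hI1 : ∀ M, I M ≤ 1 := fun M => Set.indicator_le_self' (by simp) M
  -- the probability that iteration `j` starts at distance larger than `ε`
  have hprob : ∀ j, ∫⁻ ω, I (G.rcdMem α p₀ ω j) ∂(uniformDraws R) ≤ 1 := fun j => by
    refine (lintegral_mono fun ω => hI1 _).trans ?_
    simp
  have htail : ∀ j, ∫⁻ ω, I (G.rcdMem α p₀ ω (j + K)) ∂(uniformDraws R)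
      ≤ ENNReal.ofReal (ρ ^ j) := fun j => by
    calc ∫⁻ ω, I (G.rcdMem α p₀ ω (j + K)) ∂(uniformDraws R)
        ≤ ∫⁻ ω, ENNReal.ofReal (1 / ε ^ 2) * ENNReal.ofReal
            (G.rcdPotential α p₀ (dualOf (G.rcdMem α p₀ ω (j + K)))) ∂(uniformDraws R) := by
          refine lintegral_mono fun ω => ?_
          have hz := (memInv_rcdMem (G := G) (p₀ := p₀) h0 h1 ω (j + K)).mem
          by_cases hmem : ε < G.rcdDist α p₀ (dualOf (G.rcdMem α p₀ ω (j + K)))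
          · refine (hI1 _).trans ?_
            rw [← ENNReal.ofReal_mul (by positivity), ← ENNReal.ofReal_one]
            refine ENNReal.ofReal_le_ofReal ?_
            rw [one_div_mul_eq_div, le_div_iff₀ (by positivity), one_mul, rcdPotential]
            have := dualGap_nonneg h0 h1 (p₀ := p₀) hz
            nlinarith
          · rw [hI, Set.indicator_of_notMem (by simpa using hmem)]
            exact zero_le
      _ = ENNReal.ofReal (1 / ε ^ 2) * ∫⁻ ω, ENNReal.ofReal
            (G.rcdPotential α p₀ (dualOf (G.rcdMem α p₀ ω (j + K)))) ∂(uniformDraws R) :=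
          lintegral_const_mul _ (measurable_rcdMem _ fun M =>
            ENNReal.ofReal (G.rcdPotential α p₀ (dualOf M)))
      _ ≤ ENNReal.ofReal (1 / ε ^ 2) * ENNReal.ofReal (ρ ^ (j + K) * G.rcdPotential α p₀ 0) :=
          mul_le_mul_right (lintegral_rcdPotential_le h0 h1 _) _
      _ ≤ ENNReal.ofReal (ρ ^ j) := by
          rw [← ENNReal.ofReal_mul (by positivity)]
          refine ENNReal.ofReal_le_ofReal ?_
          have h := rcdPotential_decay_le_sq h0 h1 hε hK
          rw [one_div_mul_eq_div, div_le_iff₀ (by positivity), pow_add, mul_assoc]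
          exact mul_le_mul_of_nonneg_left h (pow_nonneg hρ0 j)
  have hgeom : ∑' j, ENNReal.ofReal (ρ ^ j) = ENNReal.ofReal m := by
    rw [← ENNReal.ofReal_tsum_of_nonneg (fun j => pow_nonneg hρ0 j)
      (summable_geometric_of_lt_one hρ0 hρ1), tsum_geometric_of_lt_one hρ0 hρ1, hρ]
    congr 1
    field_simp
    ring
  have hsum : ∑' j, ∫⁻ ω, I (G.rcdMem α p₀ ω j) ∂(uniformDraws R)
      ≤ ENNReal.ofReal (K + m) := by
    rw [← ENNReal.summable.sum_add_tsum_nat_add' (k := K),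
      ENNReal.ofReal_add (Nat.cast_nonneg K) (by linarith), ← hgeom]
    refine add_le_add ?_ (ENNReal.tsum_le_tsum htail)
    refine (Finset.sum_le_sum fun j _ => hprob j).trans ?_
    simp
  have hmeas : ∀ j, Measurable fun ω : ℕ → Fin R =>
      I (G.rcdMem α p₀ ω j) * ENNReal.ofReal (G.stepCost (ω j)) := fun j =>
    measurable_of_prefix (k := j + 1) fun ω ω' h => by
      rw [h j (by omega), rcdMem_congr fun i hi => h i (by omega)]
  refine (lintegral_mono fun ω => hitting_time_le h0 h1 ε ω).trans ?_
  rw [lintegral_add_left measurable_const, lintegral_const, measure_univ, mul_one,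
    lintegral_tsum fun j => (hmeas j).aemeasurable]
  simp_rw [fun j => lintegral_stepCost (G := G) (p₀ := p₀) h0 h1 j I]
  rw [ENNReal.tsum_mul_left, mul_comm (_ + m) _, ENNReal.ofReal_add (by linarith) (by positivity),
    ENNReal.ofReal_mul (q := K + m) (by positivity)]
  gcongr

/-- All the estimates for RCD, with `κ = rcdCond` and `L` the logarithm. The `2 (100 κ R) L`
iterations and the `100 κ R` further ones expected before the distance is small cost `240 · 100 κ
(2 L + 1)` times `sortCost`; since `L ≥ 1 / 2` and `κ ≥ 1`, this, the rounding of the number of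
iterations and the initialization fit into the universal constant `10⁵`. -/
theorem rcd_bounds (h0 : 0 < α) (h1 : α < 1) {ε : ℝ} (hε : 0 < ε) (hε2 : ε ≤ 1 / 2) :
    (∃ K : ℕ,
      ∫⁻ ω, ((G.rcd α p₀ ω K).time : ℝ≥0∞) ∂(uniformDraws R)
        ≤ ENNReal.ofReal (10 ^ 5 * G.rcdRate α *
          Real.log (max 1 (G.dualGap α p₀ 0 + G.rcdDist α p₀ 0 ^ 2) / ε)) ∧
      ∀ k, K ≤ k →
        ∫⁻ ω, ENNReal.ofReal (G.dualGap α p₀ (G.rcd α p₀ ω k).val.dual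
          + G.rcdDist α p₀ (G.rcd α p₀ ω k).val.dual ^ 2) ∂(uniformDraws R)
            ≤ ENNReal.ofReal ε ∧
        ∫⁻ ω, ENNReal.ofReal (G.rcdDist α p₀ (G.rcd α p₀ ω k).val.dual) ∂(uniformDraws R)
            ≤ ENNReal.ofReal ε ∧
        ∀ p, G.IsPageRank α p₀ p →
          ∫⁻ ω, ENNReal.ofReal (wNormSq (G.W α) ((G.rcd α p₀ ω k).val.primal - G.x0 p))
            ∂(uniformDraws R) ≤ ENNReal.ofReal ε) ∧
    ∫⁻ ω, (⨅ (k : ℕ) (_ : G.rcdDist α p₀ (G.rcd α p₀ ω k).val.dual ≤ ε),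
      ((G.rcd α p₀ ω k).time : ℝ≥0∞)) ∂(uniformDraws R)
        ≤ ENNReal.ofReal (10 ^ 5 * G.rcdRate α *
          Real.log (max 1 (G.dualGap α p₀ 0 + G.rcdDist α p₀ 0 ^ 2) / ε)) := by
  simp only [rcd_val h0 h1]
  have hκ := (G.rcdCond_spec h0 h1).1
  have hR := one_le_R (R := R)
  have hs := G.one_le_sortCost
  have hrate : G.rcdRate α = G.rcdCond α * G.sortCost := rfl
  have hpot : G.dualGap α p₀ 0 + G.rcdDist α p₀ 0 ^ 2 = G.rcdPotential α p₀ 0 := rfl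
  rw [hpot, hrate]
  set L := Real.log (max 1 (G.rcdPotential α p₀ 0) / ε) with hL
  have hL2 : 1 / 2 ≤ L := half_le_log (le_max_left _ _) hε hε2
  set m := R * (100 * G.rcdCond α) with hm
  set K := ⌈2 * m * L⌉₊ with hK
  have hK1 : 2 * m * L ≤ K := Nat.le_ceil _
  have hm0 : 0 < m := by positivity
  have hK2 : (K : ℝ) ≤ 2 * m * L + 1 := (Nat.ceil_lt_add_one (by positivity)).le
  have hbudget : 70 * G.sortCost + (K + m) * (240 * G.sortCost / R)
      ≤ 10 ^ 5 * (G.rcdCond α * G.sortCost) * L := by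
    have hmR : m / R = 100 * G.rcdCond α := by
      rw [hm]
      field_simp
    have e1 : (K + m) / R ≤ 100 * G.rcdCond α * (2 * L + 1) + 1 := by
      calc (K + m) / R ≤ (2 * m * L + 1 + m) / R := by gcongr
        _ = m / R * (2 * L + 1) + 1 / R := by ring
        _ ≤ 100 * G.rcdCond α * (2 * L + 1) + 1 := by
            rw [hmR]
            gcongr
            rw [div_le_one (by linarith)]
            exact hR
    have e2 : 1 ≤ 2 * (G.rcdCond α * L) := by nlinarith
    have e3 : G.rcdCond α ≤ 2 * (G.rcdCond α * L) := by nlinarith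
    calc 70 * G.sortCost + (K + m) * (240 * G.sortCost / R)
        = G.sortCost * (70 + 240 * ((K + m) / R)) := by ring
      _ ≤ G.sortCost * (10 ^ 5 * (G.rcdCond α * L)) := by
          refine mul_le_mul_of_nonneg_left ?_ (by linarith)
          linarith
      _ = 10 ^ 5 * (G.rcdCond α * G.sortCost) * L := by ring
  refine ⟨⟨K, ?_, fun k hk => ?_⟩, ?_⟩
  · refine (lintegral_rcd_time_le h0 h1 K).trans (ENNReal.ofReal_le_ofReal (le_trans ?_ hbudget))
    gcongr
    linarith
  · have hsq : ∫⁻ ω, ENNReal.ofReal (G.rcdPotential α p₀ (dualOf (G.rcdMem α p₀ ω k)))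
        ∂(uniformDraws R) ≤ ENNReal.ofReal (ε ^ 2) :=
      (lintegral_rcdPotential_le h0 h1 k).trans (ENNReal.ofReal_le_ofReal
        (rcdPotential_decay_le_sq h0 h1 hε (hK1.trans (by exact_mod_cast hk))))
    have hlin : ∫⁻ ω, ENNReal.ofReal (G.rcdPotential α p₀ (dualOf (G.rcdMem α p₀ ω k)))
        ∂(uniformDraws R) ≤ ENNReal.ofReal ε :=
      hsq.trans (ENNReal.ofReal_le_ofReal (by nlinarith))
    refine ⟨hlin, ?_, fun p hp => ?_⟩
    · -- `2 ε d ≤ ε² + d²`, a form of the inequality of Jensen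
      have hpt : ∀ ω : ℕ → Fin R, ENNReal.ofReal (G.rcdDist α p₀ (dualOf (G.rcdMem α p₀ ω k)))
          ≤ ENNReal.ofReal (ε / 2) + ENNReal.ofReal (1 / (2 * ε)) * ENNReal.ofReal
            (G.rcdPotential α p₀ (dualOf (G.rcdMem α p₀ ω k))) := fun ω => by
        have hz := (memInv_rcdMem (G := G) (p₀ := p₀) h0 h1 ω k).mem
        rw [← ENNReal.ofReal_mul (by positivity), ← ENNReal.ofReal_add (by positivity)
          (mul_nonneg (by positivity) (rcdPotential_nonneg h0 h1 hz))]
        refine ENNReal.ofReal_le_ofReal ?_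
        have e : ε / 2 + 1 / (2 * ε) * G.rcdPotential α p₀ (dualOf (G.rcdMem α p₀ ω k))
            = (ε ^ 2 + G.rcdPotential α p₀ (dualOf (G.rcdMem α p₀ ω k))) / (2 * ε) := by
          field_simp
        rw [e, le_div_iff₀ (by positivity), rcdPotential]
        have := dualGap_nonneg h0 h1 (p₀ := p₀) hz
        nlinarith [sq_nonneg (ε - G.rcdDist α p₀ (dualOf (G.rcdMem α p₀ ω k)))]
      refine (lintegral_mono hpt).trans ?_
      rw [lintegral_add_left measurable_const, lintegral_const, measure_univ, mul_one,
        lintegral_const_mul _ (measurable_rcdMem k fun M =>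
            ENNReal.ofReal (G.rcdPotential α p₀ (dualOf M)))]
      refine (add_le_add le_rfl (mul_le_mul_right hsq _)).trans ?_
      rw [← ENNReal.ofReal_mul (by positivity), ← ENNReal.ofReal_add (by positivity)
        (by positivity)]
      refine ENNReal.ofReal_le_ofReal (le_of_eq ?_)
      field_simp
      ring
    · refine le_trans (lintegral_mono fun ω => ENNReal.ofReal_le_ofReal ?_) hlin
      have hz := (memInv_rcdMem (G := G) (p₀ := p₀) h0 h1 ω k).mem
      exact (primal_error_le_dualGap h0 h1 hp hz).trans (le_add_of_nonneg_right (sq_nonneg _))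
  · exact (lintegral_hitting_time_le h0 h1 hε hK1).trans (ENNReal.ofReal_le_ofReal hbudget)

/-- All the estimates for AP; the constant `10⁵` arises as for RCD. -/
theorem ap_bounds (h0 : 0 < α) (h1 : α < 1) {ε : ℝ} (hε : 0 < ε) (hε2 : ε ≤ 1 / 2) :
    ∃ K : ℕ,
      ((G.ap α p₀ K).time : ℝ) ≤
        10 ^ 5 * G.apRate α * Real.log (max 1 (G.apDist α p₀ 0) / ε) ∧
      ∀ k, K ≤ k →
        G.apDist α p₀ (G.ap α p₀ k).val.dual ≤ ε ∧
        ∀ p, G.IsPageRank α p₀ p →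
          √(wNormSq (G.W α) ((G.ap α p₀ k).val.primal - G.x0 p)) ≤ ε := by
  simp only [ap_val h0 h1]
  have hκ := (G.apCond_spec h0 h1).1
  have hs := G.one_le_sortCost
  have hrate : G.apRate α = G.apCond α * G.sortCost := rfl
  rw [hrate]
  set M := max 1 (G.apDist α p₀ 0) with hM
  have hM1 : 1 ≤ M := le_max_left _ _
  set L := Real.log (M / ε) with hL
  have hL2 : 1 / 2 ≤ L := half_le_log hM1 hε hε2
  set m := 100 * G.apCond α with hm
  set K := ⌈2 * m * L⌉₊ with hK
  have hK1 : 2 * m * L ≤ K := Nat.le_ceil _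
  have hm0 : 0 < m := by positivity
  have hK2 : (K : ℝ) ≤ 2 * m * L + 1 := (Nat.ceil_lt_add_one (by positivity)).le
  have hdist : ∀ k, G.apDist α p₀ (dualOf (G.apMem α p₀ k)) ^ 2
      ≤ (1 - 1 / m) ^ k * G.apDist α p₀ 0 ^ 2 := by
    intro k
    induction k with
    | zero =>
      have e : dualOf (G.apMem α p₀ 0) = 0 := dualOf_initMem
      simp [e]
    | succ k ih =>
      have hMk := memInv_apMem (G := G) (p₀ := p₀) h0 h1 k
      refine (apDist_step_sq_le h0 h1 hMk.mem (MemInv.apStep h0 h1 hMk).2).trans ?_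
      rw [pow_succ' _ k, mul_assoc]
      refine mul_le_mul_of_nonneg_left ih ?_
      rw [sub_nonneg, div_le_one hm0]
      linarith
  have hfinal : ∀ k, K ≤ k → G.apDist α p₀ (dualOf (G.apMem α p₀ k)) ≤ ε := by
    intro k hk
    refine le_of_sq_le_sq ?_ hε.le
    have h := pow_le_of_log_le (m := m) (by linarith) (by linarith) hε
      (hK1.trans (Nat.cast_le.2 hk))
    calc G.apDist α p₀ (dualOf (G.apMem α p₀ k)) ^ 2
        ≤ (1 - 1 / m) ^ k * G.apDist α p₀ 0 ^ 2 := hdist k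
      _ ≤ (ε / M) ^ 2 * M ^ 2 :=
          mul_le_mul h (pow_le_pow_left₀ (dualDist_nonneg _ _ _) (le_max_right _ _) 2)
            (sq_nonneg _) (sq_nonneg _)
      _ = ε ^ 2 := by field_simp
  refine ⟨K, ?_, fun k hk => ⟨hfinal k hk, fun p hp => ?_⟩⟩
  · refine (ap_time_le h0 h1 K).trans ?_
    have e2 : 1 ≤ 2 * (G.apCond α * L) := by nlinarith
    calc 70 * G.sortCost + K * (250 * G.sortCost) = G.sortCost * (70 + 250 * K) := by ring
      _ ≤ G.sortCost * (10 ^ 5 * (G.apCond α * L)) := by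
          refine mul_le_mul_of_nonneg_left ?_ (by linarith)
          rw [hm] at hK2
          linarith
      _ = 10 ^ 5 * (G.apCond α * G.sortCost) * L := by ring
  · exact (primal_error_le_apDist h0 h1 hp (memInv_apMem h0 h1 k).mem).trans (hfinal k hk)

end DirHypergraph

theorem mainTheorem10 :
    ∃ C : ℝ, 0 < C ∧
      ∀ (N R : ℕ) [NeZero R] (G : DirHypergraph N R) (α : ℝ), 0 < α → α < 1 →
      ∀ p₀ : Fin N → ℝ,
      -- PageRank is the solution of a QDSFM problem with `W = (α / (1 - α)) D`
      (∀ r, IsNormalizedSubmodular (G.wcut r)) ∧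
      (∃! x, IsMinOn (qdsfm G.wcut (G.W α) (G.x0 p₀)) Set.univ x) ∧
      (∀ p : Fin N → ℝ, G.IsPageRank α p₀ p ↔
        IsMinOn (qdsfm G.wcut (G.W α) (G.x0 p₀)) Set.univ (G.x0 p)) ∧
      (G.prSol α p₀).Nonempty ∧
      -- the projection is exact and takes `O(|S_r| log |S_r|)` steps
      (∀ (r : Fin R) (b V : Fin N → ℝ), (∀ i, 0 < V i) →
        let out := Projection.project (G.w r)
          ((G.entries r).map fun e => (⟨e, b e.vtx, V e.vtx⟩ : Item N))
        IsConeProj (G.wcut r) b V⁻¹ (Projection.scatter out.val.1, out.val.2) ∧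
        (out.time : ℝ) ≤ C * ((G.S r).card * Real.log (G.S r).card)) ∧
      -- RCD
      (∀ ω k, (G.rcd α p₀ ω k).val.dual ∈ prodCone G.wcut) ∧
      (∀ ε : ℝ, 0 < ε → ε ≤ 1 / 2 →
        let B := C * G.rcdRate α *
          Real.log (max 1 (G.dualGap α p₀ 0 + G.rcdDist α p₀ 0 ^ 2) / ε)
        -- a fixed number of iterations: the expected error is at most `ε`
        (∃ K : ℕ,
          ∫⁻ ω, ((G.rcd α p₀ ω K).time : ℝ≥0∞) ∂(uniformDraws R) ≤ ENNReal.ofReal B ∧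
          ∀ k, K ≤ k →
            ∫⁻ ω, ENNReal.ofReal (G.dualGap α p₀ (G.rcd α p₀ ω k).val.dual
              + G.rcdDist α p₀ (G.rcd α p₀ ω k).val.dual ^ 2) ∂(uniformDraws R)
                ≤ ENNReal.ofReal ε ∧
            ∫⁻ ω, ENNReal.ofReal (G.rcdDist α p₀ (G.rcd α p₀ ω k).val.dual) ∂(uniformDraws R)
                ≤ ENNReal.ofReal ε ∧
            ∀ p, G.IsPageRank α p₀ p →
              ∫⁻ ω, ENNReal.ofReal (wNormSq (G.W α) ((G.rcd α p₀ ω k).val.primal - G.x0 p))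
                ∂(uniformDraws R) ≤ ENNReal.ofReal ε) ∧
        -- the expected time until the distance to the solution set is at most `ε`
        ∫⁻ ω, (⨅ (k : ℕ) (_ : G.rcdDist α p₀ (G.rcd α p₀ ω k).val.dual ≤ ε),
          ((G.rcd α p₀ ω k).time : ℝ≥0∞)) ∂(uniformDraws R) ≤ ENNReal.ofReal B) ∧
      -- AP
      (∀ k, (G.ap α p₀ k).val.dual ∈ prodCone G.wcut) ∧
      (∀ ε : ℝ, 0 < ε → ε ≤ 1 / 2 →
        ∃ K : ℕ,
          ((G.ap α p₀ K).time : ℝ) ≤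
            C * G.apRate α * Real.log (max 1 (G.apDist α p₀ 0) / ε) ∧
          ∀ k, K ≤ k →
            G.apDist α p₀ (G.ap α p₀ k).val.dual ≤ ε ∧
            ∀ p, G.IsPageRank α p₀ p →
              √(wNormSq (G.W α) ((G.ap α p₀ k).val.primal - G.x0 p)) ≤ ε) := by
  refine ⟨10 ^ 5, by norm_num, fun N R _ G α h0 h1 p₀ => ?_⟩
  have hW := G.W_pos h0 h1
  obtain ⟨z, hz⟩ := G.prSol_nonempty h0 h1 p₀
  refine ⟨G.isNormalizedSubmodular_wcut, ⟨_, (G.isMinOn_iff_eq_primalOf hW _ hz _).2 rfl,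
    fun x hx => (G.isMinOn_iff_eq_primalOf hW _ hz x).1 hx⟩, fun p => ?_, ⟨z, hz⟩,
    fun r b V hV => ⟨G.project_isConeProj r b V hV, ?_⟩, fun ω k => ?_,
    fun ε hε hε2 => DirHypergraph.rcd_bounds h0 h1 hε hε2, fun k => ?_,
    fun ε hε hε2 => DirHypergraph.ap_bounds h0 h1 hε hε2⟩
  · rw [G.isPageRank_iff h0 h1 hz, G.isMinOn_iff_eq_primalOf hW _ hz]
  · refine (G.project_items_time_le r b V).trans ?_
    have h : (0 : ℝ) ≤ (G.S r).card * Real.log (G.S r).card := by positivity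
    linarith
  · rw [DirHypergraph.rcd_val h0 h1]
    exact (DirHypergraph.memInv_rcdMem h0 h1 ω k).mem
  · rw [DirHypergraph.ap_val h0 h1]
    exact (DirHypergraph.memInv_apMem h0 h1 k).mem
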